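/- **Setting.** Let $X\subset\mathbb R^n$ be convex and compact with diameter $D_X>0$. Let $F:X\to\mathbb R^n$ be monotone with $\|F(x)-F(y)\|\le L\|x-y\|+H$ on $X$. Let $g=(g_1,\dots,g_m):X\to\mathbb R^m$ be continuous with convex components, and let $\nabla g_j(x)\in\partial g_j(x)$ be chosen subgradients such that, for all $x,y\in X$, $$g_j(x)-g_j(y)-\langle\nabla g_j(y),x-y\rangle\le\tfrac{L_{g_j}}2\|x-y\|^2+H_{g_j}\|x-y\|,\qquad L_g:=\Big(\sum_jL_{g_j}^2\Big)^{1/2},\quad H_g:=\Big(\sum_jH_{g_j}^2\Big)^{1/2},$$ where $L,H,L_{g_j},H_{g_j}\ge 0$. Let $M_g>0$ satisfy $\|g(x)-g(y)\|\le M_g\|x-y\|$ and $\|\nabla g(x)\|\le M_g$ (operator norm of $\nabla g(x)=[\nabla g_1(x),\dots,\nabla g_m(x)]$) on $X$. Put $\widetilde X:=\{x\in X:g(x)\le 0\}$, and assume that a KKT pair $(x^*,\lambda^*)\in\widetilde X\times\mathbb R^m_+$ exists: $0\in F(x^*)+\sum_j\lambda_j^*\partial g_j(x^*)+N_X(x^*)$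 and $\lambda_j^*g_j(x^*)=0$ for all $j$. **Oracles.** For every $x\in X$, the random vectors $\mathfrak F(x,\xi)$, $\mathfrak g(x,\xi)$, $\mathfrak G_j(x,\xi)$ are unbiased estimators of $F(x)$, $g(x)$, $\nabla g_j(x)$, with $\mathbb E\|\mathfrak F(x,\xi)-F(x)\|^2\le\sigma^2$, $\mathbb E\|\mathfrak g(x,\xi)-g(x)\|^2\le\sigma_{\mathfrak g}^2$, $\mathbb E\|\mathfrak G_j(x,\xi)-\nabla g_j(x)\|^2\le\sigma_j^2$. Let $\sigma_{\mathfrak G}:=(\sigma_1,\dots,\sigma_m)$, and let $\xi^0,\dots,\xi^{T-1},\bar\xi^0,\dots,\bar\xi^{T-1}$ be independent copies of $\xi$. **Algorithm (F-StOpConEx).** Given $T\ge 1$ and $x^0\in X$, let $\lambda^0=0$, $x^{-2}=x^{-1}=x^0$, $\mathfrak F^t:=\mathfrak F(x^t,\xi^t)$ and $\mathfrak F^{-1}:=\mathfrak F^0$. With $\ell^t(x^s):=\mathfrak g(x^{s-1},\bar\xi^t)+\mathfrak G(x^{s-1},\bar\xi^t)^T(x^s-x^{s-1})$ for $s\in\{t,t-1\}$,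 set for $t=0,\dots,T-1$ $$\mathfrak s^t=(1+\theta_t)\ell^t(x^t)-\theta_t\ell^t(x^{t-1}),\qquad \lambda^{t+1}=\operatorname*{argmin}_{\lambda\ge0}\ \langle-\mathfrak s^t,\lambda\rangle+\tfrac{\tau_t}2\|\lambda-\lambda^t\|^2,$$ $$x^{t+1}=\operatorname*{argmin}_{x\in X}\ \Big\langle(1+\theta_t)\mathfrak F^t-\theta_t\mathfrak F^{t-1}+\sum_j\lambda_j^{t+1}\mathfrak G_j(x^t,\xi^t),\,x\Big\rangle+\tfrac{\eta_t}2\|x-x^t\|^2,$$ and output $\bar x^T:=\big(\sum_{t<T}\gamma_tx^{t+1}\big)/\sum_{t<T}\gamma_t$. Write $\delta_{\mathfrak G}^t:=\sum_j\lambda_j^{t+1}[\mathfrak G_j(x^t,\xi^t)-\nabla g_j(x^t)]$. **Theorem.** Let $B\ge1$, $\sigma_{X,g}:=\sqrt{\sigma_{\mathfrak g}^2+D_X^2\|\sigma_{\mathfrak G}\|^2}$, $\mathcal H_*:=H_g(\|\lambda^*\|+1)+\tfrac{L_gD_X}{2}[\|\lambda^*\|+1-B]_+$, and suppose $H+H_gB+\sqrt2\sigma>0$.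 Set $\gamma_t=\theta_t=1$, $\eta_t=L_gB+\eta$, $\tau_t=\tau$ with $$\eta=8L+\tfrac{8M_gB}{D_X}+\tfrac{2(H+H_gB+\sqrt2\sigma+4B\|\sigma_{\mathfrak G}\|)}{D_X}\sqrt T,\qquad \tau=\tfrac{9D_X}{B}\max\{M_g,\|\sigma_{\mathfrak G}\|\}+\tfrac{8\sigma_{X,g}}{B}\sqrt T .$$ Then $\mathbb E\|\delta_{\mathfrak G}^t\|^2\le\omega^2$ for all $0\le t\le T-1$, where $$\omega=2.2\Big[\big(6\|\lambda^*\|^2+18B^2+\tfrac{(8L+L_gB)BD_X}{M_g}\big)\|\sigma_{\mathfrak G}\|^2+4\big(H+\sqrt2\sigma+\tfrac{\mathcal H_*^2}{2(H+H_gB+\sqrt2\sigma)}+\tfrac{H_gB}2\big)B\|\sigma_{\mathfrak G}\|\Big]^{1/2},$$ and $$\mathbb E\Big[\sup_{x\in\widetilde X}\langle F(x),\bar x^T-x\rangle\Big]\le\tfrac{3[(8L+L_gB)D_X+8M_gB]D_X}{2T}+\tfrac{3(H+\sqrt2\sigma+H_gB+\|\sigma_{\mathfrak G}\|B)D_X}{\sqrt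 T}+\tfrac{(9\omega^2+8H^2+9\sigma^2)D_X}{4\left(H+H_gB+\sqrt2\sigma+B\|\sigma_{\mathfrak G}\|+4M_gB/\sqrt T\right)\sqrt T}+\tfrac{9\sigma_{X,g}B}{8\sqrt T},$$ $$\mathbb E\|[g(\bar x^T)]_+\|\le\tfrac{[(8L+L_gB)D_X+8M_gB]D_X}{2T}+\tfrac{9\max\{M_g,\|\sigma_{\mathfrak G}\|\}D_X(\|\lambda^*\|+1)^2}{BT}+\tfrac{(H+\sqrt2\sigma+H_gB+\|\sigma_{\mathfrak G}\|B)D_X}{\sqrt T}+\tfrac{2(H^2+\mathcal H_*^2+2\sigma^2+\omega^2)D_X}{(H+H_gB+\sqrt2\sigma+B\|\sigma_{\mathfrak G}\|)\sqrt T}+\tfrac{2\sigma_{X,g}}{\sqrt T}\Big(B+\tfrac{4(\|\lambda^*\|+1)^2}{B}\Big),$$ all these expectations being finite. -/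

import Mathlib

open MeasureTheory ProbabilityTheory

noncomputable section

namespace FCVI

/-- Euclidean space `ℝᵏ` with its standard inner product and norm. -/
abbrev Euc (k : ℕ) : Type := EuclideanSpace ℝ (Fin k)

variable {n m : ℕ}

/-- The nonnegative orthant of `ℝᵏ`. -/
def orthant (k : ℕ) : Set (Euc k) := {v | ∀ j, 0 ≤ v j}

/-- The componentwise positive part `[v]₊`. -/
def posPart {k : ℕ} (v : Euc k) : Euc k := WithLp.toLp 2 fun j => max (v j) 0

/-- The feasible set `X ∩ {x : g_j(x) ≤ 0 for all j}`. -/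
def feasibleSet (X : Set (Euc n)) (g : Euc n → Euc m) : Set (Euc n) :=
  {x | x ∈ X ∧ ∀ j, g x j ≤ 0}

/-- The normal cone of `X` at `x`. -/
def normalCone (X : Set (Euc n)) (x : Euc n) : Set (Euc n) :=
  {v | ∀ y ∈ X, inner ℝ v (y - x) ≤ 0}

/-- The subdifferential at `x` of a function `h : X → ℝ`. -/
def subdifferential (X : Set (Euc n)) (h : Euc n → ℝ) (x : Euc n) : Set (Euc n) :=
  {v | ∀ y ∈ X, h x + inner ℝ v (y - x) ≤ h y}

/-- For vectors `G_1, …, G_m`, the columns of a matrix `G ∈ ℝ^{n × m}`, the product `Gᵀ v`. -/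
def transposeApply (G : Fin m → Euc n) (v : Euc n) : Euc m :=
  WithLp.toLp 2 fun j => inner ℝ (G j) v

/-- The function constrained variational inequality: `X` is convex and compact, `F` is monotone
on `X` and is the sum of a Lipschitz and a bounded part, the `g_j` are continuous and convex on `X`
with chosen (sub)gradients `gradg j`, each `g_j` has a smooth and a nonsmooth part with
constants `Lg j`, `Hg j`, and `Mg` is a Lipschitz constant of `g` which also bounds the
(operator norm of the) matrix of (sub)gradients. -/
structure IsProblem (X : Set (Euc n)) (F : Euc n → Euc n) (g : Euc n → Euc m)
    (gradg : Fin m → Euc n → Euc n) (L H : ℝ) (Lg Hg : Fin m → ℝ) (Mg : ℝ) : Prop where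
  convex : Convex ℝ X
  compact : IsCompact X
  monotone : ∀ x ∈ X, ∀ y ∈ X, 0 ≤ inner ℝ (F x - F y) (x - y)
  L_nonneg : 0 ≤ L
  H_nonneg : 0 ≤ H
  F_lipschitz : ∀ x ∈ X, ∀ y ∈ X, ‖F x - F y‖ ≤ L * ‖x - y‖ + H
  g_continuous : ContinuousOn g X
  g_convex : ∀ j, ConvexOn ℝ X fun x => g x j
  gradg_mem : ∀ j, ∀ x ∈ X, gradg j x ∈ subdifferential X (fun y => g y j) x
  Lg_nonneg : ∀ j, 0 ≤ Lg j
  Hg_nonneg : ∀ j, 0 ≤ Hg j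
  g_smoothness : ∀ j, ∀ x ∈ X, ∀ y ∈ X,
    g x j - g y j - inner ℝ (gradg j y) (x - y) ≤ Lg j / 2 * ‖x - y‖ ^ 2 + Hg j * ‖x - y‖
  g_lipschitz : ∀ x ∈ X, ∀ y ∈ X, ‖g x - g y‖ ≤ Mg * ‖x - y‖
  gradg_bound : ∀ x ∈ X, ∀ v, ‖transposeApply (fun j => gradg j x) v‖ ≤ Mg * ‖v‖

/-- `(xs, ls)` is a Karush–Kuhn–Tucker pair of the function constrained variational inequality:
`0 ∈ F(xs) + ∑ⱼ lsⱼ ∂gⱼ(xs) + N_X(xs)` with `xs` feasible, `ls ≥ 0` and complementary slackness. -/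
structure IsKKTPair (X : Set (Euc n)) (F : Euc n → Euc n) (g : Euc n → Euc m)
    (xs : Euc n) (ls : Euc m) : Prop where
  feasible : xs ∈ feasibleSet X g
  nonneg : ls ∈ orthant m
  stationary : ∃ v : Fin m → Euc n, (∀ j, v j ∈ subdifferential X (fun y => g y j) xs) ∧
    ∃ w ∈ normalCone X xs, F xs + ∑ j, ls j • v j + w = 0
  slackness : ∀ j, ls j * g xs j = 0

/-- `Φ(x, s)`, with `s` drawn from `P`, is a (jointly measurable) unbiased estimator of `φ(x)`
with variance at most `σ²`, for every `x ∈ X`. -/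
structure IsOracle {k : ℕ} {Ξ : Type*} [MeasurableSpace Ξ] (P : Measure Ξ) (X : Set (Euc n))
    (Φ : Euc n → Ξ → Euc k) (φ : Euc n → Euc k) (σ : ℝ) : Prop where
  measurable : Measurable fun p : X × Ξ => Φ p.1 p.2
  memLp : ∀ x ∈ X, MemLp (Φ x) 2 P
  unbiased : ∀ x ∈ X, ∫ s, Φ x s ∂P = φ x
  variance_le : ∀ x ∈ X, ∫ s, ‖Φ x s - φ x‖ ^ 2 ∂P ≤ σ ^ 2

/-- The samples `ξ⁰, …, ξ^{T-1}, ξb⁰, …, ξb^{T-1}` are independent with common law `P`. -/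
structure IsSampling {Ω Ξ : Type*} [MeasurableSpace Ω] [MeasurableSpace Ξ] (μ : Measure Ω)
    (P : Measure Ξ) (T : ℕ) (ξ ξb : ℕ → Ω → Ξ) : Prop where
  measurable : ∀ t < T, Measurable (ξ t) ∧ Measurable (ξb t)
  law : ∀ t < T, μ.map (ξ t) = P ∧ μ.map (ξb t) = P
  indep : iIndepFun (Sum.elim (fun t : Fin T => ξ t) (fun t : Fin T => ξb t)) μ

/-- The stochastic linearization at `y` of the constraints with sample `s`, evaluated at `x`:
`𝔤(y, s) + 𝔊(y, s)ᵀ (x - y)`. -/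
def stochLin {Ξ : Type*} (gs : Euc n → Ξ → Euc m) (Gs : Fin m → Euc n → Ξ → Euc n)
    (s : Ξ) (y x : Euc n) : Euc m :=
  gs y s + transposeApply (fun j => Gs j y s) (x - y)

/-- The extrapolated stochastic constraint estimate of iteration `t`,
`(1 + θ_t) ℓ^t(x^t) - θ_t ℓ^t(x^{t-1})`, where `ℓ^t(x^t)` and `ℓ^t(x^{t-1})` are the stochastic
linearizations at `x^{t-1}` and `x^{t-2}`, both with the sample `ξb^t`. The truncated subtraction
on `ℕ` is intended: it is the convention that iterates with a negative index equal `x⁰`. -/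
def dualSignal {Ω Ξ : Type*} (gs : Euc n → Ξ → Euc m) (Gs : Fin m → Euc n → Ξ → Euc n)
    (θ : ℕ → ℝ) (ξb : ℕ → Ω → Ξ) (x : ℕ → Ω → Euc n) (t : ℕ) (a : Ω) : Euc m :=
  (1 + θ t) • stochLin gs Gs (ξb t a) (x (t - 1) a) (x t a)
    - θ t • stochLin gs Gs (ξb t a) (x (t - 2) a) (x (t - 1) a)

/-- The extrapolated stochastic direction of the primal step of iteration `t`,
`(1 + θ_t) 𝔉^t - θ_t 𝔉^{t-1} + ∑ⱼ λⱼ^{t+1} 𝔊ⱼ(x^t, ξ^t)` with `𝔉^t = 𝔉(x^t, ξ^t)`.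
The truncated subtraction on `ℕ` is intended: it is the convention `𝔉^{-1} = 𝔉⁰`. -/
def primalSignal {Ω Ξ : Type*} (Fs : Euc n → Ξ → Euc n) (Gs : Fin m → Euc n → Ξ → Euc n)
    (θ : ℕ → ℝ) (ξ : ℕ → Ω → Ξ) (x : ℕ → Ω → Euc n) (lam : ℕ → Ω → Euc m)
    (t : ℕ) (a : Ω) : Euc n :=
  (1 + θ t) • Fs (x t a) (ξ t a) - θ t • Fs (x (t - 1) a) (ξ (t - 1) a)
    + ∑ j, lam (t + 1) a j • Gs j (x t a) (ξ t a)

/-- `z` minimizes `⟨v, ·⟩ + (ρ / 2) ‖· - c‖²` over `S`. -/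
def IsProxPoint {k : ℕ} (S : Set (Euc k)) (v c : Euc k) (ρ : ℝ) (z : Euc k) : Prop :=
  z ∈ S ∧ IsMinOn (fun y => inner ℝ v y + ρ / 2 * ‖y - c‖ ^ 2) S z

/-- The random sequences `x`, `lam` are the iterates of `T` iterations of the fully stochastic
operator constraint extrapolation method (F-StOpConEx) with oracles `Fs`, `gs`, `Gs`, samples
`ξ`, `ξb` and step sizes `θ`, `η`, `τ`, started at `x0` and `0`. -/
structure IsRun {Ω Ξ : Type*} (X : Set (Euc n)) (Fs : Euc n → Ξ → Euc n)
    (gs : Euc n → Ξ → Euc m) (Gs : Fin m → Euc n → Ξ → Euc n) (θ η τ : ℕ → ℝ) (T : ℕ)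
    (ξ ξb : ℕ → Ω → Ξ) (x0 : Euc n) (x : ℕ → Ω → Euc n) (lam : ℕ → Ω → Euc m) : Prop where
  x_zero : ∀ a, x 0 a = x0
  lam_zero : ∀ a, lam 0 a = 0
  lam_step : ∀ t < T, ∀ a,
    IsProxPoint (orthant m) (-dualSignal gs Gs θ ξb x t a) (lam t a) (τ t) (lam (t + 1) a)
  x_step : ∀ t < T, ∀ a,
    IsProxPoint X (primalSignal Fs Gs θ ξ x lam t a) (x t a) (η t) (x (t + 1) a)

/-- The output `(∑_{t<T} γ_t x^{t+1}) / (∑_{t<T} γ_t)`. -/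
def output {Ω : Type*} (γ : ℕ → ℝ) (T : ℕ) (x : ℕ → Ω → Euc n) (a : Ω) : Euc n :=
  (∑ t ∈ Finset.range T, γ t)⁻¹ • ∑ t ∈ Finset.range T, γ t • x (t + 1) a

/-- The noise `∑ⱼ λⱼ^{t+1} (𝔊ⱼ(x^t, ξ^t) - ∇gⱼ(x^t))` of the constraint gradients. -/
def gradNoise {Ω Ξ : Type*} (Gs : Fin m → Euc n → Ξ → Euc n) (gradg : Fin m → Euc n → Euc n)
    (ξ : ℕ → Ω → Ξ) (x : ℕ → Ω → Euc n) (lam : ℕ → Ω → Euc m) (t : ℕ) (a : Ω) : Euc n :=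
  ∑ j, lam (t + 1) a j • (Gs j (x t a) (ξ t a) - gradg j (x t a))

/-- The values `⟨F(x), y - x⟩`, `x` in the feasible set, whose supremum is the weak gap at `y`. -/
def gapValues (X : Set (Euc n)) (F : Euc n → Euc n) (g : Euc n → Euc m) (y : Euc n) : Set ℝ :=
  (fun x => inner ℝ (F x) (y - x)) '' feasibleSet X g

/-- The weak gap `sup_{x feasible} ⟨F(x), y - x⟩`. -/
def weakGap (X : Set (Euc n)) (F : Euc n → Euc n) (g : Euc n → Euc m) (y : Euc n) : ℝ :=
  sSup (gapValues X F g y)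

/-- The infeasibility `‖[g(y)]₊‖`. -/
def infeasibility (g : Euc n → Euc m) (y : Euc n) : ℝ := ‖posPart (g y)‖

end FCVI

end

noncomputable section

namespace FCVI

open scoped ENNReal

variable {n m : ℕ}

/-! The method is a primal-dual scheme, and the proof is an energy estimate along each sample path
followed by expectations. Every proximal step obeys a three-point inequality. When these are summed,
the extrapolated directions telescope against the ideal ones, `F` at the new iterate and the
linearized constraints at the new iterate, and leave only products of consecutive differences.
Young's inequality charges these to the negative squares of the primal and dual increments that the
proximal terms supply. The result, `IsProblem.path_le`, holds for every feasible `y` and every `l ≥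
0`, and keeps a spare `τ/4 ‖l - λ^{k+1}‖²` on the left.

Each noise is centered given the samples drawn before it, so `IsStochasticRun.exists_fluctuation`
can split the stochastic terms into a part `U` that depends on neither `y` nor `l`, with controlled
expectation, and three noise sums that are linear in `(y, l)`. Three choices of `(y, l)` then give
the three claims. At the fixed pair `(x*, λ*)` the linear sums have mean zero and the gap is
nonnegative, so the spare term bounds the multipliers. At `l = 0` with `y` arbitrary one gets the
weak gap; the supremum stands inside the expectation, so norms of noise sums appear, of order `√T`
by orthogonality. At `y = x*` with `l` a multiple of `[g(x̄)]₊` one gets the infeasibility; here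
only `l` is random, at the cost of one more Young inequality.

The obstacle is that the noise of the constraint gradients is multiplied by `λ^{t+1}`, which ranges
over an unbounded set. Its variance is at most `‖σ_𝔊‖² E‖λ^{t+1}‖²`, so the bound for the
multipliers has the maximum over `t` of `E‖λ^t‖²` on its right side as well. The summand `4B‖σ_𝔊‖`
in `η` makes the coefficient of that maximum less than one (`IsParams.σG_sq_mul_le`), so it is
absorbed; this produces `ω`. -/

/-! ### Proximal steps. -/

lemma IsProxPoint.variational {k : ℕ} {S : Set (Euc k)} (hS : Convex ℝ S) {v c z : Euc k} {ρ : ℝ}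
    (h : IsProxPoint S v c ρ z) {y : Euc k} (hy : y ∈ S) :
    0 ≤ inner ℝ (v + ρ • (z - c)) (y - z) := by
  set A := inner ℝ (v + ρ • (z - c)) (y - z) with hA
  have key : ∀ s : ℝ, 0 < s → s ≤ 1 → 0 ≤ A + s * (ρ / 2 * ‖y - z‖ ^ 2) := by
    intro s hs hs1
    have hmem : z + s • (y - z) ∈ S := hS.add_smul_sub_mem h.1 hy ⟨hs.le, hs1⟩
    have hmin := isMinOn_iff.mp h.2 _ hmem
    have e : z + s • (y - z) - c = (z - c) + s • (y - z) := by abel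
    rw [e, norm_add_sq_real, norm_smul, inner_add_right, inner_smul_right, inner_smul_right,
      Real.norm_eq_abs, mul_pow, sq_abs] at hmin
    rw [inner_add_left, inner_smul_left] at hA
    simp only [conj_trivial] at hA
    have : 0 ≤ s * (A + s * (ρ / 2 * ‖y - z‖ ^ 2)) := by rw [hA]; nlinarith
    exact nonneg_of_mul_nonneg_right this hs
  -- `A + s Q` is affine in `s`, and at `s = -A / (2Q)` it equals `A / 2 < 0`. The value at `s = 1`
  -- gives `-A ≤ Q`, so this `s` is at most one.
  by_contra! hneg
  set Q := ρ / 2 * ‖y - z‖ ^ 2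
  have h1 := key 1 one_pos le_rfl
  have hQ : 0 < Q := by linarith
  have hs : 0 < -A / (2 * Q) := by apply div_pos <;> linarith
  have h2 := key (-A / (2 * Q)) hs (by rw [div_le_one (by positivity)]; linarith)
  have : -A / (2 * Q) * Q = -A / 2 := by field_simp
  linarith

/-- The three-point inequality of a proximal step. -/
lemma IsProxPoint.inner_le {k : ℕ} {S : Set (Euc k)} (hS : Convex ℝ S) {v c z : Euc k} {ρ : ℝ}
    (h : IsProxPoint S v c ρ z) {y : Euc k} (hy : y ∈ S) :
    inner ℝ v (z - y) ≤ ρ / 2 * (‖y - c‖ ^ 2 - ‖z - c‖ ^ 2 - ‖y - z‖ ^ 2) := by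
  have h1 := h.variational hS hy
  have e : y - c = (z - c) + (y - z) := by abel
  rw [inner_add_left, inner_smul_left] at h1
  simp only [conj_trivial] at h1
  rw [e, norm_add_sq_real, ← neg_sub y z, inner_neg_right]
  linarith

/-- A proximal step depends in a nonexpansive way on the shifted center `c - ρ⁻¹ v`. -/
lemma IsProxPoint.norm_sub_le {k : ℕ} {S : Set (Euc k)} (hS : Convex ℝ S)
    {v₁ c₁ z₁ v₂ c₂ z₂ : Euc k} {ρ : ℝ} (hρ : 0 < ρ)
    (h₁ : IsProxPoint S v₁ c₁ ρ z₁) (h₂ : IsProxPoint S v₂ c₂ ρ z₂) :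
    ‖z₁ - z₂‖ ≤ ‖(c₁ - ρ⁻¹ • v₁) - (c₂ - ρ⁻¹ • v₂)‖ := by
  have a := h₁.variational hS h₂.1
  have b := h₂.variational hS h₁.1
  -- Firm nonexpansiveness of the projection: each variational inequality is tested at the other
  -- solution and the two are added.
  have key : ‖z₁ - z₂‖ ^ 2 ≤ inner ℝ ((c₁ - ρ⁻¹ • v₁) - (c₂ - ρ⁻¹ • v₂)) (z₁ - z₂) := by
    have e : inner ℝ ((c₁ - ρ⁻¹ • v₁) - (c₂ - ρ⁻¹ • v₂)) (z₁ - z₂) - ‖z₁ - z₂‖ ^ 2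
        = ρ⁻¹ * (inner ℝ (v₁ + ρ • (z₁ - c₁)) (z₂ - z₁)
          + inner ℝ (v₂ + ρ • (z₂ - c₂)) (z₁ - z₂)) := by
      rw [← real_inner_self_eq_norm_sq, ← neg_sub z₁ z₂, inner_neg_right]
      simp only [inner_add_left, inner_sub_left, inner_smul_left, conj_trivial]
      field_simp
      ring
    have : 0 ≤ ρ⁻¹ * (inner ℝ (v₁ + ρ • (z₁ - c₁)) (z₂ - z₁)
          + inner ℝ (v₂ + ρ • (z₂ - c₂)) (z₁ - z₂)) :=
      mul_nonneg (inv_nonneg.2 hρ.le) (add_nonneg a b)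
    linarith
  have := key.trans (real_inner_le_norm _ _)
  rcases (norm_nonneg (z₁ - z₂)).eq_or_lt with h0 | h0
  · rw [← h0]; exact norm_nonneg _
  · nlinarith

/-! ### The nonnegative orthant and linearized constraints. -/

lemma convex_orthant (k : ℕ) : Convex ℝ (orthant k) := by
  intro u hu v hv a b ha hb _ j
  have := hu j
  have := hv j
  simp only [PiLp.add_apply, PiLp.smul_apply, smul_eq_mul]
  positivity

lemma zero_mem_orthant (k : ℕ) : (0 : Euc k) ∈ orthant k := fun j => by simp

lemma inner_euc {k : ℕ} (u v : Euc k) : inner ℝ u v = ∑ j, u j * v j := by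
  rw [PiLp.inner_apply]
  exact Finset.sum_congr rfl fun j _ => by simp [mul_comm]

@[simp] lemma transposeApply_apply (G : Fin m → Euc n) (v : Euc n) (j : Fin m) :
    transposeApply G v j = inner ℝ (G j) v := rfl

lemma inner_transposeApply (u : Euc m) (G : Fin m → Euc n) (v : Euc n) :
    inner ℝ u (transposeApply G v) = inner ℝ (∑ j, u j • G j) v := by
  rw [inner_euc, sum_inner]
  exact Finset.sum_congr rfl fun j _ => by simp [inner_smul_left]

/-- The linearization at `y` of the constraints, evaluated at `x`. -/
def lin (g : Euc n → Euc m) (gradg : Fin m → Euc n → Euc n) (y x : Euc n) : Euc m :=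
  g y + transposeApply (fun j => gradg j y) (x - y)

lemma inner_mono_orthant {k : ℕ} {l u v : Euc k} (hl : l ∈ orthant k) (h : ∀ j, u j ≤ v j) :
    inner ℝ l u ≤ inner ℝ l v := by
  rw [inner_euc, inner_euc]
  exact Finset.sum_le_sum fun j _ => mul_le_mul_of_nonneg_left (h j) (hl j)

/-! ### Energy estimate along a fixed path. -/

section Problem

variable {X : Set (Euc n)} {F : Euc n → Euc n} {g : Euc n → Euc m} {gradg : Fin m → Euc n → Euc n}
  {L H Mg : ℝ} {Lgj Hgj : Fin m → ℝ}

/-- By convexity the linearization at `z` lies below `g` at `y`, so replacing `g y` by it only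
increases the left side; the difference of two values of one linearization is linear in `x - y`. -/
lemma IsProblem.inner_lin_sub_le (hp : IsProblem X F g gradg L H Lgj Hgj Mg) {l : Euc m}
    (hl : l ∈ orthant m) {y z : Euc n} (hy : y ∈ X) (hz : z ∈ X) (x : Euc n) :
    inner ℝ l (lin g gradg z x - g y) ≤ inner ℝ (∑ j, l j • gradg j z) (x - y) := by
  rw [← inner_transposeApply]
  refine inner_mono_orthant hl fun j => ?_
  have h := hp.gradg_mem j z hz y hy
  simp only [lin, PiLp.sub_apply, PiLp.add_apply, transposeApply_apply]
  have : inner ℝ (gradg j z) (x - y) = inner ℝ (gradg j z) (x - z) - inner ℝ (gradg j z) (y - z) := by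
    rw [← inner_sub_right]; congr 1; abel
  simp only at h
  linarith

/-- The summed primal steps. -/
lemma IsProblem.sum_primal_le (hp : IsProblem X F g gradg L H Lgj Hgj Mg) {x : ℕ → Euc n}
    {lam : ℕ → Euc m} {f δ : ℕ → Euc n} {c : ℝ} (k : ℕ) (hx : ∀ t ≤ k, x t ∈ X)
    (hlam : ∀ t ≤ k, lam (t + 1) ∈ orthant m)
    (hstep : ∀ t ≤ k, ∀ y ∈ X, inner ℝ ((2 : ℝ) • (F (x t) + f t) - (F (x (t - 1)) + f (t - 1))
      + (∑ j, lam (t + 1) j • gradg j (x t)) + δ t) (x (t + 1) - y)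
      ≤ c / 2 * (‖y - x t‖ ^ 2 - ‖x (t + 1) - x t‖ ^ 2 - ‖y - x (t + 1)‖ ^ 2))
    {y : Euc n} (hy : y ∈ X) :
    ∑ t ∈ Finset.range (k + 1), (inner ℝ (F (x (t + 1))) (x (t + 1) - y)
        + inner ℝ (lam (t + 1)) (lin g gradg (x t) (x (t + 1)) - g y))
      ≤ c / 2 * ‖y - x 0‖ ^ 2 - c / 2 * ‖y - x (k + 1)‖ ^ 2
        - c / 2 * ∑ t ∈ Finset.range (k + 1), ‖x (t + 1) - x t‖ ^ 2
        + inner ℝ (F (x (k + 1)) - F (x k) - f k) (x (k + 1) - y)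
        - ∑ t ∈ Finset.range k, inner ℝ (F (x (t + 1)) - F (x t) + f (t + 1) - f t)
            (x (t + 2) - x (t + 1))
        - ∑ t ∈ Finset.range k, inner ℝ (f (t + 1)) (x (t + 1) - y)
        - ∑ t ∈ Finset.range (k + 1), inner ℝ (δ t) (x (t + 1) - y) := by
  -- With `Δ_t = F(x_t) + f_t - F(x_{t-1}) - f_{t-1}`, the extrapolated direction is `F(x_{t+1}) +
  -- f_{t+1} + Δ_t - Δ_{t+1}`. Hence `⟨Δ_t, x_t - y⟩` telescopes, starting from `Δ_0 = 0` because `0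
  -- - 1 = 0`. At the last index `f_{k+1}` cancels, so no sample at `x_{k+1}` is needed. Each
  -- surviving `f_{t+1}` is paired with `x_{t+1}`, which is determined before that noise is drawn.
  induction k with
  | zero =>
    have h1 := hstep 0 le_rfl y hy
    have h2 := hp.inner_lin_sub_le (hlam 0 le_rfl) hy (hx 0 le_rfl) (x (0 + 1))
    simp only [Finset.range_one, Finset.sum_singleton, Finset.range_zero, Finset.sum_empty, zero_add,
      Nat.zero_sub, inner_add_left, inner_sub_left, inner_smul_left, conj_trivial] at h1 h2 ⊢
    linarith
  | succ k ih =>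
    have ih' := ih (fun t ht => hx t (by omega)) (fun t ht => hlam t (by omega))
      (fun t ht => hstep t (by omega))
    have h1 := hstep (k + 1) le_rfl y hy
    have h2 := hp.inner_lin_sub_le (hlam (k + 1) le_rfl) hy (hx (k + 1) le_rfl) (x (k + 1 + 1))
    have e : ∀ v, inner ℝ v (x (k + 2) - x (k + 1))
        = inner ℝ v (x (k + 2) - y) - inner ℝ v (x (k + 1) - y) := fun v => by
      rw [← inner_sub_right]; congr 1; abel
    simp only [Finset.sum_range_succ, add_tsub_cancel_right, inner_add_left, inner_sub_left, inner_smul_left,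
      conj_trivial, e, add_assoc, Nat.reduceAdd] at h1 h2 ih' ⊢
    linarith

/-- The summed dual steps, for linearized constraint values `q` and errors `ζ`. -/
lemma sum_dual_le {lam q ζ : ℕ → Euc m} {τ : ℝ} (K : ℕ) {l : Euc m}
    (hstep : ∀ t < K, inner ℝ (-((2 : ℝ) • q t - q (t - 1) + ζ t)) (lam (t + 1) - l)
      ≤ τ / 2 * (‖l - lam t‖ ^ 2 - ‖lam (t + 1) - lam t‖ ^ 2 - ‖l - lam (t + 1)‖ ^ 2)) :
    ∑ t ∈ Finset.range K, inner ℝ (l - lam (t + 1)) (q (t + 1))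
      ≤ τ / 2 * ‖l - lam 0‖ ^ 2 - τ / 2 * ‖l - lam K‖ ^ 2
        - τ / 2 * ∑ t ∈ Finset.range K, ‖lam (t + 1) - lam t‖ ^ 2
        + inner ℝ (l - lam K) (q K - q (K - 1))
        + ∑ t ∈ Finset.range K, inner ℝ (lam (t + 1) - lam t) (q t - q (t - 1))
        - ∑ t ∈ Finset.range K, inner ℝ (l - lam (t + 1)) (ζ t) := by
  -- The same telescoping for `q`; the errors stay outside the differences, collected in `ζ`.
  induction K with
  | zero => simp
  | succ K ih =>
    have ih' := ih fun t ht => hstep t (by omega)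
    have h1 := hstep K (by omega)
    rw [real_inner_comm] at h1
    simp only [Finset.sum_range_succ, add_tsub_cancel_right, inner_sub_left, inner_sub_right,
      inner_add_right, inner_neg_right, inner_smul_right] at h1 ih' ⊢
    linarith

end Problem

lemma mul_le_young {c : ℝ} (hc : 0 < c) (a b : ℝ) : a * b ≤ a ^ 2 / (2 * c) + c / 2 * b ^ 2 := by
  have e : a ^ 2 / (2 * c) + c / 2 * b ^ 2 - a * b = (a - c * b) ^ 2 / (2 * c) := by
    field_simp; ring
  have : 0 ≤ (a - c * b) ^ 2 / (2 * c) := by positivity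
  linarith

lemma abs_inner_le_young {E : Type*} [NormedAddCommGroup E] [InnerProductSpace ℝ E] {c : ℝ}
    (hc : 0 < c) (a b : E) :
    |inner ℝ a b| ≤ ‖a‖ ^ 2 / (2 * c) + c / 2 * ‖b‖ ^ 2 :=
  (abs_real_inner_le_norm a b).trans (mul_le_young hc _ _)

/-- A sum over increments with the convention that the zeroth increment vanishes. -/
lemma sum_norm_sub_pred_sq_add {E : Type*} [NormedAddCommGroup E] (x : ℕ → E) (k : ℕ) :
    ∑ t ∈ Finset.range (k + 1), ‖x t - x (t - 1)‖ ^ 2 + ‖x (k + 1) - x k‖ ^ 2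
      = ∑ t ∈ Finset.range (k + 1), ‖x (t + 1) - x t‖ ^ 2 := by
  rw [Finset.sum_range_succ', Finset.sum_range_succ _ k]
  simp

section Problem

variable {X : Set (Euc n)} {F : Euc n → Euc n} {g : Euc n → Euc m} {gradg : Fin m → Euc n → Euc n}
  {L H Mg : ℝ} {Lgj Hgj : Fin m → ℝ}

/-- `hc` is the budget for the coefficient of the squared increments: `b` for the linearization
error of `g`, `2L` for the Lipschitz part of `F` (each increment occurs in two neighbouring
products), `cH`, `cf`, `cδ` for the bounded part and the two noises, and `ρ` left over for the dual
side. -/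
lemma IsProblem.primal_young (hp : IsProblem X F g gradg L H Lgj Hgj Mg) {x : ℕ → Euc n}
    {f δ : ℕ → Euc n} {c cH cf cδ b ρ : ℝ} (hcH : 0 < cH) (hcf : 0 < cf) (hcδ : 0 < cδ)
    (hc : b + 2 * L + cH + cf + cδ + ρ ≤ c) (hb : 0 ≤ b) (hρ : 0 ≤ ρ)
    (k : ℕ) (hx : ∀ t ≤ k + 1, x t ∈ X) (y : Euc n) :
    b / 2 * ∑ t ∈ Finset.range (k + 1), ‖x (t + 1) - x t‖ ^ 2
        - c / 2 * ‖y - x (k + 1)‖ ^ 2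
        - c / 2 * ∑ t ∈ Finset.range (k + 1), ‖x (t + 1) - x t‖ ^ 2
        + inner ℝ (F (x (k + 1)) - F (x k) - f k) (x (k + 1) - y)
        - ∑ t ∈ Finset.range k, inner ℝ (F (x (t + 1)) - F (x t) + f (t + 1) - f t)
            (x (t + 2) - x (t + 1))
        - ∑ t ∈ Finset.range (k + 1), inner ℝ (δ t) (x (t + 1) - y)
      ≤ - (ρ / 2 * ∑ t ∈ Finset.range (k + 1), ‖x (t + 1) - x t‖ ^ 2)
        + (k + 1) * (H ^ 2 / (2 * cH))
        + (∑ t ∈ Finset.range k, ‖f (t + 1) - f t‖ ^ 2 + ‖f k‖ ^ 2) / (2 * cf)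
        + (∑ t ∈ Finset.range (k + 1), ‖δ t‖ ^ 2) / (2 * cδ)
        - ∑ t ∈ Finset.range (k + 1), inner ℝ (δ t) (x t - y) := by
  have hL := hp.L_nonneg
  have step : ∀ t ≤ k, ∀ u v : Euc n, |inner ℝ (F (x (t + 1)) - F (x t) + u) v|
      ≤ L / 2 * ‖x (t + 1) - x t‖ ^ 2 + (L + cH + cf) / 2 * ‖v‖ ^ 2
        + H ^ 2 / (2 * cH) + ‖u‖ ^ 2 / (2 * cf) := by
    intro t ht u v
    have h1 := hp.F_lipschitz _ (hx (t + 1) (by omega)) _ (hx t (by omega))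
    have h2 : ‖F (x (t + 1)) - F (x t) + u‖ ≤ L * ‖x (t + 1) - x t‖ + H + ‖u‖ :=
      (norm_add_le _ _).trans (by linarith)
    have h3 := (abs_real_inner_le_norm (F (x (t + 1)) - F (x t) + u) v).trans
      (mul_le_mul_of_nonneg_right h2 (norm_nonneg v))
    have h4 := mul_le_young hcH H ‖v‖
    have h5 := mul_le_young hcf ‖u‖ ‖v‖
    have h6 : L * (‖x (t + 1) - x t‖ * ‖v‖) ≤ L * ((‖x (t + 1) - x t‖ ^ 2 + ‖v‖ ^ 2) / 2) :=
      mul_le_mul_of_nonneg_left (by nlinarith [sq_nonneg (‖x (t + 1) - x t‖ - ‖v‖)]) hL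
    nlinarith
  have T1 : - ∑ t ∈ Finset.range k, inner ℝ (F (x (t + 1)) - F (x t) + f (t + 1) - f t)
      (x (t + 2) - x (t + 1))
      ≤ ∑ t ∈ Finset.range k, (L / 2 * ‖x (t + 1) - x t‖ ^ 2
        + (L + cH + cf) / 2 * ‖x (t + 2) - x (t + 1)‖ ^ 2
        + H ^ 2 / (2 * cH) + ‖f (t + 1) - f t‖ ^ 2 / (2 * cf)) := by
    rw [← Finset.sum_neg_distrib]
    refine Finset.sum_le_sum fun t ht => ?_
    have := step t (by have := Finset.mem_range.1 ht; omega) (f (t + 1) - f t)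
      (x (t + 2) - x (t + 1))
    rw [← add_sub_assoc] at this
    exact (neg_le_abs _).trans this
  -- The boundary product is paid by the final distance `c/2 ‖y - x_{k+1}‖²` in place of an
  -- increment.
  have T2 := (le_abs_self _).trans (step k le_rfl (-f k) (x (k + 1) - y))
  rw [norm_neg, ← sub_eq_add_neg] at T2
  have T3 : - ∑ t ∈ Finset.range (k + 1), inner ℝ (δ t) (x (t + 1) - y)
      ≤ ∑ t ∈ Finset.range (k + 1), (- inner ℝ (δ t) (x t - y) + ‖δ t‖ ^ 2 / (2 * cδ)
        + cδ / 2 * ‖x (t + 1) - x t‖ ^ 2) := by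
    rw [← Finset.sum_neg_distrib]
    refine Finset.sum_le_sum fun t ht => ?_
    have h1 := (neg_le_abs _).trans (abs_inner_le_young hcδ (δ t) (x (t + 1) - x t))
    -- `x t - y` does not involve the sample of `δ t`, so that pairing is kept for the expectation;
    -- only the increment needs Young's inequality.
    have e : x (t + 1) - y = (x t - y) + (x (t + 1) - x t) := by abel
    rw [e, inner_add_right]
    linarith
  simp only [Finset.sum_add_distrib, ← Finset.mul_sum, ← Finset.sum_div, Finset.sum_neg_distrib,
    Finset.sum_const, Finset.card_range, nsmul_eq_mul] at T1 T3
  have S1 := Finset.sum_range_succ (fun t => ‖x (t + 1) - x t‖ ^ 2) k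
  have S2 := Finset.sum_range_succ' (fun t => ‖x (t + 1) - x t‖ ^ 2) k
  simp only [zero_add, add_assoc, Nat.reduceAdd] at S1 S2 T1
  set S := ∑ t ∈ Finset.range (k + 1), ‖x (t + 1) - x t‖ ^ 2
  have hS : 0 ≤ S := Finset.sum_nonneg fun t _ => sq_nonneg _
  rw [norm_sub_rev (x (k + 1)) y] at T2
  have e1 : ∑ t ∈ Finset.range k, ‖x (t + 1) - x t‖ ^ 2 = S - ‖x (k + 1) - x k‖ ^ 2 := by linarith
  have e2 : ∑ t ∈ Finset.range k, ‖x (t + 2) - x (t + 1)‖ ^ 2 = S - ‖x 1 - x 0‖ ^ 2 := by linarith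
  rw [e1, e2, mul_div_assoc] at T1
  have i1 : 0 ≤ (L + (cH + cf)) / 2 * ‖x 1 - x 0‖ ^ 2 := by positivity
  have i2 : (b + 2 * L + cH + cf + cδ + ρ) / 2 * S ≤ c / 2 * S :=
    mul_le_mul_of_nonneg_right (by linarith) hS
  have i3 : (L + cH + cf) / 2 * ‖y - x (k + 1)‖ ^ 2 ≤ c / 2 * ‖y - x (k + 1)‖ ^ 2 :=
    mul_le_mul_of_nonneg_right (by linarith) (sq_nonneg _)
  rw [add_div (∑ t ∈ Finset.range k, ‖f (t + 1) - f t‖ ^ 2)]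
  linarith

lemma IsProblem.norm_lin_sub_sq_le (hp : IsProblem X F g gradg L H Lgj Hgj Mg) {x y z : Euc n}
    (hy : y ∈ X) (hz : z ∈ X) :
    ‖lin g gradg y x - lin g gradg z y‖ ^ 2
      ≤ Mg ^ 2 * (3 * ‖x - y‖ ^ 2 + 6 * ‖y - z‖ ^ 2) := by
  have h1 := hp.g_lipschitz y hy z hz
  have h2 := hp.gradg_bound y hy (x - y)
  have h3 := hp.gradg_bound z hz (y - z)
  have e : lin g gradg y x - lin g gradg z y = (g y - g z)
      + transposeApply (fun j => gradg j y) (x - y)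
      - transposeApply (fun j => gradg j z) (y - z) := by
    simp only [lin]; abel
  have h4 : ‖lin g gradg y x - lin g gradg z y‖ ≤ Mg * (‖x - y‖ + 2 * ‖y - z‖) := by
    rw [e]
    refine (norm_sub_le _ _).trans ((add_le_add_left (norm_add_le _ _) _).trans ?_)
    linarith
  have h5 := pow_le_pow_left₀ (norm_nonneg _) h4 2
  have h6 : (‖x - y‖ + 2 * ‖y - z‖) ^ 2 ≤ 3 * ‖x - y‖ ^ 2 + 6 * ‖y - z‖ ^ 2 := by
    nlinarith [sq_nonneg (‖x - y‖ - ‖y - z‖)]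
  calc _ ≤ _ := h5
    _ = Mg ^ 2 * (‖x - y‖ + 2 * ‖y - z‖) ^ 2 := by ring
    _ ≤ _ := mul_le_mul_of_nonneg_left h6 (sq_nonneg _)

/-- The dual increments are shared out: the fraction `β` of `τ` pays for the differences of exact
linearizations, the fraction `1 - β` for the noise. Splitting `λ_{t+1}` as `λ_t` plus an increment
leaves `⟨λ_t, ζ_t⟩`, which has mean zero. The factor `9 = 3 + 6` comes from
`IsProblem.norm_lin_sub_sq_le`, summed over all steps. -/
lemma IsProblem.dual_young (hp : IsProblem X F g gradg L H Lgj Hgj Mg) {x : ℕ → Euc n}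
    {lam ζ : ℕ → Euc m} {τ β : ℝ} (hτ : 0 < τ) (hβ : 0 < β) (hβ' : β ≤ 1 / 2) (k : ℕ)
    (hx : ∀ t ≤ k + 1, x t ∈ X) (l : Euc m) :
    - (τ / 2 * ‖l - lam (k + 1)‖ ^ 2)
        - τ / 2 * ∑ t ∈ Finset.range (k + 1), ‖lam (t + 1) - lam t‖ ^ 2
        + inner ℝ (l - lam (k + 1)) (lin g gradg (x k) (x (k + 1)) - lin g gradg (x (k - 1)) (x k))
        + ∑ t ∈ Finset.range (k + 1), inner ℝ (lam (t + 1) - lam t)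
            (lin g gradg (x (t - 1)) (x t) - lin g gradg (x (t - 1 - 1)) (x (t - 1)))
        - ∑ t ∈ Finset.range (k + 1), inner ℝ (l - lam (t + 1)) (ζ t)
      ≤ - (τ / 4 * ‖l - lam (k + 1)‖ ^ 2)
        + 9 * Mg ^ 2 / (2 * (β * τ)) * ∑ t ∈ Finset.range (k + 1), ‖x (t + 1) - x t‖ ^ 2
        + (∑ t ∈ Finset.range (k + 1), ‖ζ t‖ ^ 2) / (2 * ((1 - β) * τ))
        - inner ℝ l (∑ t ∈ Finset.range (k + 1), ζ t)
        + ∑ t ∈ Finset.range (k + 1), inner ℝ (lam t) (ζ t) := by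
  have hβτ : 0 < β * τ := mul_pos hβ hτ
  have hβτ' : 0 < (1 - β) * τ := mul_pos (by linarith) hτ
  set q : ℕ → Euc m := fun t => lin g gradg (x (t - 1)) (x t) with hq
  have T1 : ∑ t ∈ Finset.range (k + 1), inner ℝ (lam (t + 1) - lam t) (q t - q (t - 1))
        - ∑ t ∈ Finset.range (k + 1), inner ℝ (l - lam (t + 1)) (ζ t)
      ≤ ∑ t ∈ Finset.range (k + 1), (‖q t - q (t - 1)‖ ^ 2 / (2 * (β * τ))
        + τ / 2 * ‖lam (t + 1) - lam t‖ ^ 2 + ‖ζ t‖ ^ 2 / (2 * ((1 - β) * τ))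
        - inner ℝ l (ζ t) + inner ℝ (lam t) (ζ t)) := by
    rw [← Finset.sum_sub_distrib]
    refine Finset.sum_le_sum fun t _ => ?_
    have h1 := (le_abs_self _).trans (abs_inner_le_young hβτ (q t - q (t - 1)) (lam (t + 1) - lam t))
    have h2 := (le_abs_self _).trans (abs_inner_le_young hβτ' (ζ t) (lam (t + 1) - lam t))
    rw [real_inner_comm] at h1 h2
    have e : l - lam (t + 1) = l - lam t - (lam (t + 1) - lam t) := by abel
    rw [e, inner_sub_left (l - lam t), inner_sub_left l]
    linarith
  have T2 := (le_abs_self _).trans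
    (abs_inner_le_young (half_pos hτ) (q (k + 1) - q k) (l - lam (k + 1)))
  rw [real_inner_comm] at T2
  -- The boundary product uses half of the final distance, hence the constant `τ/2`. Since `β ≤
  -- 1/2`, it can be weakened to `βτ` and joined to the other differences.
  have T3 : ‖q (k + 1) - q k‖ ^ 2 / (2 * (τ / 2)) ≤ ‖q (k + 1) - q k‖ ^ 2 / (2 * (β * τ)) := by
    gcongr; nlinarith
  have T4 := sum_norm_sub_pred_sq_add q k
  have T5 : ∑ t ∈ Finset.range (k + 1), ‖q (t + 1) - q t‖ ^ 2
      ≤ Mg ^ 2 * (3 * ∑ t ∈ Finset.range (k + 1), ‖x (t + 1) - x t‖ ^ 2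
        + 6 * ∑ t ∈ Finset.range (k + 1), ‖x t - x (t - 1)‖ ^ 2) := by
    rw [Finset.mul_sum, Finset.mul_sum, ← Finset.sum_add_distrib, Finset.mul_sum]
    refine Finset.sum_le_sum fun t ht => ?_
    have ht := Finset.mem_range.1 ht
    exact hp.norm_lin_sub_sq_le (hx t (by omega)) (hx (t - 1) (by omega))
  have T6 : ∑ t ∈ Finset.range (k + 1), ‖x t - x (t - 1)‖ ^ 2
      ≤ ∑ t ∈ Finset.range (k + 1), ‖x (t + 1) - x t‖ ^ 2 := by
    rw [← sum_norm_sub_pred_sq_add x k]; linarith [sq_nonneg ‖x (k + 1) - x k‖]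
  have T7 : ∑ t ∈ Finset.range (k + 1), ‖q (t + 1) - q t‖ ^ 2
      ≤ 9 * Mg ^ 2 * ∑ t ∈ Finset.range (k + 1), ‖x (t + 1) - x t‖ ^ 2 := by
    nlinarith [sq_nonneg Mg]
  have T8 : (∑ t ∈ Finset.range (k + 1), ‖q (t + 1) - q t‖ ^ 2) / (2 * (β * τ))
      ≤ 9 * Mg ^ 2 / (2 * (β * τ)) * ∑ t ∈ Finset.range (k + 1), ‖x (t + 1) - x t‖ ^ 2 := by
    rw [div_mul_eq_mul_div]; gcongr
  rw [← T4, add_div] at T8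
  simp only [Finset.sum_add_distrib, Finset.sum_sub_distrib, ← Finset.mul_sum, ← Finset.sum_div,
    ← inner_sum] at T1
  simp only [hq, add_tsub_cancel_right] at T1 T2 T3 T8 ⊢
  linarith

/-- The estimate for a fixed sample path from which all the bounds are obtained. -/
lemma IsProblem.path_le (hp : IsProblem X F g gradg L H Lgj Hgj Mg) {x : ℕ → Euc n}
    {lam ζ : ℕ → Euc m} {f δ : ℕ → Euc n} {c cH cf cδ b ρ C τ β : ℝ}
    (hcH : 0 < cH) (hcf : 0 < cf) (hcδ : 0 < cδ)
    (hc : b + 2 * L + cH + cf + cδ + ρ ≤ c) (hb : 0 ≤ b) (hρ : 0 ≤ ρ)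
    (hτ : 0 < τ) (hβ : 0 < β) (hβ' : β ≤ 1 / 2) (k : ℕ)
    (hx : ∀ t ≤ k + 1, x t ∈ X) (hlam : ∀ t ≤ k, lam (t + 1) ∈ orthant m) (hlam0 : lam 0 = 0)
    (hprimal : ∀ t ≤ k, ∀ y ∈ X, inner ℝ ((2 : ℝ) • (F (x t) + f t) - (F (x (t - 1)) + f (t - 1))
      + (∑ j, lam (t + 1) j • gradg j (x t)) + δ t) (x (t + 1) - y)
      ≤ c / 2 * (‖y - x t‖ ^ 2 - ‖x (t + 1) - x t‖ ^ 2 - ‖y - x (t + 1)‖ ^ 2))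
    (hdual : ∀ t ≤ k, ∀ l ∈ orthant m, inner ℝ (-((2 : ℝ) • lin g gradg (x (t - 1)) (x t)
      - lin g gradg (x (t - 1 - 1)) (x (t - 1)) + ζ t)) (lam (t + 1) - l)
      ≤ τ / 2 * (‖l - lam t‖ ^ 2 - ‖lam (t + 1) - lam t‖ ^ 2 - ‖l - lam (t + 1)‖ ^ 2))
    {y : Euc n} (hy : y ∈ feasibleSet X g) {l : Euc m} (hl : l ∈ orthant m)
    (hlin : ∀ t ≤ k, inner ℝ l (g (x (t + 1)) - lin g gradg (x t) (x (t + 1)))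
      ≤ b / 2 * ‖x (t + 1) - x t‖ ^ 2 + C) :
    ∑ t ∈ Finset.range (k + 1), (inner ℝ (F (x (t + 1))) (x (t + 1) - y)
        + inner ℝ l (g (x (t + 1)))) + τ / 4 * ‖l - lam (k + 1)‖ ^ 2
      ≤ c / 2 * ‖y - x 0‖ ^ 2 + τ / 2 * ‖l‖ ^ 2
        - (ρ / 2 - 9 * Mg ^ 2 / (2 * (β * τ)))
          * ∑ t ∈ Finset.range (k + 1), ‖x (t + 1) - x t‖ ^ 2
        + (k + 1) * (H ^ 2 / (2 * cH) + C)
        + (∑ t ∈ Finset.range k, ‖f (t + 1) - f t‖ ^ 2 + ‖f k‖ ^ 2) / (2 * cf)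
        + (∑ t ∈ Finset.range (k + 1), ‖δ t‖ ^ 2) / (2 * cδ)
        + (∑ t ∈ Finset.range (k + 1), ‖ζ t‖ ^ 2) / (2 * ((1 - β) * τ))
        - ∑ t ∈ Finset.range k, inner ℝ (f (t + 1)) (x (t + 1) - y)
        - ∑ t ∈ Finset.range (k + 1), inner ℝ (δ t) (x t - y)
        - inner ℝ l (∑ t ∈ Finset.range (k + 1), ζ t)
        + ∑ t ∈ Finset.range (k + 1), inner ℝ (lam t) (ζ t) := by
  have P1 := hp.sum_primal_le k (fun t ht => hx t (by omega)) hlam hprimal hy.1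
  have P2 := hp.primal_young (f := f) (δ := δ) hcH hcf hcδ hc hb hρ k hx y
  have D1 := sum_dual_le (q := fun t => lin g gradg (x (t - 1)) (x t)) (k + 1)
    (fun t ht => hdual t (by omega) l hl)
  have D2 := hp.dual_young (lam := lam) (ζ := ζ) hτ hβ hβ' k hx l
  simp only [add_tsub_cancel_right, hlam0, sub_zero] at D1
  have G : ∑ t ∈ Finset.range (k + 1), inner ℝ l (g (x (t + 1)) - lin g gradg (x t) (x (t + 1)))
      ≤ ∑ t ∈ Finset.range (k + 1), (b / 2 * ‖x (t + 1) - x t‖ ^ 2 + C) :=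
    Finset.sum_le_sum fun t ht => hlin t (by have := Finset.mem_range.1 ht; omega)
  -- Feasibility of `y` enters here: against nonnegative multipliers `g y` contributes with a good
  -- sign.
  have N : ∀ t ∈ Finset.range (k + 1), inner ℝ (lam (t + 1)) (g y) ≤ 0 := fun t ht => by
    have h0 := inner_mono_orthant (v := 0)
      (hlam t (by have := Finset.mem_range.1 ht; omega)) (u := g y) (fun j => by simpa using hy.2 j)
    simpa using h0
  have N := Finset.sum_nonpos N
  simp only [Finset.sum_add_distrib, Finset.sum_sub_distrib, ← Finset.mul_sum, inner_sub_left,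
    inner_sub_right l, inner_sub_right (lam _), Finset.sum_const, Finset.card_range, nsmul_eq_mul,
    Nat.cast_add, Nat.cast_one] at *
  linarith

/-- The linearization error of the constraints against a multiplier. -/
lemma IsProblem.inner_sub_lin_le (hp : IsProblem X F g gradg L H Lgj Hgj Mg) {x y : Euc n}
    (hx : x ∈ X) (hy : y ∈ X) {l : Euc m} (hl : l ∈ orthant m) :
    inner ℝ l (g x - lin g gradg y x)
      ≤ ‖l‖ * (√(∑ j, Lgj j ^ 2) / 2 * ‖x - y‖ ^ 2 + √(∑ j, Hgj j ^ 2) * ‖x - y‖) := by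
  have cs : ∀ c : Fin m → ℝ, ∑ j, l j * c j ≤ ‖l‖ * √(∑ j, c j ^ 2) := fun c => by
    rw [EuclideanSpace.norm_eq]
    simpa using Real.sum_mul_le_sqrt_mul_sqrt Finset.univ (fun j => l j) c
  have h1 : inner ℝ l (g x - lin g gradg y x)
      ≤ inner ℝ l (WithLp.toLp 2 fun j => Lgj j / 2 * ‖x - y‖ ^ 2 + Hgj j * ‖x - y‖) := by
    refine inner_mono_orthant hl fun j => ?_
    have := hp.g_smoothness j x hx y hy
    simp only [lin, PiLp.sub_apply, PiLp.add_apply, transposeApply_apply]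
    linarith
  refine h1.trans ?_
  have e : inner ℝ l (WithLp.toLp 2 fun j => Lgj j / 2 * ‖x - y‖ ^ 2 + Hgj j * ‖x - y‖ : Euc m)
      = (∑ j, l j * Lgj j) * (‖x - y‖ ^ 2 / 2) + (∑ j, l j * Hgj j) * ‖x - y‖ := by
    rw [inner_euc, Finset.sum_mul, Finset.sum_mul, ← Finset.sum_add_distrib]
    exact Finset.sum_congr rfl fun j _ => by simp only; ring
  rw [e]
  have h2 := mul_le_mul_of_nonneg_right (cs Lgj) (by positivity : 0 ≤ ‖x - y‖ ^ 2 / 2)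
  have h3 := mul_le_mul_of_nonneg_right (cs Hgj) (norm_nonneg (x - y))
  linarith

/-- Stationarity says that `xs` minimizes the convex function `⟨F xs, ·⟩ + ⟨ls, g⟩` over `X`, and
complementary slackness makes the constraint part vanish at `xs`. -/
lemma IsKKTPair.inner_nonneg {xs : Euc n} {ls : Euc m} (h : IsKKTPair X F g xs ls) {y : Euc n}
    (hy : y ∈ X) : 0 ≤ inner ℝ (F xs) (y - xs) + inner ℝ ls (g y) := by
  obtain ⟨v, hv, w, hw, he⟩ := h.stationary
  have h1 : inner ℝ (F xs + ∑ j, ls j • v j + w) (y - xs) = 0 := by rw [he, inner_zero_left]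
  rw [inner_add_left, inner_add_left, ← inner_transposeApply] at h1
  have h2 := hw y hy
  have h3 : inner ℝ ls (transposeApply v (y - xs)) ≤ inner ℝ ls (g y - g xs) := by
    refine inner_mono_orthant h.nonneg fun j => ?_
    have := hv j y hy
    simp only [PiLp.sub_apply, transposeApply_apply] at this ⊢
    linarith
  have h4 : inner ℝ ls (g xs) = 0 := by
    rw [inner_euc]; exact Finset.sum_eq_zero fun j _ => h.slackness j
  rw [inner_sub_right] at h3
  linarith

end Problem

/-! ### Conditionally centered noise. -/

/-- `N` is a centered noise with variance at most `v²`, conditionally on the past `𝓐`. -/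
structure IsNoise {Ω : Type*} (𝓐 : MeasurableSpace Ω) [MeasurableSpace Ω] (μ : Measure Ω) {k : ℕ}
    (N : Ω → Euc k) (v : ℝ) : Prop where
  measurable : Measurable N
  lintegral_le : ∀ w : Ω → ℝ≥0∞, Measurable[𝓐] w →
    ∫⁻ a, ‖N a‖ₑ ^ 2 * w a ∂μ ≤ ENNReal.ofReal (v ^ 2) * ∫⁻ a, w a ∂μ
  integral_inner : ∀ h : Ω → Euc k, Measurable[𝓐] h → Integrable h μ →
    Integrable (fun a => inner ℝ (N a) (h a)) μ ∧ ∫ a, inner ℝ (N a) (h a) ∂μ = 0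

section Noise

variable {Ω Ξ : Type*} {𝓐 : MeasurableSpace Ω} [mΩ : MeasurableSpace Ω] [MeasurableSpace Ξ]
  {μ : Measure Ω} {P : Measure Ξ}

/-- Measurability of `F` and of the chosen subgradients is not assumed; on `X` they are parameter
integrals of jointly measurable maps. -/
lemma IsOracle.measurable_mean [SFinite P] {k : ℕ} {X : Set (Euc n)} {Φ : Euc n → Ξ → Euc k}
    {φ : Euc n → Euc k} {σ : ℝ} (hΦ : IsOracle P X Φ φ σ) : Measurable fun p : X => φ p := by
  have e : (fun p : X => φ p) = fun p : X => ∫ s, Φ p s ∂P :=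
    funext fun p => (hΦ.unbiased p p.2).symm
  rw [e]
  exact (hΦ.measurable.stronglyMeasurable.integral_prod_right (f := fun (p : X) s => Φ p s)).measurable

/-- The sample is independent of the past, so its joint law with any past-measurable data is a
product; Fubini freezes that data and the oracle bounds apply pointwise. The variance bound is a
lower integral against arbitrary weights, so no integrability has to be known beforehand. -/
lemma IsOracle.isNoise [IsProbabilityMeasure μ] [IsProbabilityMeasure P] {k : ℕ} {X : Set (Euc n)} {Φ : Euc n → Ξ → Euc k}
    {φ : Euc n → Euc k} {σ : ℝ} (hΦ : IsOracle P X Φ φ σ) (h𝓐 : 𝓐 ≤ mΩ) {y : Ω → Euc n}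
    (hyX : ∀ a, y a ∈ X) (hy : Measurable[𝓐] y) {s : Ω → Ξ} (hs : Measurable s)
    (hlaw : μ.map s = P) (hind : Indep 𝓐 (MeasurableSpace.comap s inferInstance) μ) :
    IsNoise 𝓐 μ (fun a => Φ (y a) (s a) - φ (y a)) σ := by
  set Y : Ω → X := fun a => ⟨y a, hyX a⟩ with hY
  have hYm : Measurable[𝓐] Y := hy.subtype_mk
  set Ψ : X × Ξ → Euc k := fun p => Φ p.1 p.2 - φ p.1 with hΨ
  have hΨm : Measurable Ψ := hΦ.measurable.sub (hΦ.measurable_mean.comp measurable_fst)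
  have hmem : ∀ p : X, MemLp (fun s => Ψ (p, s)) 2 P := fun p =>
    (hΦ.memLp p p.2).sub (memLp_const (φ p))
  have hvar : ∀ p : X, ∫⁻ s, ‖Ψ (p, s)‖ₑ ^ 2 ∂P ≤ ENNReal.ofReal (σ ^ 2) := fun p => by
    have h1 := hΦ.variance_le p p.2
    have h2 : ∫⁻ s, ‖Ψ (p, s)‖ₑ ^ 2 ∂P = ENNReal.ofReal (∫ s, ‖Ψ (p, s)‖ ^ 2 ∂P) := by
      rw [ofReal_integral_eq_lintegral_ofReal ((hmem p).integrable_norm_pow two_ne_zero)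
        (Filter.Eventually.of_forall fun s => sq_nonneg _)]
      refine lintegral_congr fun s => ?_
      rw [ENNReal.ofReal_pow (norm_nonneg _), ofReal_norm]
    rw [h2]
    exact ENNReal.ofReal_le_ofReal h1
  have hprod : ∀ {W : Type _} [MeasurableSpace W] (w : Ω → W), Measurable[𝓐] w →
      μ.map (fun a => ((Y a, w a), s a)) = (μ.map fun a => (Y a, w a)).prod P := by
    intro W _ w hw
    have hYw : Measurable[𝓐] fun a => (Y a, w a) := hYm.prodMk hw
    have hi : IndepFun (fun a => (Y a, w a)) s μ := by
      rw [IndepFun_iff_Indep]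
      exact indep_of_indep_of_le_left hind hYw.comap_le
    rw [(indepFun_iff_map_prod_eq_prod_map_map (hYw.mono h𝓐 le_rfl).aemeasurable
      hs.aemeasurable).1 hi, hlaw]
  have hNm : Measurable fun a => Φ (y a) (s a) - φ (y a) :=
    hΨm.comp ((hYm.mono h𝓐 le_rfl).prodMk hs)
  have hlint : ∀ w : Ω → ℝ≥0∞, Measurable[𝓐] w →
      ∫⁻ a, ‖Φ (y a) (s a) - φ (y a)‖ₑ ^ 2 * w a ∂μ
        ≤ ENNReal.ofReal (σ ^ 2) * ∫⁻ a, w a ∂μ := by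
    intro w hw
    have hw' : Measurable w := hw.mono h𝓐 le_rfl
    have hY' : Measurable Y := hYm.mono h𝓐 le_rfl
    have hG : Measurable fun p : (X × ℝ≥0∞) × Ξ => ‖Ψ (p.1.1, p.2)‖ₑ ^ 2 * p.1.2 := by fun_prop
    calc ∫⁻ a, ‖Φ (y a) (s a) - φ (y a)‖ₑ ^ 2 * w a ∂μ
        = ∫⁻ p, ‖Ψ (p.1.1, p.2)‖ₑ ^ 2 * p.1.2 ∂(μ.map (fun a => ((Y a, w a), s a))) := by
          rw [lintegral_map hG (by fun_prop)]
      _ = ∫⁻ q : X × ℝ≥0∞, (∫⁻ s, ‖Ψ (q.1, s)‖ₑ ^ 2 ∂P) * q.2 ∂(μ.map fun a => (Y a, w a)) := by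
          rw [hprod w hw, lintegral_prod _ hG.aemeasurable]
          refine lintegral_congr fun q => ?_
          exact lintegral_mul_const q.2
            (f := fun s => ‖Ψ (q.1, s)‖ₑ ^ 2) (by fun_prop)
      _ ≤ ∫⁻ q : X × ℝ≥0∞, ENNReal.ofReal (σ ^ 2) * q.2 ∂(μ.map fun a => (Y a, w a)) :=
          lintegral_mono fun q => mul_le_mul_left (hvar q.1) _
      _ = _ := by
          rw [lintegral_map (by fun_prop) (by fun_prop), lintegral_const_mul _ hw']
  refine ⟨hNm, hlint, fun h hh hi => ?_⟩
  have hh' : Measurable h := hh.mono h𝓐 le_rfl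
  have hint : Integrable (fun a => inner ℝ (Φ (y a) (s a) - φ (y a)) (h a)) μ := by
    refine ⟨(hNm.inner hh').aestronglyMeasurable, ?_⟩
    have h1 := hlint (fun a => ‖h a‖ₑ) (measurable_enorm.comp hh)
    calc ∫⁻ a, ‖(inner ℝ (Φ (y a) (s a) - φ (y a)) (h a) : ℝ)‖ₑ ∂μ
        ≤ ∫⁻ a, (‖Φ (y a) (s a) - φ (y a)‖ₑ ^ 2 * ‖h a‖ₑ + ‖h a‖ₑ) ∂μ := by
          refine lintegral_mono fun a => ?_
          -- `r ≤ r² + 1` trades the norm of the noise for its square. Thus integrability of `h`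
          -- suffices, which is needed when `h` is a product of two square-integrable factors.
          have h2 : ‖(inner ℝ (Φ (y a) (s a) - φ (y a)) (h a) : ℝ)‖
              ≤ ‖Φ (y a) (s a) - φ (y a)‖ ^ 2 * ‖h a‖ + ‖h a‖ := by
            refine (norm_inner_le_norm _ _).trans ?_
            nlinarith [norm_nonneg (h a), sq_nonneg (‖Φ (y a) (s a) - φ (y a)‖ - 1),
              mul_nonneg (norm_nonneg (h a)) (sq_nonneg (‖Φ (y a) (s a) - φ (y a)‖ - 1)),
              mul_nonneg (norm_nonneg (h a)) (sq_nonneg (‖Φ (y a) (s a) - φ (y a)‖))]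
          have h3 := ENNReal.ofReal_le_ofReal h2
          rwa [ENNReal.ofReal_add (by positivity) (by positivity),
            ENNReal.ofReal_mul (by positivity), ENNReal.ofReal_pow (norm_nonneg _),
            ofReal_norm, ofReal_norm, ofReal_norm] at h3
      _ = ∫⁻ a, ‖Φ (y a) (s a) - φ (y a)‖ₑ ^ 2 * ‖h a‖ₑ ∂μ + ∫⁻ a, ‖h a‖ₑ ∂μ :=
          lintegral_add_right _ hh'.enorm
      _ < ∞ := ENNReal.add_lt_top.2 ⟨h1.trans_lt (ENNReal.mul_lt_top ENNReal.ofReal_lt_top hi.2),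
          hi.2⟩
  refine ⟨hint, ?_⟩
  have hG : Measurable fun p : (X × Euc k) × Ξ => (inner ℝ (Ψ (p.1.1, p.2)) p.1.2 : ℝ) := by
    fun_prop
  have hm : Measurable fun a => ((Y a, h a), s a) :=
    ((hYm.mono h𝓐 le_rfl).prodMk hh').prodMk hs
  have e : ∫ a, inner ℝ (Φ (y a) (s a) - φ (y a)) (h a) ∂μ
      = ∫ p, (inner ℝ (Ψ (p.1.1, p.2)) p.1.2 : ℝ) ∂(μ.map (fun a => ((Y a, h a), s a))) := by
    rw [integral_map hm.aemeasurable hG.aestronglyMeasurable]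
  have hintG : Integrable (fun p : (X × Euc k) × Ξ => (inner ℝ (Ψ (p.1.1, p.2)) p.1.2 : ℝ))
      (μ.map (fun a => ((Y a, h a), s a))) :=
    (integrable_map_measure hG.aestronglyMeasurable hm.aemeasurable).2 hint
  rw [e]
  rw [hprod h hh] at hintG ⊢
  rw [integral_prod _ hintG]
  refine integral_eq_zero_of_ae (Filter.Eventually.of_forall fun q => ?_)
  have h1 : ∫ s, Ψ (q.1, s) ∂P = 0 := by
    rw [hΨ]
    simp only
    rw [integral_sub ((hΦ.memLp q.1 q.1.2).integrable one_le_two) (integrable_const _),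
      hΦ.unbiased q.1 q.1.2]
    simp
  have h2 := _root_.integral_inner (𝕜 := ℝ) ((hmem q.1).integrable one_le_two) q.2
  rw [h1, inner_zero_right] at h2
  rw [Pi.zero_apply, ← h2]
  exact integral_congr_ae (Filter.Eventually.of_forall fun s => real_inner_comm _ _)

variable {k : ℕ} {N : Ω → Euc k} {v : ℝ}

lemma IsNoise.integral_sq_mul_le (hN : IsNoise 𝓐 μ N v) (h𝓐 : 𝓐 ≤ mΩ) {w : Ω → ℝ} (hw : Measurable[𝓐] w)
    (hw0 : ∀ a, 0 ≤ w a) (hi : Integrable w μ) :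
    Integrable (fun a => ‖N a‖ ^ 2 * w a) μ ∧ ∫ a, ‖N a‖ ^ 2 * w a ∂μ ≤ v ^ 2 * ∫ a, w a ∂μ := by
  have hw' : Measurable w := hw.mono h𝓐 le_rfl
  have h1 := hN.lintegral_le (fun a => ENNReal.ofReal (w a)) hw.ennreal_ofReal
  have e : ∀ a, ENNReal.ofReal (‖N a‖ ^ 2 * w a) = ‖N a‖ₑ ^ 2 * ENNReal.ofReal (w a) := fun a => by
    rw [ENNReal.ofReal_mul (by positivity), ENNReal.ofReal_pow (norm_nonneg _),
      ofReal_norm]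
  have hm : AEStronglyMeasurable (fun a => ‖N a‖ ^ 2 * w a) μ :=
    ((hN.measurable.norm.pow_const 2).mul hw').aestronglyMeasurable
  have hnn : 0 ≤ᵐ[μ] fun a => ‖N a‖ ^ 2 * w a :=
    Filter.Eventually.of_forall fun a => mul_nonneg (sq_nonneg _) (hw0 a)
  rw [← ofReal_integral_eq_lintegral_ofReal hi (Filter.Eventually.of_forall hw0),
    ← ENNReal.ofReal_mul (sq_nonneg v)] at h1
  simp only [← e] at h1
  refine ⟨⟨hm, ?_⟩, ?_⟩
  · rw [hasFiniteIntegral_iff_ofReal hnn]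
    exact h1.trans_lt ENNReal.ofReal_lt_top
  · rw [integral_eq_lintegral_of_nonneg_ae hnn hm]
    exact ENNReal.toReal_le_of_le_ofReal (mul_nonneg (sq_nonneg v) (integral_nonneg hw0)) h1

lemma IsNoise.memLp [IsProbabilityMeasure μ] (hN : IsNoise 𝓐 μ N v) (h𝓐 : 𝓐 ≤ mΩ) : MemLp N 2 μ := by
  have h := (hN.integral_sq_mul_le h𝓐 (w := fun _ => 1) measurable_const (fun _ => zero_le_one)
    (integrable_const _)).1
  simp only [mul_one] at h
  exact (memLp_two_iff_integrable_sq_norm hN.measurable.aestronglyMeasurable).2 h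

lemma IsNoise.integral_sq_le [IsProbabilityMeasure μ] (hN : IsNoise 𝓐 μ N v) (h𝓐 : 𝓐 ≤ mΩ) :
    ∫ a, ‖N a‖ ^ 2 ∂μ ≤ v ^ 2 := by
  simpa using (hN.integral_sq_mul_le h𝓐 (w := fun _ => 1) measurable_const (fun _ => zero_le_one)
    (integrable_const _)).2

lemma MemLp.integrable_sq {u : Ω → Euc k} (hu : MemLp u 2 μ) :
    Integrable (fun a => ‖u a‖ ^ 2) μ := hu.integrable_norm_pow two_ne_zero

lemma MemLp.integrable_inner_of_two {u w : Ω → Euc k} (hu : MemLp u 2 μ) (hw : MemLp w 2 μ) :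
    Integrable (fun a => inner ℝ (u a) (w a)) μ := by
  refine Integrable.mono' ((MemLp.integrable_sq hu).add (MemLp.integrable_sq hw))
    (hu.1.inner hw.1) (Filter.Eventually.of_forall fun a => ?_)
  refine (norm_inner_le_norm _ _).trans ?_
  simp only [Pi.add_apply]
  nlinarith [sq_nonneg (‖u a‖ - ‖w a‖), sq_nonneg (‖u a‖), sq_nonneg (‖w a‖)]

lemma memLp_two_of_bound [IsProbabilityMeasure μ] {u : Ω → Euc k} (hu : Measurable u) (C : ℝ) (h : ∀ a, ‖u a‖ ≤ C) :
    MemLp u 2 μ :=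
  MemLp.of_bound hu.aestronglyMeasurable C (Filter.Eventually.of_forall h)

lemma sq_integral_norm_le [IsProbabilityMeasure μ] {u : Ω → Euc k} (hu : MemLp u 2 μ) :
    (∫ a, ‖u a‖ ∂μ) ^ 2 ≤ ∫ a, ‖u a‖ ^ 2 ∂μ := by
  set c := ∫ a, ‖u a‖ ∂μ with hc
  have hi : Integrable (fun a => ‖u a‖) μ := (hu.integrable one_le_two).norm
  -- Jensen's inequality in the form of the nonnegative expectation of `(‖u‖ - c)²`.
  have h1 : ∫ a, (2 * c * ‖u a‖ - c ^ 2) ∂μ ≤ ∫ a, ‖u a‖ ^ 2 ∂μ :=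
    integral_mono ((hi.const_mul _).sub (integrable_const _)) (MemLp.integrable_sq hu) fun a => by
      have := sq_nonneg (‖u a‖ - c)
      simp only
      linarith
  rw [integral_sub (hi.const_mul _) (integrable_const _), integral_const_mul, ← hc] at h1
  simp at h1
  linarith

/-- Orthogonal increments. -/
lemma integral_norm_sum_sq {N : ℕ → Ω → Euc k} (K : ℕ) (hN : ∀ t < K, MemLp (N t) 2 μ)
    (horth : ∀ t < K, ∫ a, inner ℝ (N t a) (∑ s ∈ Finset.range t, N s a) ∂μ = 0) :
    ∫ a, ‖∑ t ∈ Finset.range K, N t a‖ ^ 2 ∂μ = ∑ t ∈ Finset.range K, ∫ a, ‖N t a‖ ^ 2 ∂μ := by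
  induction K with
  | zero => simp
  | succ K ih =>
    have hS : MemLp (fun a => ∑ s ∈ Finset.range K, N s a) 2 μ :=
      memLp_finsetSum _ fun t ht => hN t (by have := Finset.mem_range.1 ht; omega)
    have hK := hN K (by omega)
    have e : ∀ a, ‖∑ t ∈ Finset.range (K + 1), N t a‖ ^ 2
        = ‖N K a‖ ^ 2 + 2 * inner ℝ (N K a) (∑ t ∈ Finset.range K, N t a)
          + ‖∑ t ∈ Finset.range K, N t a‖ ^ 2 := fun a => by
      rw [Finset.sum_range_succ, add_comm, norm_add_sq_real]
    have i1 := MemLp.integrable_inner_of_two hK hS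
    have i2 : Integrable (fun a => ‖N K a‖ ^ 2
        + 2 * inner ℝ (N K a) (∑ t ∈ Finset.range K, N t a)) μ :=
      (MemLp.integrable_sq hK).add (i1.const_mul 2)
    simp_rw [e]
    rw [integral_add i2 (MemLp.integrable_sq hS),
      integral_add (MemLp.integrable_sq hK) (i1.const_mul 2), integral_const_mul,
      horth K (by omega), ih (fun t ht => hN t (by omega)) (fun t ht => horth t (by omega)),
      Finset.sum_range_succ]
    ring

section Matrix

variable {N : Fin m → Ω → Euc n} {σj : Fin m → ℝ}

/-- The operator norm is at most the Frobenius norm; this is why the gradient variances enter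
through `∑ σ_j²`. -/
lemma norm_sum_smul_sq_le (l : Euc m) (G : Fin m → Euc n) :
    ‖∑ j, l j • G j‖ ^ 2 ≤ ∑ j, ‖G j‖ ^ 2 * ‖l‖ ^ 2 := by
  have h1 : ‖∑ j, l j • G j‖ ≤ ∑ j, |l j| * ‖G j‖ :=
    (norm_sum_le _ _).trans (Finset.sum_le_sum fun j _ => by rw [norm_smul, Real.norm_eq_abs])
  have h2 := Finset.sum_mul_sq_le_sq_mul_sq Finset.univ (fun j => |l j|) (fun j => ‖G j‖)
  have h3 : ‖l‖ ^ 2 = ∑ j, |l j| ^ 2 := by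
    rw [EuclideanSpace.norm_sq_eq]; rfl
  rw [← Finset.sum_mul, h3, mul_comm]
  exact (pow_le_pow_left₀ (norm_nonneg _) h1 2).trans h2

lemma norm_transposeApply_sq_le (G : Fin m → Euc n) (u : Euc n) :
    ‖transposeApply G u‖ ^ 2 ≤ ∑ j, ‖G j‖ ^ 2 * ‖u‖ ^ 2 := by
  rw [EuclideanSpace.norm_sq_eq]
  refine Finset.sum_le_sum fun j _ => ?_
  rw [transposeApply_apply, ← mul_pow]
  exact pow_le_pow_left₀ (norm_nonneg _) (norm_inner_le_norm _ _) 2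

lemma measurable_transposeApply {Ω' : Type*} {_ : MeasurableSpace Ω'} {G : Fin m → Ω' → Euc n}
    {u : Ω' → Euc n} (hG : ∀ j, Measurable (G j)) (hu : Measurable u) :
    Measurable fun a => transposeApply (fun j => G j a) (u a) :=
  (WithLp.measurable_toLp 2 _).comp (measurable_pi_lambda _ fun j => (hG j).inner hu)

lemma IsNoise.sum_sq_mul_le (hN : ∀ j, IsNoise 𝓐 μ (N j) (σj j)) (h𝓐 : 𝓐 ≤ mΩ) {r : ℕ} {u : Ω → Euc r}
    (hu : Measurable[𝓐] u) (hu2 : MemLp u 2 μ) :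
    Integrable (fun a => ∑ j, ‖N j a‖ ^ 2 * ‖u a‖ ^ 2) μ ∧
      ∫ a, ∑ j, ‖N j a‖ ^ 2 * ‖u a‖ ^ 2 ∂μ ≤ (∑ j, σj j ^ 2) * ∫ a, ‖u a‖ ^ 2 ∂μ := by
  have h := fun j => (hN j).integral_sq_mul_le h𝓐 (w := fun a => ‖u a‖ ^ 2)
    ((measurable_norm.comp hu).pow_const 2) (fun a => sq_nonneg _) (MemLp.integrable_sq hu2)
  refine ⟨integrable_finsetSum _ fun j _ => (h j).1, ?_⟩
  rw [integral_finsetSum _ fun j _ => (h j).1, Finset.sum_mul]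
  exact Finset.sum_le_sum fun j _ => (h j).2

lemma memLp_two_and_integral_le_of_sq_le {r : ℕ} {u : Ω → Euc r} {w : Ω → ℝ} (hu : Measurable u)
    (hw : Integrable w μ) (h : ∀ a, ‖u a‖ ^ 2 ≤ w a) :
    MemLp u 2 μ ∧ ∫ a, ‖u a‖ ^ 2 ∂μ ≤ ∫ a, w a ∂μ := by
  have hi : Integrable (fun a => ‖u a‖ ^ 2) μ :=
    hw.mono' (hu.norm.pow_const 2).aestronglyMeasurable
      (Filter.Eventually.of_forall fun a => by rw [Real.norm_of_nonneg (sq_nonneg _)]; exact h a)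
  exact ⟨(memLp_two_iff_integrable_sq_norm hu.aestronglyMeasurable).2 hi, integral_mono hi hw h⟩

lemma IsNoise.combination (hN : ∀ j, IsNoise 𝓐 μ (N j) (σj j)) (h𝓐 : 𝓐 ≤ mΩ) {l : Ω → Euc m}
    (hl : Measurable[𝓐] l) (hl2 : MemLp l 2 μ) :
    MemLp (fun a => ∑ j, l a j • N j a) 2 μ ∧
      ∫ a, ‖∑ j, l a j • N j a‖ ^ 2 ∂μ ≤ (∑ j, σj j ^ 2) * ∫ a, ‖l a‖ ^ 2 ∂μ := by
  have h1 := IsNoise.sum_sq_mul_le hN h𝓐 hl hl2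
  have hl' : Measurable l := hl.mono h𝓐 le_rfl
  have hm : Measurable fun a => ∑ j, l a j • N j a :=
    Finset.measurable_fun_sum _ fun j _ =>
      ((measurable_pi_apply j).comp ((WithLp.measurable_ofLp 2 _).comp hl')).smul (hN j).measurable
  have h2 := memLp_two_and_integral_le_of_sq_le hm h1.1 fun a => norm_sum_smul_sq_le (l a) _
  exact ⟨h2.1, h2.2.trans h1.2⟩

lemma IsNoise.transpose (hN : ∀ j, IsNoise 𝓐 μ (N j) (σj j)) (h𝓐 : 𝓐 ≤ mΩ) {u : Ω → Euc n}
    (hu : Measurable[𝓐] u) (hu2 : MemLp u 2 μ) :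
    MemLp (fun a => transposeApply (fun j => N j a) (u a)) 2 μ ∧
      ∫ a, ‖transposeApply (fun j => N j a) (u a)‖ ^ 2 ∂μ
        ≤ (∑ j, σj j ^ 2) * ∫ a, ‖u a‖ ^ 2 ∂μ := by
  have h1 := IsNoise.sum_sq_mul_le hN h𝓐 hu hu2
  have hu' : Measurable u := hu.mono h𝓐 le_rfl
  have h2 := memLp_two_and_integral_le_of_sq_le
    (measurable_transposeApply (fun j => (hN j).measurable) hu') h1.1
    fun a => norm_transposeApply_sq_le _ (u a)
  exact ⟨h2.1, h2.2.trans h1.2⟩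

/-- The random coefficient moves onto the test vector: `l_j u` is past-measurable and, as a product
of two `L²` factors, integrable. No bound on the multipliers is required. -/
lemma IsNoise.combination_inner (hN : ∀ j, IsNoise 𝓐 μ (N j) (σj j)) (h𝓐 : 𝓐 ≤ mΩ) {l : Ω → Euc m}
    {u : Ω → Euc n} (hl : Measurable[𝓐] l) (hl2 : MemLp l 2 μ) (hu : Measurable[𝓐] u)
    (hu2 : MemLp u 2 μ) :
    ∫ a, inner ℝ (∑ j, l a j • N j a) (u a) ∂μ = 0 := by
  have e : ∀ a, inner ℝ (∑ j, l a j • N j a) (u a) = ∑ j, inner ℝ (N j a) (l a j • u a) := fun a => by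
    rw [sum_inner]
    exact Finset.sum_congr rfl fun j _ => by
      rw [inner_smul_left, inner_smul_right]; simp
  have hlj : ∀ j, Measurable[𝓐] fun a => l a j := fun j =>
    (measurable_pi_apply j).comp ((WithLp.measurable_ofLp 2 _).comp hl)
  have h := fun j => (hN j).integral_inner (fun a => l a j • u a) ((hlj j).smul hu) (by
    refine Integrable.mono' ((MemLp.integrable_sq hl2).add (MemLp.integrable_sq hu2))
      (((hlj j).smul hu).mono h𝓐 le_rfl).aestronglyMeasurable
      (Filter.Eventually.of_forall fun a => ?_)
    have h1 : ‖l a j‖ ≤ ‖l a‖ := PiLp.norm_apply_le (l a) j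
    rw [norm_smul]
    simp only [Pi.add_apply]
    nlinarith [sq_nonneg (‖l a‖ - ‖u a‖), mul_le_mul_of_nonneg_right h1 (norm_nonneg (u a)),
      sq_nonneg (‖l a‖), sq_nonneg (‖u a‖)])
  simp_rw [e]
  rw [integral_finsetSum _ fun j _ => (h j).1]
  exact Finset.sum_eq_zero fun j _ => (h j).2

lemma IsNoise.transpose_inner (hN : ∀ j, IsNoise 𝓐 μ (N j) (σj j)) (h𝓐 : 𝓐 ≤ mΩ) {l : Ω → Euc m}
    {u : Ω → Euc n} (hl : Measurable[𝓐] l) (hl2 : MemLp l 2 μ) (hu : Measurable[𝓐] u)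
    (hu2 : MemLp u 2 μ) :
    ∫ a, inner ℝ (transposeApply (fun j => N j a) (u a)) (l a) ∂μ = 0 := by
  simp_rw [real_inner_comm (l _), inner_transposeApply]
  exact IsNoise.combination_inner hN h𝓐 hl hl2 hu hu2

end Matrix
end Noise

/-! ### Measurability of proximal steps and the filtration of the samples. -/

/-- A nonexpansive image of a measurable map is measurable. -/
lemma measurable_of_norm_sub_le {Ω : Type*} {_ : MeasurableSpace Ω} {k r : ℕ} {u : Ω → Euc k}
    {z : Ω → Euc r} (hu : Measurable u) (h : ∀ a b, ‖z a - z b‖ ≤ ‖u a - u b‖) : Measurable z := by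
  refine measurable_of_isOpen fun V hV => ?_
  -- Around each point of `z ⁻¹' V` a ball of values lies in `V`. The ball of the same radius about
  -- the value of `u` pulls back into `z ⁻¹' V`, so this preimage is a `u`-preimage of an open set.
  set W : Set (Euc k) := ⋃ p : {p : Ω × ℝ // Metric.ball (z p.1) p.2 ⊆ V},
    Metric.ball (u p.1.1) p.1.2 with hW
  have e : z ⁻¹' V = u ⁻¹' W := by
    ext a
    simp only [hW, Set.mem_preimage, Set.mem_iUnion, Subtype.exists, exists_prop, Prod.exists]
    constructor
    · intro ha
      obtain ⟨ε, hε, hb⟩ := Metric.isOpen_iff.1 hV _ ha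
      exact ⟨a, ε, hb, Metric.mem_ball_self hε⟩
    · rintro ⟨b, ε, hb, hab⟩
      refine hb ?_
      rw [Metric.mem_ball, dist_eq_norm] at hab ⊢
      exact (h a b).trans_lt hab
  rw [e]
  exact hu (isOpen_iUnion fun _ => Metric.isOpen_ball).measurableSet

/-- The σ-algebra generated by the samples with index in `S`. -/
@[reducible]
def hist {Ω Ξ : Type*} [MeasurableSpace Ξ] {T : ℕ} (ξ ξb : ℕ → Ω → Ξ) (S : Set (Fin T ⊕ Fin T)) :
    MeasurableSpace Ω :=
  ⨆ i ∈ S, MeasurableSpace.comap (Sum.elim (fun t : Fin T => ξ t) (fun t : Fin T => ξb t) i)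
    inferInstance

/-- The samples drawn before the dual step of iteration `t`. -/
@[reducible]
def past {Ω Ξ : Type*} [MeasurableSpace Ξ] (T : ℕ) (ξ ξb : ℕ → Ω → Ξ) (t : ℕ) :
    MeasurableSpace Ω :=
  hist ξ ξb {i : Fin T ⊕ Fin T | Sum.elim (fun s => s.val < t) (fun s => s.val < t) i}

/-- The samples drawn before the primal step of iteration `t`. -/
@[reducible]
def pastDual {Ω Ξ : Type*} [MeasurableSpace Ξ] (T : ℕ) (ξ ξb : ℕ → Ω → Ξ) (t : ℕ) :
    MeasurableSpace Ω :=
  hist ξ ξb {i : Fin T ⊕ Fin T | Sum.elim (fun s => s.val < t) (fun s => s.val ≤ t) i}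

section Sampling

variable {Ω Ξ : Type*} [MeasurableSpace Ξ] {T : ℕ} {ξ ξb : ℕ → Ω → Ξ}

lemma hist_mono {S S' : Set (Fin T ⊕ Fin T)} (h : S ⊆ S') :
    hist ξ ξb S ≤ hist ξ ξb S' := biSup_mono h

lemma past_le_pastDual (t : ℕ) : past T ξ ξb t ≤ pastDual T ξ ξb t :=
  hist_mono fun i hi => by rcases i with i | i <;> simp_all [le_of_lt]

lemma pastDual_le_past {s t : ℕ} (h : s < t) : pastDual T ξ ξb s ≤ past T ξ ξb t :=
  hist_mono fun i hi => by rcases i with i | i <;> simp_all <;> omega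

lemma past_mono {s t : ℕ} (h : s ≤ t) : past T ξ ξb s ≤ past T ξ ξb t :=
  hist_mono fun i hi => by rcases i with i | i <;> simp_all <;> omega

lemma measurable_hist {S : Set (Fin T ⊕ Fin T)} {i : Fin T ⊕ Fin T} (hi : i ∈ S) :
    Measurable[hist ξ ξb S]
      (Sum.elim (fun t : Fin T => ξ t) (fun t : Fin T => ξb t) i) :=
  Measurable.mono (comap_measurable _) (le_biSup (fun i => MeasurableSpace.comap
    (Sum.elim (fun t : Fin T => ξ t) (fun t : Fin T => ξb t) i) inferInstance) hi) le_rfl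

lemma measurable_past {s t : ℕ} (h : s < t) (hs : s < T) : Measurable[past T ξ ξb t] (ξ s) :=
  measurable_hist (i := Sum.inl ⟨s, hs⟩) h

lemma measurable_pastDual {t : ℕ} (ht : t < T) : Measurable[pastDual T ξ ξb t] (ξb t) :=
  measurable_hist (i := Sum.inr ⟨t, ht⟩) (le_refl t)

variable [mΩ : MeasurableSpace Ω] {μ : Measure Ω} {P : Measure Ξ}

lemma IsSampling.measurable_elim (h : IsSampling μ P T ξ ξb) (i : Fin T ⊕ Fin T) :
    Measurable (Sum.elim (fun t : Fin T => ξ t) (fun t : Fin T => ξb t) i) := by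
  rcases i with i | i
  · exact (h.measurable i i.2).1
  · exact (h.measurable i i.2).2

lemma IsSampling.hist_le (h : IsSampling μ P T ξ ξb) (S : Set (Fin T ⊕ Fin T)) :
    hist ξ ξb S ≤ mΩ :=
  iSup₂_le fun i _ => (h.measurable_elim i).comap_le

lemma IsSampling.indep_hist (h : IsSampling μ P T ξ ξb) {S : Set (Fin T ⊕ Fin T)}
    {i : Fin T ⊕ Fin T} (hi : i ∉ S) :
    Indep (hist ξ ξb S) (MeasurableSpace.comap
      (Sum.elim (fun t : Fin T => ξ t) (fun t : Fin T => ξb t) i) inferInstance) μ := by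
  have := indep_iSup_of_disjoint (fun i => (h.measurable_elim i).comap_le) h.indep.iIndep
    (Set.disjoint_singleton_right.2 hi)
  simpa [hist] using this

lemma IsSampling.indep_past (h : IsSampling μ P T ξ ξb) {t : ℕ} (ht : t < T) :
    Indep (past T ξ ξb t) (MeasurableSpace.comap (ξb t) inferInstance) μ :=
  h.indep_hist (i := Sum.inr ⟨t, ht⟩) (by simp)

/-- The dual sample of iteration `t` already belongs to this past, so `λ^{t+1}` is known while `ξ^t`
is still fresh. -/
lemma IsSampling.indep_pastDual (h : IsSampling μ P T ξ ξb) {t : ℕ} (ht : t < T) :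
    Indep (pastDual T ξ ξb t) (MeasurableSpace.comap (ξ t) inferInstance) μ :=
  h.indep_hist (i := Sum.inl ⟨t, ht⟩) (by simp)

end Sampling

/-! ### The stochastic run and its noises. -/

lemma IsOracle.measurable_comp {Ω Ξ : Type*} {_ : MeasurableSpace Ω} [MeasurableSpace Ξ] {P : Measure Ξ}
    {k : ℕ} {X : Set (Euc n)} {Φ : Euc n → Ξ → Euc k} {φ : Euc n → Euc k} {σ : ℝ}
    (hΦ : IsOracle P X Φ φ σ) {y : Ω → Euc n} (hyX : ∀ a, y a ∈ X) (hy : Measurable y) {s : Ω → Ξ}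
    (hs : Measurable s) : Measurable fun a => Φ (y a) (s a) :=
  hΦ.measurable.comp ((hy.subtype_mk (h := hyX)).prodMk hs)

/-- The stochastic constrained problem together with a run of F-StOpConEx with `θ_t = 1` and constant
step sizes. -/
structure IsStochasticRun {Ω Ξ : Type*} [MeasurableSpace Ω] [MeasurableSpace Ξ] (μ : Measure Ω)
    (P : Measure Ξ) (X : Set (Euc n)) (F : Euc n → Euc n) (g : Euc n → Euc m)
    (gradg : Fin m → Euc n → Euc n) (L H : ℝ) (Lgj Hgj : Fin m → ℝ) (Mg : ℝ)
    (Fs : Euc n → Ξ → Euc n) (gs : Euc n → Ξ → Euc m) (Gs : Fin m → Euc n → Ξ → Euc n)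
    (σ σg : ℝ) (σj : Fin m → ℝ) (T : ℕ) (c τ : ℝ) (ξ ξb : ℕ → Ω → Ξ) (x0 : Euc n)
    (x : ℕ → Ω → Euc n) (lam : ℕ → Ω → Euc m) : Prop where
  problem : IsProblem X F g gradg L H Lgj Hgj Mg
  Mg_nonneg : 0 ≤ Mg
  oracleF : IsOracle P X Fs F σ
  oracleg : IsOracle P X gs g σg
  oracleG : ∀ j, IsOracle P X (Gs j) (gradg j) (σj j)
  sampling : IsSampling μ P T ξ ξb
  x0_mem : x0 ∈ X
  c_pos : 0 < c
  τ_pos : 0 < τ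
  run : IsRun X Fs gs Gs (fun _ => 1) (fun _ => c) (fun _ => τ) T ξ ξb x0 x lam

/-- The noise of the operator. -/
def opNoise {Ω Ξ : Type*} (Fs : Euc n → Ξ → Euc n) (F : Euc n → Euc n)
    (ξ : ℕ → Ω → Ξ) (x : ℕ → Ω → Euc n) (t : ℕ) (a : Ω) : Euc n :=
  Fs (x t a) (ξ t a) - F (x t a)

/-- The noise of the extrapolated constraint estimate. -/
def dualNoise {Ω Ξ : Type*} (gs : Euc n → Ξ → Euc m) (Gs : Fin m → Euc n → Ξ → Euc n)
    (g : Euc n → Euc m) (gradg : Fin m → Euc n → Euc n) (ξb : ℕ → Ω → Ξ) (x : ℕ → Ω → Euc n)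
    (t : ℕ) (a : Ω) : Euc m :=
  dualSignal gs Gs (fun _ => 1) ξb x t a - ((2 : ℝ) • lin g gradg (x (t - 1) a) (x t a)
    - lin g gradg (x (t - 1 - 1) a) (x (t - 1) a))

/-- Both linearizations use the fresh sample `ξb t`, at points and with displacements fixed by the
past, so the noise is a combination of centered oracle errors. -/
lemma dualNoise_eq {Ω Ξ : Type*} {g : Euc n → Euc m} {gradg : Fin m → Euc n → Euc n}
    {gs : Euc n → Ξ → Euc m} {Gs : Fin m → Euc n → Ξ → Euc n} {ξb : ℕ → Ω → Ξ}
    {x : ℕ → Ω → Euc n} (t : ℕ) (a : Ω) : dualNoise gs Gs g gradg ξb x t a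
    = (2 : ℝ) • ((gs (x (t - 1) a) (ξb t a) - g (x (t - 1) a))
        + transposeApply (fun j => Gs j (x (t - 1) a) (ξb t a) - gradg j (x (t - 1) a))
          (x t a - x (t - 1) a))
      - ((gs (x (t - 2) a) (ξb t a) - g (x (t - 2) a))
        + transposeApply (fun j => Gs j (x (t - 2) a) (ξb t a) - gradg j (x (t - 2) a))
          (x (t - 1) a - x (t - 2) a)) := by
  have e : ∀ (u v : Fin m → Euc n) (w : Euc n), transposeApply (fun j => u j - v j) w
      = transposeApply u w - transposeApply v w := fun u v w => by
    ext j; simp [inner_sub_left]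
  simp only [dualNoise, dualSignal, stochLin, lin, e, Nat.sub_sub, Nat.reduceAdd]
  module

namespace IsStochasticRun

variable {Ω Ξ : Type*} {𝓑 : MeasurableSpace Ω} [mΩ : MeasurableSpace Ω] [MeasurableSpace Ξ]
  {μ : Measure Ω} {P : Measure Ξ} {X : Set (Euc n)}
  {F : Euc n → Euc n} {g : Euc n → Euc m} {gradg : Fin m → Euc n → Euc n} {L H : ℝ}
  {Lgj Hgj : Fin m → ℝ} {Mg : ℝ} {Fs : Euc n → Ξ → Euc n} {gs : Euc n → Ξ → Euc m}
  {Gs : Fin m → Euc n → Ξ → Euc n} {σ σg : ℝ} {σj : Fin m → ℝ} {T : ℕ} {c τ : ℝ}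
  {ξ ξb : ℕ → Ω → Ξ} {x0 : Euc n} {x : ℕ → Ω → Euc n} {lam : ℕ → Ω → Euc m}

lemma x_mem (hr : IsStochasticRun μ P X F g gradg L H Lgj Hgj Mg Fs gs Gs σ σg σj T c τ ξ ξb x0 x lam)
    {t : ℕ} (ht : t ≤ T) (a : Ω) : x t a ∈ X := by
  cases t with
  | zero => rw [hr.run.x_zero]; exact hr.x0_mem
  | succ t => exact (hr.run.x_step t (by omega) a).1

lemma lam_mem (hr : IsStochasticRun μ P X F g gradg L H Lgj Hgj Mg Fs gs Gs σ σg σj T c τ ξ ξb x0 x lam)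
    {t : ℕ} (ht : t < T) (a : Ω) : lam (t + 1) a ∈ orthant m := (hr.run.lam_step t ht a).1

lemma past_le (hr : IsStochasticRun μ P X F g gradg L H Lgj Hgj Mg Fs gs Gs σ σg σj T c τ ξ ξb x0 x lam)
    (t : ℕ) : past T ξ ξb t ≤ mΩ := hr.sampling.hist_le _

lemma pastDual_le
    (hr : IsStochasticRun μ P X F g gradg L H Lgj Hgj Mg Fs gs Gs σ σg σj T c τ ξ ξb x0 x lam)
    (t : ℕ) : pastDual T ξ ξb t ≤ mΩ := hr.sampling.hist_le _

lemma measurable_dualSignal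
    (hr : IsStochasticRun μ P X F g gradg L H Lgj Hgj Mg Fs gs Gs σ σg σj T c τ ξ ξb x0 x lam)
    {t : ℕ} (ht : t < T) (hx : ∀ s ≤ t, Measurable[𝓑] (x s))
    (hξ : Measurable[𝓑] (ξb t)) :
    Measurable[𝓑] (dualSignal gs Gs (fun _ => 1) ξb x t) := by
  have h1 := fun s (hs : s ≤ t) => hr.oracleg.measurable_comp (hr.x_mem (hs.trans ht.le)) (hx s hs) hξ
  have h2 := fun s (hs : s ≤ t) j =>
    (hr.oracleG j).measurable_comp (hr.x_mem (hs.trans ht.le)) (hx s hs) hξ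
  have h3 := fun s s' (hs : s ≤ t) (hs' : s' ≤ t) =>
    (h1 s hs).add (measurable_transposeApply (h2 s hs) ((hx s' hs').sub (hx s hs)))
  exact ((h3 (t - 1) t (by omega) le_rfl).const_smul (1 + 1 : ℝ)).sub
    ((h3 (t - 2) (t - 1) (by omega) (by omega)).const_smul (1 : ℝ))

/-- The step is nonexpansive in its shifted center, so measurability follows without a formula for
the minimizer. -/
lemma measurable_lam_succ
    (hr : IsStochasticRun μ P X F g gradg L H Lgj Hgj Mg Fs gs Gs σ σg σj T c τ ξ ξb x0 x lam)
    {t : ℕ} (ht : t < T) (hx : ∀ s ≤ t, Measurable[past T ξ ξb t] (x s))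
    (hlam : Measurable[past T ξ ξb t] (lam t)) :
    Measurable[pastDual T ξ ξb t] (lam (t + 1)) := by
  have h1 := hr.measurable_dualSignal ht
    (fun s hs => (hx s hs).mono (past_le_pastDual t) le_rfl) (measurable_pastDual ht)
  exact measurable_of_norm_sub_le
    ((hlam.mono (past_le_pastDual t) le_rfl).sub (h1.neg.const_smul τ⁻¹))
    fun a b => (hr.run.lam_step t ht a).norm_sub_le (convex_orthant m) hr.τ_pos
      (hr.run.lam_step t ht b)

lemma measurable_x_succ
    (hr : IsStochasticRun μ P X F g gradg L H Lgj Hgj Mg Fs gs Gs σ σg σj T c τ ξ ξb x0 x lam)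
    {t : ℕ} (ht : t < T) (hx : ∀ s ≤ t, Measurable[𝓑] (x s))
    (hξ : ∀ s ≤ t, Measurable[𝓑] (ξ s)) (hlam : Measurable[𝓑] (lam (t + 1))) :
    Measurable[𝓑] (x (t + 1)) := by
  have h1 := fun s (hs : s ≤ t) =>
    hr.oracleF.measurable_comp (hr.x_mem (hs.trans ht.le)) (hx s hs) (hξ s hs)
  have h2 := fun j => (hr.oracleG j).measurable_comp (hr.x_mem ht.le) (hx t le_rfl) (hξ t le_rfl)
  have h3 : ∀ j, Measurable[𝓑] fun a => lam (t + 1) a j := fun j =>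
    (measurable_pi_apply j).comp ((WithLp.measurable_ofLp 2 _).comp hlam)
  have h4 : Measurable[𝓑] (primalSignal Fs Gs (fun _ => 1) ξ x lam t) :=
    (((h1 t le_rfl).const_smul (1 + 1 : ℝ)).sub ((h1 (t - 1) (by omega)).const_smul (1 : ℝ))).add
      (Finset.measurable_fun_sum _ fun j _ => (h3 j).smul (h2 j))
  exact measurable_of_norm_sub_le ((hx t le_rfl).sub (h4.const_smul c⁻¹))
    fun a b => (hr.run.x_step t ht a).norm_sub_le hr.problem.convex hr.c_pos
      (hr.run.x_step t ht b)

lemma measurable_iterates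
    (hr : IsStochasticRun μ P X F g gradg L H Lgj Hgj Mg Fs gs Gs σ σg σj T c τ ξ ξb x0 x lam)
    {t : ℕ} (ht : t ≤ T) :
    (∀ s ≤ t, Measurable[past T ξ ξb t] (x s)) ∧ ∀ s ≤ t, Measurable[past T ξ ξb t] (lam s) := by
  induction t with
  | zero =>
    have e1 : x 0 = fun _ => x0 := funext hr.run.x_zero
    have e2 : lam 0 = fun _ => 0 := funext hr.run.lam_zero
    refine ⟨fun s hs => ?_, fun s hs => ?_⟩
    · rw [Nat.le_zero.1 hs, e1]; exact measurable_const
    · rw [Nat.le_zero.1 hs, e2]; exact measurable_const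
  | succ t ih =>
    obtain ⟨h1, h2⟩ := ih (by omega)
    have h3 := hr.measurable_lam_succ (by omega) h1 (h2 t le_rfl)
    have hle := past_mono (T := T) (ξ := ξ) (ξb := ξb) (Nat.le_succ t)
    have h1' := fun s hs => (h1 s hs).mono hle le_rfl
    have h3' := h3.mono (pastDual_le_past (Nat.lt_succ_self t)) le_rfl
    have h4 := hr.measurable_x_succ (by omega) h1'
      (fun s hs => measurable_past (T := T) (ξb := ξb) (Nat.lt_succ_of_le hs) (by omega)) h3'
    refine ⟨fun s hs => ?_, fun s hs => ?_⟩
    · rcases Nat.lt_or_eq_of_le hs with h | rfl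
      · exact h1' s (by omega)
      · exact h4
    · rcases Nat.lt_or_eq_of_le hs with h | rfl
      · exact (h2 s (by omega)).mono hle le_rfl
      · exact h3'

lemma measurable_x_past
    (hr : IsStochasticRun μ P X F g gradg L H Lgj Hgj Mg Fs gs Gs σ σg σj T c τ ξ ξb x0 x lam)
    {s t : ℕ} (hst : s ≤ t) (ht : t ≤ T) : Measurable[past T ξ ξb t] (x s) :=
  (hr.measurable_iterates ht).1 s hst

lemma measurable_x
    (hr : IsStochasticRun μ P X F g gradg L H Lgj Hgj Mg Fs gs Gs σ σg σj T c τ ξ ξb x0 x lam)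
    {t : ℕ} (ht : t ≤ T) : Measurable (x t) :=
  (hr.measurable_x_past le_rfl ht).mono (hr.past_le t) le_rfl

lemma measurable_lam_past
    (hr : IsStochasticRun μ P X F g gradg L H Lgj Hgj Mg Fs gs Gs σ σg σj T c τ ξ ξb x0 x lam)
    {s t : ℕ} (hst : s ≤ t) (ht : t ≤ T) : Measurable[past T ξ ξb t] (lam s) :=
  (hr.measurable_iterates ht).2 s hst

lemma measurable_lam_pastDual
    (hr : IsStochasticRun μ P X F g gradg L H Lgj Hgj Mg Fs gs Gs σ σg σj T c τ ξ ξb x0 x lam)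
    {t : ℕ} (ht : t < T) : Measurable[pastDual T ξ ξb t] (lam (t + 1)) :=
  hr.measurable_lam_succ ht (fun _ hs => hr.measurable_x_past hs ht.le)
    (hr.measurable_lam_past le_rfl ht.le)

lemma norm_sub_le
    (hr : IsStochasticRun μ P X F g gradg L H Lgj Hgj Mg Fs gs Gs σ σg σj T c τ ξ ξb x0 x lam)
    {y z : Euc n} (hy : y ∈ X) (hz : z ∈ X) : ‖y - z‖ ≤ Metric.diam X := by
  rw [← dist_eq_norm]
  exact Metric.dist_le_diam_of_mem hr.problem.compact.isBounded hy hz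

lemma opNoise_isNoise [IsProbabilityMeasure μ] [IsProbabilityMeasure P]
    (hr : IsStochasticRun μ P X F g gradg L H Lgj Hgj Mg Fs gs Gs σ σg σj T c τ ξ ξb x0 x lam)
    {t : ℕ} (ht : t < T) : IsNoise (pastDual T ξ ξb t) μ (opNoise Fs F ξ x t) σ :=
  hr.oracleF.isNoise (hr.pastDual_le t) (hr.x_mem ht.le)
    ((hr.measurable_x_past le_rfl ht.le).mono (past_le_pastDual t) le_rfl)
    (hr.sampling.measurable t ht).1 (hr.sampling.law t ht).1 (hr.sampling.indep_pastDual ht)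

lemma gradNoise_isNoise [IsProbabilityMeasure μ] [IsProbabilityMeasure P]
    (hr : IsStochasticRun μ P X F g gradg L H Lgj Hgj Mg Fs gs Gs σ σg σj T c τ ξ ξb x0 x lam)
    {t : ℕ} (ht : t < T) (j : Fin m) :
    IsNoise (pastDual T ξ ξb t) μ (fun a => Gs j (x t a) (ξ t a) - gradg j (x t a)) (σj j) :=
  (hr.oracleG j).isNoise (hr.pastDual_le t) (hr.x_mem ht.le)
    ((hr.measurable_x_past le_rfl ht.le).mono (past_le_pastDual t) le_rfl)
    (hr.sampling.measurable t ht).1 (hr.sampling.law t ht).1 (hr.sampling.indep_pastDual ht)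

lemma dual_isNoise_const [IsProbabilityMeasure μ] [IsProbabilityMeasure P]
    (hr : IsStochasticRun μ P X F g gradg L H Lgj Hgj Mg Fs gs Gs σ σg σj T c τ ξ ξb x0 x lam)
    {s t : ℕ} (hst : s ≤ t) (ht : t < T) :
    IsNoise (past T ξ ξb t) μ (fun a => gs (x s a) (ξb t a) - g (x s a)) σg :=
  hr.oracleg.isNoise (hr.past_le t) (hr.x_mem (hst.trans ht.le)) (hr.measurable_x_past hst ht.le)
    (hr.sampling.measurable t ht).2 (hr.sampling.law t ht).2 (hr.sampling.indep_past ht)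

lemma dual_isNoise_grad [IsProbabilityMeasure μ] [IsProbabilityMeasure P]
    (hr : IsStochasticRun μ P X F g gradg L H Lgj Hgj Mg Fs gs Gs σ σg σj T c τ ξ ξb x0 x lam)
    {s t : ℕ} (hst : s ≤ t) (ht : t < T) (j : Fin m) :
    IsNoise (past T ξ ξb t) μ (fun a => Gs j (x s a) (ξb t a) - gradg j (x s a)) (σj j) :=
  (hr.oracleG j).isNoise (hr.past_le t) (hr.x_mem (hst.trans ht.le))
    (hr.measurable_x_past hst ht.le)
    (hr.sampling.measurable t ht).2 (hr.sampling.law t ht).2 (hr.sampling.indep_past ht)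

lemma memLp_x_sub [IsProbabilityMeasure μ]
    (hr : IsStochasticRun μ P X F g gradg L H Lgj Hgj Mg Fs gs Gs σ σg σj T c τ ξ ξb x0 x lam)
    {s t : ℕ} (hs : s ≤ T) (ht : t ≤ T) : MemLp (fun a => x s a - x t a) 2 μ :=
  memLp_two_of_bound ((hr.measurable_x hs).sub (hr.measurable_x ht)) (Metric.diam X)
    fun a => hr.norm_sub_le (hr.x_mem hs a) (hr.x_mem ht a)

lemma dualNoise_memLp_and_integral_le [IsProbabilityMeasure μ] [IsProbabilityMeasure P]
    (hr : IsStochasticRun μ P X F g gradg L H Lgj Hgj Mg Fs gs Gs σ σg σj T c τ ξ ξb x0 x lam)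
    {t : ℕ} (ht : t < T) :
    MemLp (dualNoise gs Gs g gradg ξb x t) 2 μ ∧
      ∫ a, ‖dualNoise gs Gs g gradg ξb x t a‖ ^ 2 ∂μ ≤ 27 / 2 * σg ^ 2
        + (∑ j, σj j ^ 2) * (18 * ∫ a, ‖x t a - x (t - 1) a‖ ^ 2 ∂μ
          + 9 * ∫ a, ‖x (t - 1) a - x (t - 1 - 1) a‖ ^ 2 ∂μ) := by
  have hA := hr.past_le t
  have a1 := hr.dual_isNoise_const (s := t - 1) (by omega) ht
  have a2 := hr.dual_isNoise_const (s := t - 2) (by omega) ht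
  have b1 := IsNoise.transpose (hr.dual_isNoise_grad (s := t - 1) (by omega) ht) hA
    (u := fun a => x t a - x (t - 1) a) ((hr.measurable_x_past (s := t) le_rfl ht.le).sub
      (hr.measurable_x_past (s := t - 1) (by omega) ht.le))
    (hr.memLp_x_sub ht.le (by omega))
  have b2 := IsNoise.transpose (hr.dual_isNoise_grad (s := t - 2) (by omega) ht) hA
    (u := fun a => x (t - 1) a - x (t - 2) a)
    ((hr.measurable_x_past (s := t - 1) (by omega) ht.le).sub
      (hr.measurable_x_past (s := t - 2) (by omega) ht.le))
    (hr.memLp_x_sub (by omega) (by omega))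
  have a1' := a1.memLp hA
  have a2' := a2.memLp hA
  have hm : MemLp (dualNoise gs Gs g gradg ξb x t) 2 μ := by
    have e := funext (dualNoise_eq (gs := gs) (Gs := Gs) (g := g) (gradg := gradg) (ξb := ξb)
      (x := x) t)
    rw [e]
    exact ((a1'.add b1.1).const_smul (2 : ℝ)).sub (a2'.add b2.1)
  refine ⟨hm, ?_⟩
  -- `(2a + b)² ≤ 6a² + 3b²` followed by `(r + s)² ≤ 3/2 r² + 3 s²`. The weights favour `u, u'`,
  -- whose variance stays in the final bound; the parts with `v, v'` carry squared increments and
  -- will be absorbed.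
  have key : ∀ u v u' v' : Euc m, ‖(2 : ℝ) • (u + v) - (u' + v')‖ ^ 2
      ≤ 9 * ‖u‖ ^ 2 + 18 * ‖v‖ ^ 2 + (9 / 2 * ‖u'‖ ^ 2 + 9 * ‖v'‖ ^ 2) := fun u v u' v' => by
    have h1 : ‖(2 : ℝ) • (u + v) - (u' + v')‖ ≤ 2 * (‖u‖ + ‖v‖) + (‖u'‖ + ‖v'‖) := by
      refine (_root_.norm_sub_le _ _).trans (add_le_add ?_ (norm_add_le _ _))
      rw [norm_smul]
      simpa using norm_add_le u v
    refine (pow_le_pow_left₀ (norm_nonneg _) h1 2).trans ?_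
    nlinarith [sq_nonneg (‖u‖ + ‖v‖ - (‖u'‖ + ‖v'‖)), sq_nonneg (‖u‖ - 2 * ‖v‖),
      sq_nonneg (‖u'‖ - 2 * ‖v'‖)]
  have i1 := (MemLp.integrable_sq a1').const_mul 9
  have i2 := (MemLp.integrable_sq b1.1).const_mul 18
  have i3 := (MemLp.integrable_sq a2').const_mul (9 / 2)
  have i4 := (MemLp.integrable_sq b2.1).const_mul 9
  have h1 := integral_mono (MemLp.integrable_sq hm) ((i1.add i2).add (i3.add i4)) fun a => by
    simp only [dualNoise_eq]
    exact key _ _ _ _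
  rw [integral_add' (i1.add i2) (i3.add i4), integral_add' i1 i2, integral_add' i3 i4,
    integral_const_mul, integral_const_mul, integral_const_mul, integral_const_mul] at h1
  have h2 := a1.integral_sq_le hA
  have h3 := a2.integral_sq_le hA
  have h4 := b1.2
  have h5 := b2.2
  rw [Nat.sub_sub]
  linarith

lemma dualNoise_inner [IsProbabilityMeasure μ] [IsProbabilityMeasure P]
    (hr : IsStochasticRun μ P X F g gradg L H Lgj Hgj Mg Fs gs Gs σ σg σj T c τ ξ ξb x0 x lam)
    {t : ℕ} (ht : t < T) {l : Ω → Euc m} (hl : Measurable[past T ξ ξb t] l) (hl2 : MemLp l 2 μ) :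
    ∫ a, inner ℝ (dualNoise gs Gs g gradg ξb x t a) (l a) ∂μ = 0 := by
  have hA := hr.past_le t
  have main : ∀ s r, s ≤ t → r ≤ t →
      Integrable (fun a => inner ℝ ((gs (x s a) (ξb t a) - g (x s a))
        + transposeApply (fun j => Gs j (x s a) (ξb t a) - gradg j (x s a)) (x r a - x s a)) (l a)) μ
      ∧ ∫ a, inner ℝ ((gs (x s a) (ξb t a) - g (x s a))
        + transposeApply (fun j => Gs j (x s a) (ξb t a) - gradg j (x s a)) (x r a - x s a)) (l a) ∂μ
        = 0 := by
    intro s r hs hr'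
    have a1 := (hr.dual_isNoise_const hs ht).integral_inner l hl (hl2.integrable one_le_two)
    have hu : Measurable[past T ξ ξb t] fun a => x r a - x s a :=
      (hr.measurable_x_past hr' ht.le).sub (hr.measurable_x_past hs ht.le)
    have hu2 := hr.memLp_x_sub (hr'.trans ht.le) (hs.trans ht.le)
    have b1 := IsNoise.transpose (hr.dual_isNoise_grad hs ht) hA hu hu2
    have b2 := IsNoise.transpose_inner (hr.dual_isNoise_grad hs ht) hA hl hl2 hu hu2
    have b3 := MemLp.integrable_inner_of_two b1.1 hl2
    simp_rw [inner_add_left]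
    exact ⟨a1.1.add b3, by rw [integral_add a1.1 b3, a1.2]; simpa using b2⟩
  have h1 := main (t - 1) t (by omega) le_rfl
  have h2 := main (t - 2) (t - 1) (by omega) (by omega)
  simp_rw [dualNoise_eq, inner_sub_left, inner_smul_left]
  rw [integral_sub (h1.1.const_mul _) h2.1, integral_const_mul, h1.2, h2.2]
  simp

lemma primal_step
    (hr : IsStochasticRun μ P X F g gradg L H Lgj Hgj Mg Fs gs Gs σ σg σj T c τ ξ ξb x0 x lam)
    {t : ℕ} (ht : t < T) (a : Ω) {y : Euc n} (hy : y ∈ X) :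
    inner ℝ ((2 : ℝ) • (F (x t a) + opNoise Fs F ξ x t a)
        - (F (x (t - 1) a) + opNoise Fs F ξ x (t - 1) a)
        + (∑ j, lam (t + 1) a j • gradg j (x t a)) + gradNoise Gs gradg ξ x lam t a)
        (x (t + 1) a - y)
      ≤ c / 2 * (‖y - x t a‖ ^ 2 - ‖x (t + 1) a - x t a‖ ^ 2 - ‖y - x (t + 1) a‖ ^ 2) := by
  have h := (hr.run.x_step t ht a).inner_le hr.problem.convex hy
  refine le_of_eq_of_le ?_ h
  congr 1
  simp only [primalSignal, opNoise, gradNoise, smul_sub, Finset.sum_sub_distrib]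
  module

lemma dual_step
    (hr : IsStochasticRun μ P X F g gradg L H Lgj Hgj Mg Fs gs Gs σ σg σj T c τ ξ ξb x0 x lam)
    {t : ℕ} (ht : t < T) (a : Ω) {l : Euc m} (hl : l ∈ orthant m) :
    inner ℝ (-((2 : ℝ) • lin g gradg (x (t - 1) a) (x t a)
        - lin g gradg (x (t - 1 - 1) a) (x (t - 1) a) + dualNoise gs Gs g gradg ξb x t a))
        (lam (t + 1) a - l)
      ≤ τ / 2 * (‖l - lam t a‖ ^ 2 - ‖lam (t + 1) a - lam t a‖ ^ 2 - ‖l - lam (t + 1) a‖ ^ 2) := by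
  have h := (hr.run.lam_step t ht a).inner_le (convex_orthant m) hl
  refine le_of_eq_of_le ?_ h
  congr 1
  simp only [dualNoise]
  module

lemma norm_lin_le
    (hr : IsStochasticRun μ P X F g gradg L H Lgj Hgj Mg Fs gs Gs σ σg σj T c τ ξ ξb x0 x lam)
    {y z : Euc n} (hy : y ∈ X) (hz : z ∈ X) :
    ‖lin g gradg y z‖ ≤ ‖g x0‖ + 2 * (Mg * Metric.diam X) := by
  have h1 := hr.problem.g_lipschitz y hy x0 hr.x0_mem
  have h2 := hr.problem.gradg_bound y hy (z - y)
  have h3 := mul_le_mul_of_nonneg_left (hr.norm_sub_le hy hr.x0_mem) hr.Mg_nonneg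
  have h4 := mul_le_mul_of_nonneg_left (hr.norm_sub_le hz hy) hr.Mg_nonneg
  have h5 : ‖g y‖ ≤ ‖g x0‖ + ‖g y - g x0‖ := norm_le_norm_add_norm_sub' _ _
  have h6 : ‖lin g gradg y z‖ ≤ _ := norm_add_le _ _
  linarith

/-- Only qualitative, and growing with `t`: it makes the expectations meaningful before the uniform
bound is available. Testing the dual step at `λ^t` itself bounds the displacement by the norm of the
signal over `τ`. -/
lemma memLp_lam [IsProbabilityMeasure μ] [IsProbabilityMeasure P]
    (hr : IsStochasticRun μ P X F g gradg L H Lgj Hgj Mg Fs gs Gs σ σg σj T c τ ξ ξb x0 x lam)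
    {t : ℕ} (ht : t ≤ T) : MemLp (lam t) 2 μ := by
  induction t with
  | zero =>
    have e2 : lam 0 = fun _ => 0 := funext hr.run.lam_zero
    rw [e2]; exact memLp_const _
  | succ t ih =>
    have ih := ih (by omega)
    have hz := (hr.dualNoise_memLp_and_integral_le (t := t) (by omega)).1
    set C := ‖g x0‖ + 2 * (Mg * Metric.diam X)
    have hb : MemLp (fun a => ‖lam t a‖ + τ⁻¹ * (3 * C + ‖dualNoise gs Gs g gradg ξb x t a‖)) 2 μ :=
      ih.norm.add (((memLp_const (3 * C)).add hz.norm).const_mul _)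
    refine hb.of_le ((hr.measurable_lam_past le_rfl ht).mono (hr.past_le _)
      le_rfl).aestronglyMeasurable (Filter.Eventually.of_forall fun a => ?_)
    have hl : lam t a ∈ orthant m := by
      cases t with
      | zero => rw [hr.run.lam_zero]; exact zero_mem_orthant m
      | succ t => exact hr.lam_mem (by omega) a
    have h1 := hr.dual_step (t := t) (by omega) a hl
    rw [sub_self, norm_zero, norm_sub_rev (lam t a)] at h1
    set w := (2 : ℝ) • lin g gradg (x (t - 1) a) (x t a)
        - lin g gradg (x (t - 1 - 1) a) (x (t - 1) a) + dualNoise gs Gs g gradg ξb x t a with hw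
    have h2 : ‖w‖ ≤ 3 * C + ‖dualNoise gs Gs g gradg ξb x t a‖ := by
      have i1 : ‖lin g gradg (x (t - 1) a) (x t a)‖ ≤ C :=
        hr.norm_lin_le (hr.x_mem (by omega) a) (hr.x_mem (by omega) a)
      have i2 : ‖lin g gradg (x (t - 1 - 1) a) (x (t - 1) a)‖ ≤ C :=
        hr.norm_lin_le (hr.x_mem (by omega) a) (hr.x_mem (by omega) a)
      have i3 : ‖(2 : ℝ) • lin g gradg (x (t - 1) a) (x t a)‖
          = 2 * ‖lin g gradg (x (t - 1) a) (x t a)‖ := by rw [norm_smul]; simp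
      have i4 := _root_.norm_sub_le ((2 : ℝ) • lin g gradg (x (t - 1) a) (x t a))
        (lin g gradg (x (t - 1 - 1) a) (x (t - 1) a))
      have i5 : ‖w‖ ≤ _ := norm_add_le _ _
      linarith
    have h3 : -(‖w‖ * ‖lam (t + 1) a - lam t a‖) ≤ inner ℝ (-w) (lam (t + 1) a - lam t a) := by
      rw [inner_neg_left]
      exact neg_le_neg (real_inner_le_norm _ _)
    have h4 : τ * ‖lam (t + 1) a - lam t a‖ ≤ ‖w‖ := by
      rcases (norm_nonneg (lam (t + 1) a - lam t a)).eq_or_lt with h0 | h0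
      · rw [← h0, mul_zero]; exact norm_nonneg _
      · have : (τ * ‖lam (t + 1) a - lam t a‖) * ‖lam (t + 1) a - lam t a‖
            ≤ ‖w‖ * ‖lam (t + 1) a - lam t a‖ := by nlinarith
        exact le_of_mul_le_mul_right this h0
    have h5 : ‖lam (t + 1) a - lam t a‖ ≤ τ⁻¹ * (3 * C + ‖dualNoise gs Gs g gradg ξb x t a‖) := by
      rw [← div_eq_inv_mul, le_div_iff₀ hr.τ_pos]; linarith
    have h6 : ‖lam (t + 1) a‖ ≤ ‖lam t a‖ + ‖lam (t + 1) a - lam t a‖ :=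
      norm_le_norm_add_norm_sub' _ _
    exact (h6.trans (by linarith)).trans (le_abs_self _)

lemma gradNoise_memLp_and_integral_le [IsProbabilityMeasure μ] [IsProbabilityMeasure P]
    (hr : IsStochasticRun μ P X F g gradg L H Lgj Hgj Mg Fs gs Gs σ σg σj T c τ ξ ξb x0 x lam)
    {t : ℕ} (ht : t < T) :
    MemLp (gradNoise Gs gradg ξ x lam t) 2 μ ∧
      ∫ a, ‖gradNoise Gs gradg ξ x lam t a‖ ^ 2 ∂μ
        ≤ (∑ j, σj j ^ 2) * ∫ a, ‖lam (t + 1) a‖ ^ 2 ∂μ :=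
  IsNoise.combination (hr.gradNoise_isNoise ht) (hr.pastDual_le t) (hr.measurable_lam_pastDual ht)
    (hr.memLp_lam ht)

lemma gradNoise_inner [IsProbabilityMeasure μ] [IsProbabilityMeasure P]
    (hr : IsStochasticRun μ P X F g gradg L H Lgj Hgj Mg Fs gs Gs σ σg σj T c τ ξ ξb x0 x lam)
    {t : ℕ} (ht : t < T) {u : Ω → Euc n} (hu : Measurable[pastDual T ξ ξb t] u)
    (hu2 : MemLp u 2 μ) :
    ∫ a, inner ℝ (gradNoise Gs gradg ξ x lam t a) (u a) ∂μ = 0 :=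
  IsNoise.combination_inner (hr.gradNoise_isNoise ht) (hr.pastDual_le t)
    (hr.measurable_lam_pastDual ht) (hr.memLp_lam ht) hu hu2

end IsStochasticRun

/-! ### Second moments of the noise sums and the estimate with fluctuations. -/

namespace IsStochasticRun

variable {Ω Ξ : Type*} {𝓑 : MeasurableSpace Ω} [mΩ : MeasurableSpace Ω] [MeasurableSpace Ξ]
  {μ : Measure Ω} {P : Measure Ξ} {X : Set (Euc n)}
  {F : Euc n → Euc n} {g : Euc n → Euc m} {gradg : Fin m → Euc n → Euc n} {L H : ℝ}
  {Lgj Hgj : Fin m → ℝ} {Mg : ℝ} {Fs : Euc n → Ξ → Euc n} {gs : Euc n → Ξ → Euc m}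
  {Gs : Fin m → Euc n → Ξ → Euc n} {σ σg : ℝ} {σj : Fin m → ℝ} {T : ℕ} {c τ : ℝ}
  {ξ ξb : ℕ → Ω → Ξ} {x0 : Euc n} {x : ℕ → Ω → Euc n} {lam : ℕ → Ω → Euc m}
  [IsProbabilityMeasure P]

lemma measurable_opNoise_past
    (hr : IsStochasticRun μ P X F g gradg L H Lgj Hgj Mg Fs gs Gs σ σg σj T c τ ξ ξb x0 x lam)
    {s t : ℕ} (hst : s < t) (ht : t ≤ T) : Measurable[past T ξ ξb t] (opNoise Fs F ξ x s) := by
  have hx := hr.measurable_x_past hst.le ht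
  have hX := hr.x_mem (t := s) (by omega)
  exact (hr.oracleF.measurable_comp hX hx (measurable_past hst (by omega))).sub
    (hr.oracleF.measurable_mean.comp (hx.subtype_mk (h := hX)))

lemma measurable_gradNoise_past
    (hr : IsStochasticRun μ P X F g gradg L H Lgj Hgj Mg Fs gs Gs σ σg σj T c τ ξ ξb x0 x lam)
    {s t : ℕ} (hst : s < t) (ht : t ≤ T) :
    Measurable[past T ξ ξb t] (gradNoise Gs gradg ξ x lam s) := by
  have hx := hr.measurable_x_past hst.le ht
  have hX := hr.x_mem (t := s) (by omega)
  exact Finset.measurable_fun_sum _ fun j _ =>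
    ((measurable_pi_apply j).comp ((WithLp.measurable_ofLp 2 _).comp
      (hr.measurable_lam_past (s := s + 1) hst ht))).smul
    (((hr.oracleG j).measurable_comp hX hx (measurable_past hst (by omega))).sub
      ((hr.oracleG j).measurable_mean.comp (hx.subtype_mk (h := hX))))

lemma measurable_dualNoise_past
    (hr : IsStochasticRun μ P X F g gradg L H Lgj Hgj Mg Fs gs Gs σ σg σj T c τ ξ ξb x0 x lam)
    {s t : ℕ} (hst : s < t) (ht : t ≤ T) :
    Measurable[past T ξ ξb t] (dualNoise gs Gs g gradg ξb x s) := by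
  have hx := fun r (hr' : r ≤ s) => hr.measurable_x_past (s := r) (by omega) ht
  have hX := fun r (hr' : r ≤ s) => hr.x_mem (t := r) (by omega)
  have hlin : ∀ r r', r ≤ s → r' ≤ s → Measurable[past T ξ ξb t]
      fun a => lin g gradg (x r a) (x r' a) := fun r r' h h' =>
    (hr.oracleg.measurable_mean.comp ((hx r h).subtype_mk (h := hX r h))).add
      (measurable_transposeApply
        (fun j => (hr.oracleG j).measurable_mean.comp ((hx r h).subtype_mk (h := hX r h)))
        ((hx r' h').sub (hx r h)))
  exact (hr.measurable_dualSignal (by omega) (fun r h => hx r h)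
    ((measurable_pastDual (by omega)).mono (pastDual_le_past hst) le_rfl)).sub
    (((hlin (s - 1) s (by omega) le_rfl).const_smul (2 : ℝ)).sub
      (hlin (s - 1 - 1) (s - 1) (by omega) (by omega)))

variable [IsProbabilityMeasure μ]

lemma memLp_opNoise
    (hr : IsStochasticRun μ P X F g gradg L H Lgj Hgj Mg Fs gs Gs σ σg σj T c τ ξ ξb x0 x lam)
    {t : ℕ} (ht : t < T) : MemLp (opNoise Fs F ξ x t) 2 μ :=
  (hr.opNoise_isNoise ht).memLp (hr.pastDual_le t)

lemma memLp_dualNoise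
    (hr : IsStochasticRun μ P X F g gradg L H Lgj Hgj Mg Fs gs Gs σ σg σj T c τ ξ ξb x0 x lam)
    {t : ℕ} (ht : t < T) : MemLp (dualNoise gs Gs g gradg ξb x t) 2 μ :=
  (hr.dualNoise_memLp_and_integral_le ht).1

lemma memLp_gradNoise
    (hr : IsStochasticRun μ P X F g gradg L H Lgj Hgj Mg Fs gs Gs σ σg σj T c τ ξ ξb x0 x lam)
    {t : ℕ} (ht : t < T) : MemLp (gradNoise Gs gradg ξ x lam t) 2 μ :=
  (hr.gradNoise_memLp_and_integral_le ht).1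

/-- The earlier noise belongs to the past of the later one, so the cross term vanishes. -/
lemma integral_opNoise_sub_sq_le
    (hr : IsStochasticRun μ P X F g gradg L H Lgj Hgj Mg Fs gs Gs σ σg σj T c τ ξ ξb x0 x lam)
    {t : ℕ} (ht : t + 1 < T) :
    ∫ a, ‖opNoise Fs F ξ x (t + 1) a - opNoise Fs F ξ x t a‖ ^ 2 ∂μ ≤ 2 * σ ^ 2 := by
  have h1 := hr.memLp_opNoise ht
  have h2 := hr.memLp_opNoise (t := t) (by omega)
  have h3 := (hr.opNoise_isNoise ht).integral_inner _
    ((hr.measurable_opNoise_past (Nat.lt_succ_self t) ht.le).mono (past_le_pastDual _) le_rfl)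
    (h2.integrable one_le_two)
  have h4 := (hr.opNoise_isNoise ht).integral_sq_le (hr.pastDual_le _)
  have h5 := (hr.opNoise_isNoise (t := t) (by omega)).integral_sq_le (hr.pastDual_le _)
  have i1 : Integrable (fun a => ‖opNoise Fs F ξ x (t + 1) a‖ ^ 2
      - 2 * inner ℝ (opNoise Fs F ξ x (t + 1) a) (opNoise Fs F ξ x t a)) μ :=
    (MemLp.integrable_sq h1).sub (h3.1.const_mul 2)
  simp_rw [norm_sub_sq_real]
  rw [integral_add i1 (MemLp.integrable_sq h2), integral_sub (MemLp.integrable_sq h1)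
    (h3.1.const_mul 2), integral_const_mul, h3.2]
  linarith

lemma integral_sum_opNoise_sq_le
    (hr : IsStochasticRun μ P X F g gradg L H Lgj Hgj Mg Fs gs Gs σ σg σj T c τ ξ ξb x0 x lam)
    {k : ℕ} (hk : k + 1 ≤ T) :
    ∫ a, ‖∑ t ∈ Finset.range k, opNoise Fs F ξ x (t + 1) a‖ ^ 2 ∂μ ≤ k * σ ^ 2 := by
  rw [integral_norm_sum_sq (N := fun t => opNoise Fs F ξ x (t + 1)) k
    (fun t ht => hr.memLp_opNoise (by omega)) fun t ht =>
      ((hr.opNoise_isNoise (t := t + 1) (by omega)).integral_inner _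
        (Finset.measurable_fun_sum _ fun s hs => (hr.measurable_opNoise_past
          (by have := Finset.mem_range.1 hs; omega) (by omega)).mono (past_le_pastDual _) le_rfl)
        (integrable_finsetSum _ fun s hs => (hr.memLp_opNoise
          (by have := Finset.mem_range.1 hs; omega)).integrable one_le_two)).2]
  refine (Finset.sum_le_card_nsmul _ _ (σ ^ 2) fun t ht => ?_).trans_eq (by simp)
  exact (hr.opNoise_isNoise (by have := Finset.mem_range.1 ht; omega)).integral_sq_le
    (hr.pastDual_le _)

lemma integral_sum_gradNoise_sq
    (hr : IsStochasticRun μ P X F g gradg L H Lgj Hgj Mg Fs gs Gs σ σg σj T c τ ξ ξb x0 x lam)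
    {K : ℕ} (hK : K ≤ T) :
    ∫ a, ‖∑ t ∈ Finset.range K, gradNoise Gs gradg ξ x lam t a‖ ^ 2 ∂μ
      = ∑ t ∈ Finset.range K, ∫ a, ‖gradNoise Gs gradg ξ x lam t a‖ ^ 2 ∂μ :=
  integral_norm_sum_sq K (fun t ht => hr.memLp_gradNoise (by omega)) fun t ht =>
    hr.gradNoise_inner (by omega)
      (Finset.measurable_fun_sum _ fun s hs => (hr.measurable_gradNoise_past
        (by have := Finset.mem_range.1 hs; omega) (by omega)).mono (past_le_pastDual _) le_rfl)
      (memLp_finsetSum _ fun s hs => hr.memLp_gradNoise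
        (by have := Finset.mem_range.1 hs; omega))

lemma integral_sum_dualNoise_sq
    (hr : IsStochasticRun μ P X F g gradg L H Lgj Hgj Mg Fs gs Gs σ σg σj T c τ ξ ξb x0 x lam)
    {K : ℕ} (hK : K ≤ T) :
    ∫ a, ‖∑ t ∈ Finset.range K, dualNoise gs Gs g gradg ξb x t a‖ ^ 2 ∂μ
      = ∑ t ∈ Finset.range K, ∫ a, ‖dualNoise gs Gs g gradg ξb x t a‖ ^ 2 ∂μ :=
  integral_norm_sum_sq K (fun t ht => hr.memLp_dualNoise (by omega)) fun t ht =>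
    hr.dualNoise_inner (by omega)
      (Finset.measurable_fun_sum _ fun s hs => hr.measurable_dualNoise_past
        (by have := Finset.mem_range.1 hs; omega) (by omega))
      (memLp_finsetSum _ fun s hs => hr.memLp_dualNoise
        (by have := Finset.mem_range.1 hs; omega))

/-- Both shifted sums of squared increments are dominated by the unshifted one, as increments with
truncated indices vanish; `27 = 18 + 9`. -/
lemma sum_integral_dualNoise_sq_le
    (hr : IsStochasticRun μ P X F g gradg L H Lgj Hgj Mg Fs gs Gs σ σg σj T c τ ξ ξb x0 x lam)
    {k : ℕ} (hk : k + 1 ≤ T) :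
    ∑ t ∈ Finset.range (k + 1), ∫ a, ‖dualNoise gs Gs g gradg ξb x t a‖ ^ 2 ∂μ
      ≤ (k + 1) * (27 / 2 * σg ^ 2) + 27 * (∑ j, σj j ^ 2)
        * ∫ a, ∑ t ∈ Finset.range (k + 1), ‖x (t + 1) a - x t a‖ ^ 2 ∂μ := by
  have hi : ∀ s t, s ≤ T → t ≤ T → Integrable (fun a => ‖x s a - x t a‖ ^ 2) μ := fun s t hs ht =>
    MemLp.integrable_sq (hr.memLp_x_sub hs ht)
  have h1 : ∑ t ∈ Finset.range (k + 1), ∫ a, ‖dualNoise gs Gs g gradg ξb x t a‖ ^ 2 ∂μ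
      ≤ ∑ t ∈ Finset.range (k + 1), (27 / 2 * σg ^ 2
        + (∑ j, σj j ^ 2) * (18 * ∫ a, ‖x t a - x (t - 1) a‖ ^ 2 ∂μ
          + 9 * ∫ a, ‖x (t - 1) a - x (t - 1 - 1) a‖ ^ 2 ∂μ)) :=
    Finset.sum_le_sum fun t ht => (hr.dualNoise_memLp_and_integral_le
      (by have := Finset.mem_range.1 ht; omega)).2
  refine h1.trans ?_
  have p1 : ∀ a, ∑ t ∈ Finset.range (k + 1), ‖x t a - x (t - 1) a‖ ^ 2
      ≤ ∑ t ∈ Finset.range (k + 1), ‖x (t + 1) a - x t a‖ ^ 2 := fun a => by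
    rw [← sum_norm_sub_pred_sq_add (fun t => x t a) k]
    linarith [sq_nonneg ‖x (k + 1) a - x k a‖]
  have p2 : ∀ a, ∑ t ∈ Finset.range (k + 1), ‖x (t - 1) a - x (t - 1 - 1) a‖ ^ 2
      ≤ ∑ t ∈ Finset.range (k + 1), ‖x (t + 1) a - x t a‖ ^ 2 := fun a => by
    refine le_trans ?_ (p1 a)
    have := sum_norm_sub_pred_sq_add (fun t => x (t - 1) a) k
    simp only [add_tsub_cancel_right] at this
    rw [← this]
    linarith [sq_nonneg ‖x k a - x (k - 1) a‖]
  have i0 : Integrable (fun a => ∑ t ∈ Finset.range (k + 1), ‖x (t + 1) a - x t a‖ ^ 2) μ :=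
    integrable_finsetSum _ fun t ht => by
      have := Finset.mem_range.1 ht; exact hi _ _ (by omega) (by omega)
  have e1 : ∑ t ∈ Finset.range (k + 1), ∫ a, ‖x t a - x (t - 1) a‖ ^ 2 ∂μ
      ≤ ∫ a, ∑ t ∈ Finset.range (k + 1), ‖x (t + 1) a - x t a‖ ^ 2 ∂μ := by
    have j : ∀ t ∈ Finset.range (k + 1), Integrable (fun a => ‖x t a - x (t - 1) a‖ ^ 2) μ :=
      fun t ht => by have := Finset.mem_range.1 ht; exact hi _ _ (by omega) (by omega)
    rw [← integral_finsetSum _ j]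
    exact integral_mono (integrable_finsetSum _ j) i0 p1
  have e2 : ∑ t ∈ Finset.range (k + 1), ∫ a, ‖x (t - 1) a - x (t - 1 - 1) a‖ ^ 2 ∂μ
      ≤ ∫ a, ∑ t ∈ Finset.range (k + 1), ‖x (t + 1) a - x t a‖ ^ 2 ∂μ := by
    have j : ∀ t ∈ Finset.range (k + 1),
        Integrable (fun a => ‖x (t - 1) a - x (t - 1 - 1) a‖ ^ 2) μ :=
      fun t ht => by have := Finset.mem_range.1 ht; exact hi _ _ (by omega) (by omega)
    rw [← integral_finsetSum _ j]
    exact integral_mono (integrable_finsetSum _ j) i0 p2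
  have hs : 0 ≤ ∑ j, σj j ^ 2 := Finset.sum_nonneg fun j _ => sq_nonneg _
  have := mul_le_mul_of_nonneg_left e1 hs
  have := mul_le_mul_of_nonneg_left e2 hs
  simp only [Finset.sum_add_distrib, ← Finset.mul_sum, Finset.sum_const, Finset.card_range,
    nsmul_eq_mul, Nat.cast_add, Nat.cast_one]
  linarith

/-- The estimate for the sample paths, with a random term `U` whose expectation is controlled. -/
lemma exists_fluctuation
    (hr : IsStochasticRun μ P X F g gradg L H Lgj Hgj Mg Fs gs Gs σ σg σj T c τ ξ ξb x0 x lam)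
    {cH cf cδ b ρ C β : ℝ} (hcH : 0 < cH) (hcf : 0 < cf) (hcδ : 0 < cδ)
    (hc : b + 2 * L + cH + cf + cδ + ρ ≤ c) (hb : 0 ≤ b) (hρ : 0 ≤ ρ)
    (hβ : 0 < β) (hβ' : β ≤ 1 / 2) {k : ℕ} (hk : k + 1 ≤ T) :
    ∃ U : Ω → ℝ, Integrable U μ ∧
      ∫ a, U a ∂μ ≤ (k + 1) * (2 * σ ^ 2 / (2 * cf))
        + (∑ t ∈ Finset.range (k + 1), ∫ a, ‖gradNoise Gs gradg ξ x lam t a‖ ^ 2 ∂μ) / (2 * cδ)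
        + (k + 1) * (27 / 2 * σg ^ 2 / (2 * ((1 - β) * τ)))
        - (ρ / 2 - 9 * Mg ^ 2 / (2 * (β * τ)) - 27 * (∑ j, σj j ^ 2) / (2 * ((1 - β) * τ)))
          * ∫ a, ∑ t ∈ Finset.range (k + 1), ‖x (t + 1) a - x t a‖ ^ 2 ∂μ ∧
      ∀ a, ∀ y ∈ feasibleSet X g, ∀ l ∈ orthant m,
        (∀ t ≤ k, inner ℝ l (g (x (t + 1) a) - lin g gradg (x t a) (x (t + 1) a))
          ≤ b / 2 * ‖x (t + 1) a - x t a‖ ^ 2 + C) →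
        ∑ t ∈ Finset.range (k + 1), (inner ℝ (F (x (t + 1) a)) (x (t + 1) a - y)
            + inner ℝ l (g (x (t + 1) a))) + τ / 4 * ‖l - lam (k + 1) a‖ ^ 2
          ≤ c / 2 * ‖y - x0‖ ^ 2 + τ / 2 * ‖l‖ ^ 2 + (k + 1) * (H ^ 2 / (2 * cH) + C) + U a
            + inner ℝ (∑ t ∈ Finset.range k, opNoise Fs F ξ x (t + 1) a) (y - x0)
            + inner ℝ (∑ t ∈ Finset.range (k + 1), gradNoise Gs gradg ξ x lam t a) (y - x0)
            - inner ℝ l (∑ t ∈ Finset.range (k + 1), dualNoise gs Gs g gradg ξb x t a) := by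
  have hβτ' : 0 < (1 - β) * τ := mul_pos (by linarith) hr.τ_pos
  have lt : ∀ {t}, t ∈ Finset.range (k + 1) → t < T := fun ht => by
    have := Finset.mem_range.1 ht; omega
  have lt' : ∀ {t}, t ∈ Finset.range k → t + 1 < T := fun ht => by
    have := Finset.mem_range.1 ht; omega
  set f := opNoise Fs F ξ x with hf
  set δ := gradNoise Gs gradg ξ x lam with hδ
  set ζ := dualNoise gs Gs g gradg ξb x with hζ
  set κ := ρ / 2 - 9 * Mg ^ 2 / (2 * (β * τ)) with hκ
  have i1 : Integrable (fun a => ∑ t ∈ Finset.range (k + 1), ‖x (t + 1) a - x t a‖ ^ 2) μ :=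
    integrable_finsetSum _ fun t ht => MemLp.integrable_sq (hr.memLp_x_sub (lt ht) (lt ht).le)
  have i2 : ∀ t ∈ Finset.range k, Integrable (fun a => ‖f (t + 1) a - f t a‖ ^ 2) μ := fun t ht =>
    MemLp.integrable_sq ((hr.memLp_opNoise (lt' ht)).sub (hr.memLp_opNoise (by have := lt' ht; omega)))
  have i2' := integrable_finsetSum _ i2
  have i3 : Integrable (fun a => ‖f k a‖ ^ 2) μ := MemLp.integrable_sq (hr.memLp_opNoise hk)
  have i4 : ∀ t ∈ Finset.range (k + 1), Integrable (fun a => ‖δ t a‖ ^ 2) μ := fun t ht =>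
    MemLp.integrable_sq (hr.memLp_gradNoise (lt ht))
  have i4' := integrable_finsetSum _ i4
  have i5 : ∀ t ∈ Finset.range (k + 1), Integrable (fun a => ‖ζ t a‖ ^ 2) μ := fun t ht =>
    MemLp.integrable_sq (hr.memLp_dualNoise (lt ht))
  have i5' := integrable_finsetSum _ i5
  have i6 : ∀ t ∈ Finset.range (k + 1), Integrable (fun a => inner ℝ (lam t a) (ζ t a)) μ :=
    fun t ht => MemLp.integrable_inner_of_two (hr.memLp_lam (lt ht).le) (hr.memLp_dualNoise (lt ht))
  have i6' := integrable_finsetSum _ i6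
  have i7 : ∀ t ∈ Finset.range k, Integrable (fun a => inner ℝ (f (t + 1) a) (x (t + 1) a - x 0 a)) μ :=
    fun t ht => MemLp.integrable_inner_of_two (hr.memLp_opNoise (lt' ht))
      (hr.memLp_x_sub (lt' ht).le (by omega))
  have i7' := integrable_finsetSum _ i7
  have i8 : ∀ t ∈ Finset.range (k + 1), Integrable (fun a => inner ℝ (δ t a) (x t a - x 0 a)) μ :=
    fun t ht => MemLp.integrable_inner_of_two (hr.memLp_gradNoise (lt ht))
      (hr.memLp_x_sub (lt ht).le (by omega))
  have i8' := integrable_finsetSum _ i8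
  have hxs : ∀ t ≤ T, Measurable[pastDual T ξ ξb t] fun a => x t a - x 0 a := fun t ht =>
    ((hr.measurable_x_past le_rfl ht).sub (hr.measurable_x_past (Nat.zero_le t) ht)).mono
      (past_le_pastDual t) le_rfl
  have z6 : ∫ a, ∑ t ∈ Finset.range (k + 1), inner ℝ (lam t a) (ζ t a) ∂μ = 0 := by
    rw [integral_finsetSum _ i6]
    refine Finset.sum_eq_zero fun t ht => ?_
    rw [← hr.dualNoise_inner (lt ht) (hr.measurable_lam_past le_rfl (lt ht).le)
      (hr.memLp_lam (lt ht).le)]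
    exact integral_congr_ae (Filter.Eventually.of_forall fun a => real_inner_comm _ _)
  have z7 : ∫ a, ∑ t ∈ Finset.range k, inner ℝ (f (t + 1) a) (x (t + 1) a - x 0 a) ∂μ = 0 := by
    rw [integral_finsetSum _ i7]
    exact Finset.sum_eq_zero fun t ht => ((hr.opNoise_isNoise (lt' ht)).integral_inner _
      (hxs _ (lt' ht).le) ((hr.memLp_x_sub (lt' ht).le (by omega)).integrable one_le_two)).2
  have z8 : ∫ a, ∑ t ∈ Finset.range (k + 1), inner ℝ (δ t a) (x t a - x 0 a) ∂μ = 0 := by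
    rw [integral_finsetSum _ i8]
    exact Finset.sum_eq_zero fun t ht => hr.gradNoise_inner (lt ht) (hxs _ (lt ht).le)
      (hr.memLp_x_sub (lt ht).le (by omega))
  have b2 : ∫ a, ∑ t ∈ Finset.range k, ‖f (t + 1) a - f t a‖ ^ 2 ∂μ ≤ k * (2 * σ ^ 2) := by
    rw [integral_finsetSum _ i2]
    refine (Finset.sum_le_card_nsmul _ _ (2 * σ ^ 2) fun t ht => ?_).trans_eq (by simp)
    exact hr.integral_opNoise_sub_sq_le (lt' ht)
  have b3 : ∫ a, ‖f k a‖ ^ 2 ∂μ ≤ σ ^ 2 := (hr.opNoise_isNoise hk).integral_sq_le (hr.pastDual_le _)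
  have b5 := hr.sum_integral_dualNoise_sq_le hk
  rw [← hζ, ← integral_finsetSum _ i5] at b5
  -- Everything free of `y` and `l`. The inner products with noise have mean zero, because their
  -- other factor is fixed before the noise is drawn.
  set U : Ω → ℝ := fun a => - (κ * ∑ t ∈ Finset.range (k + 1), ‖x (t + 1) a - x t a‖ ^ 2)
    + (∑ t ∈ Finset.range k, ‖f (t + 1) a - f t a‖ ^ 2 + ‖f k a‖ ^ 2) / (2 * cf)
    + (∑ t ∈ Finset.range (k + 1), ‖δ t a‖ ^ 2) / (2 * cδ)
    + (∑ t ∈ Finset.range (k + 1), ‖ζ t a‖ ^ 2) / (2 * ((1 - β) * τ))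
    - ∑ t ∈ Finset.range k, inner ℝ (f (t + 1) a) (x (t + 1) a - x 0 a)
    - ∑ t ∈ Finset.range (k + 1), inner ℝ (δ t a) (x t a - x 0 a)
    + ∑ t ∈ Finset.range (k + 1), inner ℝ (lam t a) (ζ t a) with hU
  have j1 := (i1.const_mul κ).neg
  have j2 := j1.add ((i2'.add i3).div_const (2 * cf))
  have j3 := j2.add (i4'.div_const (2 * cδ))
  have j4 := j3.add (i5'.div_const (2 * ((1 - β) * τ)))
  have j5 := j4.sub i7'
  have j6 := j5.sub i8'
  have j7 := j6.add i6'
  refine ⟨U, j7, ?_, ?_⟩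
  · have e : ∫ a, U a ∂μ = - (κ * ∫ a, ∑ t ∈ Finset.range (k + 1), ‖x (t + 1) a - x t a‖ ^ 2 ∂μ)
      + (∫ a, ∑ t ∈ Finset.range k, ‖f (t + 1) a - f t a‖ ^ 2 ∂μ + ∫ a, ‖f k a‖ ^ 2 ∂μ) / (2 * cf)
      + (∑ t ∈ Finset.range (k + 1), ∫ a, ‖δ t a‖ ^ 2 ∂μ) / (2 * cδ)
      + (∫ a, ∑ t ∈ Finset.range (k + 1), ‖ζ t a‖ ^ 2 ∂μ) / (2 * ((1 - β) * τ)) := by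
      refine (integral_add' j6 i6').trans ?_
      rw [z6, integral_sub' j5 i8', z8, integral_sub' j4 i7', z7,
        integral_add' j3 (i5'.div_const _), integral_add' j2 (i4'.div_const _),
        integral_add' j1 ((i2'.add i3).div_const _), integral_neg', integral_const_mul,
        integral_div, integral_div, integral_div, integral_add' i2' i3, integral_finsetSum _ i4]
      ring
    rw [e]
    set D2 := ∫ a, ∑ t ∈ Finset.range (k + 1), ‖x (t + 1) a - x t a‖ ^ 2 ∂μ
    have c1 : (∫ a, ∑ t ∈ Finset.range k, ‖f (t + 1) a - f t a‖ ^ 2 ∂μ + ∫ a, ‖f k a‖ ^ 2 ∂μ)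
        / (2 * cf) ≤ (k + 1) * (2 * σ ^ 2 / (2 * cf)) := by
      rw [← mul_div_assoc]
      gcongr
      nlinarith [sq_nonneg σ]
    have c2 : (∫ a, ∑ t ∈ Finset.range (k + 1), ‖ζ t a‖ ^ 2 ∂μ) / (2 * ((1 - β) * τ))
        ≤ (k + 1) * (27 / 2 * σg ^ 2 / (2 * ((1 - β) * τ)))
          + 27 * (∑ j, σj j ^ 2) / (2 * ((1 - β) * τ)) * D2 := by
      refine (div_le_div_of_nonneg_right b5 (by positivity)).trans_eq ?_
      ring
    linarith
  · intro a y hy l hl hlin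
    have h := hr.problem.path_le (x := fun t => x t a) (lam := fun t => lam t a)
      (f := fun t => f t a) (δ := fun t => δ t a) (ζ := fun t => ζ t a) hcH hcf hcδ hc hb hρ
      hr.τ_pos hβ hβ' k (fun t ht => hr.x_mem (by omega) a) (fun t ht => hr.lam_mem (by omega) a)
      (hr.run.lam_zero a) (fun t ht y hy => hr.primal_step (by omega) a hy)
      (fun t ht l hl => hr.dual_step (by omega) a hl) hy hl hlin
    -- Recentering at the deterministic `x0` separates the comparison point from the iterates. Only
    -- the factor `y - x0` depends on `y`, so a supremum over `y` can be taken before integrating.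
    have e : ∀ (v u : Euc n), inner ℝ v (u - y) = inner ℝ v (u - x 0 a) - inner ℝ v (y - x0) :=
      fun v u => by rw [← inner_sub_right, hr.run.x_zero]; congr 1; abel
    simp only [e (f _ a), e (δ _ a), Finset.sum_sub_distrib, ← sum_inner] at h
    rw [hr.run.x_zero a, ← hκ] at h
    simp only [hU, hr.run.x_zero a]
    linarith

end IsStochasticRun

/-! ### From sums over iterates to the gap and infeasibility of their average. -/

lemma posPart_mem_orthant {k : ℕ} (v : Euc k) : posPart v ∈ orthant k := fun _ => le_max_right _ _

lemma le_posPart {k : ℕ} (v : Euc k) (j : Fin k) : v j ≤ posPart v j := le_max_left _ _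

lemma inner_posPart_self {k : ℕ} (v : Euc k) : inner ℝ (posPart v) v = ‖posPart v‖ ^ 2 := by
  rw [inner_euc, EuclideanSpace.norm_sq_eq]
  refine Finset.sum_congr rfl fun j _ => ?_
  simp only [posPart, Real.norm_eq_abs, sq_abs]
  rcases le_total (v j) 0 with h | h
  · simp [max_eq_right h]
  · rw [max_eq_left h, sq]

lemma norm_posPart_le {k : ℕ} (v : Euc k) : ‖posPart v‖ ≤ ‖v‖ := by
  have h := real_inner_le_norm (posPart v) v
  rw [inner_posPart_self, sq] at h
  rcases (norm_nonneg (posPart v)).eq_or_lt with h0 | h0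
  · rw [← h0]; exact norm_nonneg v
  · exact le_of_mul_le_mul_left h h0

lemma measurable_posPart {k : ℕ} : Measurable (posPart : Euc k → Euc k) :=
  (WithLp.measurable_toLp 2 _).comp (measurable_pi_lambda _ fun j =>
    ((measurable_pi_apply j).comp (WithLp.measurable_ofLp 2 _)).max measurable_const)

lemma output_one {Ω : Type*} (T : ℕ) (x : ℕ → Ω → Euc n) (a : Ω) :
    output (fun _ => 1) T x a = (T : ℝ)⁻¹ • ∑ t ∈ Finset.range T, x (t + 1) a := by
  simp [output]

section Problem

variable {X : Set (Euc n)} {F : Euc n → Euc n} {g : Euc n → Euc m} {gradg : Fin m → Euc n → Euc n}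
  {L H Mg : ℝ} {Lgj Hgj : Fin m → ℝ}

lemma IsProblem.average_mem (hp : IsProblem X F g gradg L H Lgj Hgj Mg) {T : ℕ} (hT : 0 < T)
    {x : ℕ → Euc n} (hx : ∀ t < T, x (t + 1) ∈ X) :
    (T : ℝ)⁻¹ • ∑ t ∈ Finset.range T, x (t + 1) ∈ X := by
  have hT' : (T : ℝ) ≠ 0 := by positivity
  rw [Finset.smul_sum]
  exact hp.convex.sum_mem (fun _ _ => by positivity) (by simp [hT'])
    fun t ht => hx t (Finset.mem_range.1 ht)

lemma IsProblem.g_average_le (hp : IsProblem X F g gradg L H Lgj Hgj Mg) {T : ℕ} (hT : 0 < T)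
    {x : ℕ → Euc n} (hx : ∀ t < T, x (t + 1) ∈ X) (j : Fin m) :
    T * g ((T : ℝ)⁻¹ • ∑ t ∈ Finset.range T, x (t + 1)) j
      ≤ ∑ t ∈ Finset.range T, g (x (t + 1)) j := by
  have hT' : (0 : ℝ) < T := by positivity
  have h := (hp.g_convex j).map_sum_le (t := Finset.range T) (w := fun _ => (T : ℝ)⁻¹)
    (p := fun t => x (t + 1)) (fun _ _ => by positivity) (by simp [hT'.ne'])
    fun t ht => hx t (Finset.mem_range.1 ht)
  simp only at h
  rw [← Finset.smul_sum, ← Finset.smul_sum, smul_eq_mul, ← div_eq_inv_mul, le_div_iff₀ hT'] at h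
  linarith

lemma mul_inner_average_sub {T : ℕ} (hT : 0 < T) (x : ℕ → Euc n) (v y : Euc n) :
    T * inner ℝ v ((T : ℝ)⁻¹ • ∑ t ∈ Finset.range T, x (t + 1) - y)
      = ∑ t ∈ Finset.range T, inner ℝ v (x (t + 1) - y) := by
  have hT' : (T : ℝ) ≠ 0 := by positivity
  simp only [inner_sub_right, inner_smul_right, inner_sum, Finset.sum_sub_distrib, Finset.sum_const,
    Finset.card_range, nsmul_eq_mul]
  field_simp

/-- Monotonicity replaces `F` at the iterates by `F y`, after which the expression is affine in the
iterate and averaging is exact. -/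
lemma IsProblem.sum_inner_le (hp : IsProblem X F g gradg L H Lgj Hgj Mg) {T : ℕ} (hT : 0 < T)
    {x : ℕ → Euc n} (hx : ∀ t < T, x (t + 1) ∈ X) {y : Euc n} (hy : y ∈ X) :
    T * inner ℝ (F y) ((T : ℝ)⁻¹ • ∑ t ∈ Finset.range T, x (t + 1) - y)
      ≤ ∑ t ∈ Finset.range T, inner ℝ (F (x (t + 1))) (x (t + 1) - y) := by
  rw [mul_inner_average_sub hT]
  refine Finset.sum_le_sum fun t ht => ?_
  have := hp.monotone _ (hx t (Finset.mem_range.1 ht)) y hy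
  rw [inner_sub_left] at this
  linarith

/-- The infeasibility of the average is the gap at a suitable multiplier. -/
lemma IsProblem.exists_multiplier (hp : IsProblem X F g gradg L H Lgj Hgj Mg) {xs : Euc n}
    {ls : Euc m} (hKKT : IsKKTPair X F g xs ls) {T : ℕ} (hT : 0 < T)
    {x : ℕ → Euc n} (hx : ∀ t < T, x (t + 1) ∈ X) :
    ∃ l ∈ orthant m, ‖l‖ ≤ ‖ls‖ + 1 ∧
      T * infeasibility g ((T : ℝ)⁻¹ • ∑ t ∈ Finset.range T, x (t + 1))
        ≤ ∑ t ∈ Finset.range T, (inner ℝ (F (x (t + 1))) (x (t + 1) - xs)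
          + inner ℝ l (g (x (t + 1)))) := by
  set z := (T : ℝ)⁻¹ • ∑ t ∈ Finset.range T, x (t + 1) with hz
  set p := posPart (g z) with hp'
  have hT' : (0 : ℝ) < T := by positivity
  have hzX : z ∈ X := hp.average_mem hT hx
  have h1 := hp.sum_inner_le hT hx hKKT.feasible.1
  have h2 := hKKT.inner_nonneg hzX
  have h3 : inner ℝ ls (g z) ≤ ‖ls‖ * ‖p‖ :=
    (inner_mono_orthant hKKT.nonneg (le_posPart (g z))).trans (real_inner_le_norm _ _)
  have h4 : -(T * (‖ls‖ * ‖p‖)) ≤ T * inner ℝ (F xs) (z - xs) := by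
    rw [← mul_neg]
    exact mul_le_mul_of_nonneg_left (by linarith) hT'.le
  -- The vector of length `‖ls‖ + 1` along `[g z]₊`. It gains `(‖ls‖ + 1)‖p‖` while the KKT
  -- inequality loses at most `‖ls‖‖p‖`, so `‖p‖` remains. If `p = 0`, then `l = 0` since `0⁻¹ = 0`.
  set l : Euc m := ((‖ls‖ + 1) * ‖p‖⁻¹) • p with hl
  have hlo : l ∈ orthant m := fun j => by
    have := posPart_mem_orthant (g z) j
    simp only [hl, PiLp.smul_apply, smul_eq_mul]
    positivity
  refine ⟨l, hlo, ?_, ?_⟩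
  · rw [hl, norm_smul, norm_mul, norm_inv, norm_norm, Real.norm_of_nonneg (by positivity), mul_assoc]
    exact mul_le_of_le_one_right (by positivity) inv_mul_le_one
  · have h5 : T * inner ℝ l (g z) ≤ ∑ t ∈ Finset.range T, inner ℝ l (g (x (t + 1))) := by
      rw [← inner_sum, ← real_inner_smul_right]
      refine inner_mono_orthant hlo fun j => ?_
      have := hp.g_average_le hT hx j
      simpa using this
    have h6 : inner ℝ l (g z) = (‖ls‖ + 1) * ‖p‖ := by
      rw [hl, inner_smul_left, inner_posPart_self, ← hp']
      simp only [conj_trivial]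
      rcases (norm_nonneg p).eq_or_lt with h0 | h0
      · rw [← h0]; simp
      · field_simp
    rw [h6] at h5
    rw [Finset.sum_add_distrib]
    have : infeasibility g z = ‖p‖ := rfl
    rw [this]
    linarith

lemma IsProblem.norm_F_le (hp : IsProblem X F g gradg L H Lgj Hgj Mg) {y z : Euc n} (hy : y ∈ X)
    (hz : z ∈ X) : ‖F y‖ ≤ ‖F z‖ + (L * Metric.diam X + H) := by
  have h1 := hp.F_lipschitz y hy z hz
  have h2 : ‖y - z‖ ≤ Metric.diam X := by
    rw [← dist_eq_norm]; exact Metric.dist_le_diam_of_mem hp.compact.isBounded hy hz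
  have h3 : ‖F y‖ ≤ ‖F z‖ + ‖F y - F z‖ := norm_le_norm_add_norm_sub' _ _
  have h4 := mul_le_mul_of_nonneg_left h2 hp.L_nonneg
  linarith

lemma IsProblem.norm_g_le (hp : IsProblem X F g gradg L H Lgj Hgj Mg) (hM : 0 ≤ Mg) {y z : Euc n}
    (hy : y ∈ X) (hz : z ∈ X) : ‖g y‖ ≤ ‖g z‖ + Mg * Metric.diam X := by
  have h1 := hp.g_lipschitz y hy z hz
  have h2 : ‖y - z‖ ≤ Metric.diam X := by
    rw [← dist_eq_norm]; exact Metric.dist_le_diam_of_mem hp.compact.isBounded hy hz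
  have h3 : ‖g y‖ ≤ ‖g z‖ + ‖g y - g z‖ := norm_le_norm_add_norm_sub' _ _
  have h4 := mul_le_mul_of_nonneg_left h2 hM
  linarith

lemma bddAbove_gapValues {C R : ℝ} (hF : ∀ y ∈ X, ‖F y‖ ≤ C) (hX : ∀ y ∈ X, ‖y‖ ≤ R) (z : Euc n) :
    BddAbove (gapValues X F g z) := by
  refine ⟨C * (‖z‖ + R), ?_⟩
  rintro _ ⟨y, hy, rfl⟩
  refine (real_inner_le_norm _ _).trans (mul_le_mul (hF y hy.1) ?_ (norm_nonneg _)
    ((norm_nonneg _).trans (hF y hy.1)))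
  exact (norm_sub_le _ _).trans (by linarith [hX y hy.1])

/-- A supremum of affine functions with slopes bounded by `C` is `C`-Lipschitz; continuity makes the
gap of the output measurable although the supremum is over an uncountable set. -/
lemma weakGap_sub_le {C R : ℝ} (hF : ∀ y ∈ X, ‖F y‖ ≤ C) (hX : ∀ y ∈ X, ‖y‖ ≤ R)
    (hne : (feasibleSet X g).Nonempty) (z z' : Euc n) :
    weakGap X F g z ≤ weakGap X F g z' + C * ‖z - z'‖ := by
  refine csSup_le (hne.image _) ?_
  rintro _ ⟨y, hy, rfl⟩
  have h1 := le_csSup (bddAbove_gapValues hF hX z') (Set.mem_image_of_mem _ hy)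
  have h2 : inner ℝ (F y) (z - y) = inner ℝ (F y) (z' - y) + inner ℝ (F y) (z - z') := by
    rw [← inner_add_right]; congr 1; abel
  have h3 := (real_inner_le_norm (F y) (z - z')).trans
    (mul_le_mul_of_nonneg_right (hF y hy.1) (norm_nonneg _))
  simp only [h2]
  exact add_le_add h1 h3

lemma continuous_weakGap {C R : ℝ} (hF : ∀ y ∈ X, ‖F y‖ ≤ C) (hX : ∀ y ∈ X, ‖y‖ ≤ R)
    (hne : (feasibleSet X g).Nonempty) : Continuous (weakGap X F g) := by
  have hC : 0 ≤ C := by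
    obtain ⟨y, hy⟩ := hne
    exact (norm_nonneg _).trans (hF y hy.1)
  refine (LipschitzWith.of_dist_le_mul (K := ⟨C, hC⟩) fun z z' => ?_).continuous
  rw [Real.dist_eq, dist_eq_norm, abs_sub_le_iff]
  have h1 := weakGap_sub_le (g := g) hF hX hne z z'
  have h2 := weakGap_sub_le (g := g) hF hX hne z' z
  rw [norm_sub_rev] at h2
  constructor <;> (change _ ≤ C * _; linarith)

end Problem

namespace IsStochasticRun

variable {Ω Ξ : Type*} {𝓑 : MeasurableSpace Ω} [mΩ : MeasurableSpace Ω] [MeasurableSpace Ξ]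
  {μ : Measure Ω} {P : Measure Ξ} {X : Set (Euc n)}
  {F : Euc n → Euc n} {g : Euc n → Euc m} {gradg : Fin m → Euc n → Euc n} {L H : ℝ}
  {Lgj Hgj : Fin m → ℝ} {Mg : ℝ} {Fs : Euc n → Ξ → Euc n} {gs : Euc n → Ξ → Euc m}
  {Gs : Fin m → Euc n → Ξ → Euc n} {σ σg : ℝ} {σj : Fin m → ℝ} {T : ℕ} {c τ : ℝ}
  {ξ ξb : ℕ → Ω → Ξ} {x0 : Euc n} {x : ℕ → Ω → Euc n} {lam : ℕ → Ω → Euc m}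

lemma output_mem
    (hr : IsStochasticRun μ P X F g gradg L H Lgj Hgj Mg Fs gs Gs σ σg σj T c τ ξ ξb x0 x lam)
    (hT : 0 < T) (a : Ω) : output (fun _ => 1) T x a ∈ X := by
  rw [output_one]
  exact hr.problem.average_mem hT (x := fun t => x t a) fun t ht => hr.x_mem ht a

lemma measurable_output
    (hr : IsStochasticRun μ P X F g gradg L H Lgj Hgj Mg Fs gs Gs σ σg σj T c τ ξ ξb x0 x lam) :
    Measurable (output (fun _ => 1) T x) := by
  have e : output (fun _ => 1) T x = fun a => (T : ℝ)⁻¹ • ∑ t ∈ Finset.range T, x (t + 1) a :=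
    funext fun a => output_one T x a
  rw [e]
  exact (Finset.measurable_fun_sum _ fun t ht =>
    hr.measurable_x (Finset.mem_range.1 ht)).const_smul (T : ℝ)⁻¹

lemma bddAbove_gap
    (hr : IsStochasticRun μ P X F g gradg L H Lgj Hgj Mg Fs gs Gs σ σg σj T c τ ξ ξb x0 x lam)
    (z : Euc n) : BddAbove (gapValues X F g z) := by
  obtain ⟨R, hR⟩ := hr.problem.compact.isBounded.exists_norm_le
  exact bddAbove_gapValues (fun y hy => hr.problem.norm_F_le hy hr.x0_mem) hR z

lemma integrable_weakGap [IsProbabilityMeasure μ]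
    (hr : IsStochasticRun μ P X F g gradg L H Lgj Hgj Mg Fs gs Gs σ σg σj T c τ ξ ξb x0 x lam)
    (hT : 0 < T) (hne : (feasibleSet X g).Nonempty) :
    Integrable (fun a => weakGap X F g (output (fun _ => 1) T x a)) μ := by
  obtain ⟨R, hR⟩ := hr.problem.compact.isBounded.exists_norm_le
  have hF := fun y (hy : y ∈ X) => hr.problem.norm_F_le hy hr.x0_mem
  have hc := continuous_weakGap (g := g) hF hR hne
  obtain ⟨C, hC⟩ := (hr.problem.compact.image hc).isBounded.exists_norm_le
  exact Integrable.of_bound (hc.measurable.comp hr.measurable_output).aestronglyMeasurable C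
    (Filter.Eventually.of_forall fun a => hC _ (Set.mem_image_of_mem _ (hr.output_mem hT a)))

lemma integrable_infeasibility [IsProbabilityMeasure μ] [IsProbabilityMeasure P]
    (hr : IsStochasticRun μ P X F g gradg L H Lgj Hgj Mg Fs gs Gs σ σg σj T c τ ξ ξb x0 x lam)
    (hT : 0 < T) :
    Integrable (fun a => infeasibility g (output (fun _ => 1) T x a)) μ := by
  have hm : Measurable fun a => g (output (fun _ => 1) T x a) :=
    hr.oracleg.measurable_mean.comp (hr.measurable_output.subtype_mk (h := hr.output_mem hT))
  refine Integrable.of_bound (measurable_posPart.comp hm).norm.aestronglyMeasurable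
    (‖g x0‖ + Mg * Metric.diam X) (Filter.Eventually.of_forall fun a => ?_)
  rw [infeasibility, norm_norm]
  exact (norm_posPart_le _).trans
    (hr.problem.norm_g_le hr.Mg_nonneg (hr.output_mem hT a) hr.x0_mem)

end IsStochasticRun

/-! ### Arithmetic of the step sizes. -/

/-- The constants of the step sizes, with `S = H + H_g B + √2 σ` and `q = √T`. -/
structure IsParams (L H Mg σ σg σG σXg B D Lg Hg S η τ q : ℝ) : Prop where
  L_nonneg : 0 ≤ L
  H_nonneg : 0 ≤ H
  Mg_pos : 0 < Mg
  σ_nonneg : 0 ≤ σ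
  σg_nonneg : 0 ≤ σg
  σG_nonneg : 0 ≤ σG
  σXg_nonneg : 0 ≤ σXg
  σXg_sq : σXg ^ 2 = σg ^ 2 + D ^ 2 * σG ^ 2
  one_le_B : 1 ≤ B
  D_pos : 0 < D
  Lg_nonneg : 0 ≤ Lg
  Hg_nonneg : 0 ≤ Hg
  one_le_q : 1 ≤ q
  S_eq : S = H + Hg * B + √2 * σ
  S_pos : 0 < S
  η_eq : η = 8 * L + 8 * Mg * B / D + 2 * (S + 4 * B * σG) / D * q
  τ_eq : τ = 9 * D / B * max Mg σG + 8 * σXg / B * q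

namespace IsParams

variable {L H Mg σ σg σG σXg B D Lg Hg S η τ q : ℝ}

lemma B_pos (h : IsParams L H Mg σ σg σG σXg B D Lg Hg S η τ q) : 0 < B := by
  linarith [h.one_le_B]

lemma q_pos (h : IsParams L H Mg σ σg σG σXg B D Lg Hg S η τ q) : 0 < q := by
  linarith [h.one_le_q]

lemma BσG_nonneg (h : IsParams L H Mg σ σg σG σXg B D Lg Hg S η τ q) : 0 ≤ B * σG :=
  mul_nonneg h.B_pos.le h.σG_nonneg

lemma mul_B (h : IsParams L H Mg σ σg σG σXg B D Lg Hg S η τ q) :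
    τ * B = 9 * D * max Mg σG + 8 * σXg * q := by
  have := h.B_pos
  rw [h.τ_eq]; field_simp

lemma σg_le (h : IsParams L H Mg σ σg σG σXg B D Lg Hg S η τ q) : σg ≤ σXg :=
  le_of_abs_le (abs_le_of_sq_le_sq (by rw [h.σXg_sq]; nlinarith [sq_nonneg (D * σG)]) h.σXg_nonneg)

lemma DσG_le (h : IsParams L H Mg σ σg σG σXg B D Lg Hg S η τ q) : D * σG ≤ σXg :=
  le_of_abs_le (abs_le_of_sq_le_sq (by rw [h.σXg_sq]; nlinarith [sq_nonneg σg]) h.σXg_nonneg)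

lemma Mg_le (h : IsParams L H Mg σ σg σG σXg B D Lg Hg S η τ q) : 9 * D * Mg ≤ τ * B := by
  have h1 := mul_le_mul_of_nonneg_left (le_max_left Mg σG) (by linarith [h.D_pos] : 0 ≤ 9 * D)
  have h2 := mul_nonneg h.σXg_nonneg h.q_pos.le
  rw [h.mul_B]; linarith

lemma σXg_q_le (h : IsParams L H Mg σ σg σG σXg B D Lg Hg S η τ q) : 8 * σXg * q ≤ τ * B := by
  have h1 := mul_le_mul_of_nonneg_left (le_max_left Mg σG) (by linarith [h.D_pos] : 0 ≤ 9 * D)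
  have h2 := mul_pos h.D_pos h.Mg_pos
  rw [h.mul_B]; linarith

lemma σG_q_le (h : IsParams L H Mg σ σg σG σXg B D Lg Hg S η τ q) : 8 * D * σG * q ≤ τ * B := by
  have := mul_le_mul_of_nonneg_right h.DσG_le h.q_pos.le
  linarith [h.σXg_q_le]

lemma σg_q_le (h : IsParams L H Mg σ σg σG σXg B D Lg Hg S η τ q) : 8 * σg * q ≤ τ * B := by
  have := mul_le_mul_of_nonneg_right h.σg_le h.q_pos.le
  linarith [h.σXg_q_le]

/-- `17 = 9 + 8`: the maximum gives nine, and `D σG ≤ σXg` with `q ≥ 1` gives eight. -/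
lemma σG_le (h : IsParams L H Mg σ σg σG σXg B D Lg Hg S η τ q) : 17 * D * σG ≤ τ * B := by
  have h1 := mul_le_mul_of_nonneg_left (le_max_right Mg σG) (by linarith [h.D_pos] : 0 ≤ 9 * D)
  have h2 := mul_le_mul h.DσG_le h.one_le_q zero_le_one h.σXg_nonneg
  rw [h.mul_B]; linarith

lemma τ_pos (h : IsParams L H Mg σ σg σG σXg B D Lg Hg S η τ q) : 0 < τ := by
  have h1 := h.Mg_le
  have h2 := mul_pos h.D_pos h.Mg_pos
  exact pos_of_mul_pos_left (by linarith : 0 < τ * B) h.B_pos.le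

lemma η_pos (h : IsParams L H Mg σ σg σG σXg B D Lg Hg S η τ q) : 0 < η := by
  have := h.L_nonneg; have := h.Mg_pos; have := h.B_pos; have := h.D_pos
  have := h.S_pos; have := h.BσG_nonneg; have := h.q_pos
  have h4 : 0 < S + 4 * B * σG := by linarith
  rw [h.η_eq]; positivity

lemma c_pos (h : IsParams L H Mg σ σg σG σXg B D Lg Hg S η τ q) : 0 < Lg * B + η := by
  have := h.η_pos; have := mul_nonneg h.Lg_nonneg h.B_pos.le; linarith

lemma Mg_sq_div_le (h : IsParams L H Mg σ σg σG σXg B D Lg Hg S η τ q) :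
    Mg ^ 2 / τ ≤ Mg * B / D / 9 := by
  have := h.D_pos; have := h.Mg_pos
  rw [div_div, div_le_div_iff₀ h.τ_pos (by positivity)]
  nlinarith [mul_le_mul_of_nonneg_left h.Mg_le h.Mg_pos.le]

lemma σG_sq_div_le (h : IsParams L H Mg σ σg σG σXg B D Lg Hg S η τ q) :
    σG ^ 2 / τ ≤ B * σG / D / 17 := by
  have := h.D_pos
  rw [div_div, div_le_div_iff₀ h.τ_pos (by positivity)]
  nlinarith [mul_le_mul_of_nonneg_left h.σG_le h.σG_nonneg]

lemma σg_sq_div_le (h : IsParams L H Mg σ σg σG σXg B D Lg Hg S η τ q) :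
    q ^ 2 * (σg ^ 2 / τ) ≤ σXg * q * B / 8 := by
  have hq := h.q_pos
  rw [← mul_div_assoc, div_le_div_iff₀ h.τ_pos (by norm_num)]
  have h1 := mul_le_mul_of_nonneg_left h.σg_q_le (mul_nonneg h.σg_nonneg hq.le)
  have h2 := mul_le_mul_of_nonneg_right (mul_le_mul_of_nonneg_right h.σg_le hq.le)
    (mul_nonneg h.τ_pos.le h.B_pos.le)
  nlinarith

lemma sq_add_le (h : IsParams L H Mg σ σg σG σXg B D Lg Hg S η τ q) :
    H ^ 2 + 2 * σ ^ 2 ≤ S ^ 2 := by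
  have h1 := h.H_nonneg
  have h2 := mul_nonneg h.Hg_nonneg h.B_pos.le
  have h3 : 0 ≤ √2 * σ := mul_nonneg (Real.sqrt_nonneg 2) h.σ_nonneg
  have h4 : (√2 * σ) ^ 2 = 2 * σ ^ 2 := by rw [mul_pow, Real.sq_sqrt (by norm_num)]
  rw [h.S_eq, ← h4]
  nlinarith [mul_nonneg h1 h2, mul_nonneg h1 h3, mul_nonneg h2 h3, sq_nonneg (Hg * B)]

/-- The weight left for the squared primal increments in the bounds for the multipliers and for
the infeasibility. -/
lemma weight_nonneg (h : IsParams L H Mg σ σg σG σXg B D Lg Hg S η τ q) :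
    27 * σG ^ 2 / (2 * τ) ≤ (6 * L + 8 * Mg * B / D + 19 / 20 * ((S + 4 * B * σG) * q / D)) / 2
      - 9 * Mg ^ 2 / (2 * (1 / 8 * τ)) - 27 * σG ^ 2 / (2 * ((1 - 1 / 8) * τ)) := by
  -- The `Mg` part `36 Mg²/τ ≤ 4 Mg B/D` uses up exactly half of `8 Mg B/D`. The `σG` parts total at
  -- most `(108/7 + 27/2)/17 < 1.9` times `BσG/D`. The left side of the claim is a reserve for `‖∑
  -- ζ‖²/(2τ)` in the infeasibility bound.
  have e1 : 9 * Mg ^ 2 / (2 * (1 / 8 * τ)) = 36 * (Mg ^ 2 / τ) := by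
    have := h.τ_pos; field_simp; ring
  have e2 : 27 * σG ^ 2 / (2 * ((1 - 1 / 8) * τ)) = 108 / 7 * (σG ^ 2 / τ) := by
    have := h.τ_pos; field_simp; ring
  have e3 : 27 * σG ^ 2 / (2 * τ) = 27 / 2 * (σG ^ 2 / τ) := by
    have := h.τ_pos; field_simp
  have e4 : 8 * Mg * B / D = 8 * (Mg * B / D) := by ring
  have e5 : (S + 4 * B * σG) * q / D = S * q / D + 4 * (B * σG / D) * q := by ring
  have hD := h.D_pos
  have hS : 0 ≤ S * q / D := by have := h.S_pos; have := h.q_pos; positivity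
  have hu : 0 ≤ B * σG / D := div_nonneg h.BσG_nonneg hD.le
  have hu' := mul_le_mul_of_nonneg_left h.one_le_q hu
  rw [e1, e2, e3, e4, e5]
  linarith [h.Mg_sq_div_le, h.σG_sq_div_le, h.L_nonneg]

/-- The weight left for the squared primal increments in the bound for the gap. -/
lemma gap_weight_nonneg (h : IsParams L H Mg σ σg σG σXg B D Lg Hg S η τ q) :
    0 ≤ (6 * L + 181 / 180 * (((S + 4 * B * σG) * q + 4 * Mg * B) / D)) / 2
      - 9 * Mg ^ 2 / (2 * (1 / 4 * τ)) - 27 * σG ^ 2 / (2 * ((1 - 1 / 4) * τ)) := by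
  have e1 : 9 * Mg ^ 2 / (2 * (1 / 4 * τ)) = 18 * (Mg ^ 2 / τ) := by
    have := h.τ_pos; field_simp; ring
  have e2 : 27 * σG ^ 2 / (2 * ((1 - 1 / 4) * τ)) = 18 * (σG ^ 2 / τ) := by
    have := h.τ_pos; field_simp; ring
  have e5 : ((S + 4 * B * σG) * q + 4 * Mg * B) / D
      = S * q / D + 4 * (B * σG / D) * q + 4 * (Mg * B / D) := by ring
  have hD := h.D_pos
  have hS : 0 ≤ S * q / D := by have := h.S_pos; have := h.q_pos; positivity
  have hu : 0 ≤ B * σG / D := div_nonneg h.BσG_nonneg hD.le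
  have hM : 0 ≤ Mg * B / D := by have := h.Mg_pos; have := h.B_pos; positivity
  have hu' := mul_le_mul_of_nonneg_left h.one_le_q hu
  rw [e1, e2, e5]
  linarith [h.Mg_sq_div_le, h.σG_sq_div_le, h.L_nonneg]

variable {R Hs w : ℝ}

/-- All that the final bounds need from `ω`: `4.84 · 18 ≥ 87`, and `4 · 4.84` times a bracket that
is at least `S/2`, its smallest coefficient being that of `H_g B`. -/
lemma w_sq_ge (h : IsParams L H Mg σ σg σG σXg B D Lg Hg S η τ q)
    (hw : w ^ 2 = 4.84 * ((6 * R ^ 2 + 18 * B ^ 2 + (8 * L + Lg * B) * B * D / Mg) * σG ^ 2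
      + 4 * (H + √2 * σ + Hs ^ 2 / (2 * S) + Hg * B / 2) * B * σG)) :
    87 * (B * σG) ^ 2 + 9.68 * (S * (B * σG)) ≤ w ^ 2 := by
  have hu := h.BσG_nonneg
  have := h.L_nonneg; have := h.Lg_nonneg; have := h.B_pos; have := h.D_pos; have := h.Mg_pos
  have := h.S_pos; have := h.H_nonneg; have := h.Hg_nonneg; have := h.σ_nonneg
  have h1 : 0 ≤ (8 * L + Lg * B) * B * D / Mg * σG ^ 2 := by positivity
  have h2 : 0 ≤ Hs ^ 2 / (2 * S) * (B * σG) := by positivity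
  have h3 : 0 ≤ H * (B * σG) := by positivity
  have h4 : 0 ≤ √2 * σ * (B * σG) := by positivity
  have h5 : 0 ≤ R ^ 2 * σG ^ 2 := by positivity
  have h6 : S * (B * σG) = H * (B * σG) + Hg * B * (B * σG) + √2 * σ * (B * σG) := by
    rw [h.S_eq]; ring
  rw [hw]
  nlinarith [sq_nonneg (B * σG)]

set_option maxHeartbeats 1600000 in
/-- The numerical part of the bound for the multipliers. -/
lemma σG_sq_mul_le (h : IsParams L H Mg σ σg σG σXg B D Lg Hg S η τ q)
    (hw : w ^ 2 = 4.84 * ((6 * R ^ 2 + 18 * B ^ 2 + (8 * L + Lg * B) * B * D / Mg) * σG ^ 2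
      + 4 * (H + √2 * σ + Hs ^ 2 / (2 * S) + Hg * B / 2) * B * σG))
    {A E K W : ℝ} (hA : 0 ≤ A) (hAE : A ≤ 2 * R ^ 2 + 2 * E) (hKq : K ≤ q ^ 2)
    (hW : W = (S + 4 * B * σG) * q / D)
    (hE : τ / 4 * E ≤ (Lg * B + η) / 2 * D ^ 2 + τ / 2 * R ^ 2
      + K * (H ^ 2 / (2 * (W / 4)) + Hs ^ 2 / (2 * (W / 4)))
      + (K * (2 * σ ^ 2 / (2 * (W / 4))) + K * (σG ^ 2 * A) / (2 * (3 / 10 * W))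
        + K * (27 / 2 * σg ^ 2 / (2 * ((1 - 1 / 8) * τ))))) :
    σG ^ 2 * A ≤ w ^ 2 := by
  have hu := h.BσG_nonneg
  have hτ := h.τ_pos
  have hD := h.D_pos
  have hB := h.B_pos
  have hS := h.S_pos
  have hq := h.q_pos
  have hM := h.Mg_pos
  have hL := h.L_nonneg
  have hLg := h.Lg_nonneg
  have hσG := h.σG_nonneg
  set u := B * σG with hu'
  set Pp := S + 4 * u with hPp
  have hP : 0 < Pp := by positivity
  have hW' : W = Pp * q / D := by rw [hW, hPp, hu']; ring
  have hWp : 0 < W := by rw [hW']; positivity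
  set X1 := D * q / Pp with hX1
  have hX1n : 0 ≤ X1 := by positivity
  have hKW : K / W ≤ X1 := by
    have : X1 = q ^ 2 / W := by rw [hW', hX1]; field_simp
    rw [this]; gcongr
  -- Multiplying the energy bound by this factor turns `τ/4 E` into `2σG² E`, the quantity that
  -- controls `σG² A`.
  set Z := 8 * σG ^ 2 / τ with hZ
  have hZn : 0 ≤ Z := by positivity
  have hZτ : Z * τ = 8 * σG ^ 2 := by rw [hZ]; field_simp
  have z1 : Z * D ^ 2 ≤ 8 / 9 * (B * D / Mg * σG ^ 2) := by
    have e : 8 / 9 * (B * D / Mg * σG ^ 2) = (8 * B * D * σG ^ 2) / (9 * Mg) := by field_simp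
    rw [hZ, e, div_mul_eq_mul_div, div_le_div_iff₀ hτ (by positivity)]
    nlinarith [mul_le_mul_of_nonneg_left h.Mg_le (by positivity : 0 ≤ 8 * D * σG ^ 2)]
  have z2 : Z * (D * q) ≤ u := by
    rw [hZ, div_mul_eq_mul_div, div_le_iff₀ hτ]
    nlinarith [mul_le_mul_of_nonneg_left h.σG_q_le hσG]
  have z3 : Z * (q ^ 2 * (σg ^ 2 / τ)) ≤ u ^ 2 / 8 := by
    have e1 : (8 * σg * q) ^ 2 ≤ (τ * B) ^ 2 :=
      pow_le_pow_left₀ (by have := h.σg_nonneg; positivity) h.σg_q_le 2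
    have e2 : q ^ 2 * (σg ^ 2 / τ) ≤ τ * B ^ 2 / 64 := by
      rw [← mul_div_assoc, div_le_div_iff₀ hτ (by norm_num)]; nlinarith
    calc Z * (q ^ 2 * (σg ^ 2 / τ)) ≤ Z * (τ * B ^ 2 / 64) := mul_le_mul_of_nonneg_left e2 hZn
      _ = (Z * τ) * B ^ 2 / 64 := by ring
      _ = u ^ 2 / 8 := by rw [hZτ, hu']; ring
  have z4 : Z * X1 ≤ u / Pp := by
    rw [hX1, ← mul_div_assoc]; gcongr
  -- This is what `4BσG` in `η` is for: the term with `A` on the right gets the coefficient `5/3 ·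
  -- 1/4 = 5/12 < 1` and moves to the left.
  have z4a : u / Pp ≤ 1 / 4 := by
    rw [div_le_div_iff₀ hP (by norm_num)]; linarith
  have z4b : u / Pp ≤ u / S := by gcongr; linarith
  have r1 : K * (H ^ 2 / (2 * (W / 4)) + Hs ^ 2 / (2 * (W / 4))) + K * (2 * σ ^ 2 / (2 * (W / 4)))
      = (2 * H ^ 2 + 2 * Hs ^ 2 + 4 * σ ^ 2) * (K / W) := by field_simp; ring
  have r2 : K * (σG ^ 2 * A) / (2 * (3 / 10 * W)) = 5 / 3 * (σG ^ 2 * A) * (K / W) := by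
    field_simp; ring
  have r3 : K * (27 / 2 * σg ^ 2 / (2 * ((1 - 1 / 8) * τ))) = 54 / 7 * (K * (σg ^ 2 / τ)) := by
    field_simp; ring
  have r4 : (Lg * B + η) / 2 * D ^ 2
      = 1 / 2 * (8 * L + Lg * B) * D ^ 2 + 4 * Mg * B / D * D ^ 2 + Pp * (D * q) := by
    rw [h.η_eq, hPp, hu']; field_simp; ring
  have s1 := mul_le_mul_of_nonneg_left hKW
    (by positivity : 0 ≤ 2 * H ^ 2 + 2 * Hs ^ 2 + 4 * σ ^ 2)
  have s2 := mul_le_mul_of_nonneg_left hKW (by positivity : 0 ≤ 5 / 3 * (σG ^ 2 * A))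
  have s3 := mul_le_mul_of_nonneg_right hKq (by positivity : 0 ≤ σg ^ 2 / τ)
  have hE' : τ / 4 * E ≤ 1 / 2 * (8 * L + Lg * B) * D ^ 2 + 4 * Mg * B / D * D ^ 2 + Pp * (D * q)
      + τ / 2 * R ^ 2 + (2 * H ^ 2 + 2 * Hs ^ 2 + 4 * σ ^ 2) * X1 + 5 / 3 * (σG ^ 2 * A) * X1
      + 54 / 7 * (q ^ 2 * (σg ^ 2 / τ)) := by
    rw [r4, r2, r3] at hE
    linarith
  have t1 := mul_le_mul_of_nonneg_left hE' hZn
  have t2 : Z * (τ / 4 * E) = 2 * σG ^ 2 * E := by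
    calc _ = (Z * τ) / 4 * E := by ring
      _ = _ := by rw [hZτ]; ring
  have t3 : Z * (τ / 2 * R ^ 2) = 4 * σG ^ 2 * R ^ 2 := by
    calc _ = (Z * τ) / 2 * R ^ 2 := by ring
      _ = _ := by rw [hZτ]; ring
  have t4 := mul_le_mul_of_nonneg_left hAE (sq_nonneg σG)
  have a1 := mul_le_mul_of_nonneg_left z1 (by positivity : 0 ≤ 1 / 2 * (8 * L + Lg * B))
  have a2 := mul_le_mul_of_nonneg_left z1 (by positivity : 0 ≤ 4 * Mg * B / D)
  have a2' : 4 * Mg * B / D * (8 / 9 * (B * D / Mg * σG ^ 2)) = 32 / 9 * u ^ 2 := by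
    rw [hu']; field_simp; ring
  have a3 := mul_le_mul_of_nonneg_left z2 hP.le
  have a4 := mul_le_mul_of_nonneg_left (z4.trans z4b)
    (by positivity : 0 ≤ 2 * H ^ 2 + 2 * Hs ^ 2 + 4 * σ ^ 2)
  have a5 := mul_le_mul_of_nonneg_left (z4.trans z4a) (by positivity : 0 ≤ 5 / 3 * (σG ^ 2 * A))
  have a6 : (2 * H ^ 2 + 2 * Hs ^ 2 + 4 * σ ^ 2) * (u / S) ≤ 2 * (S * u) + 2 * (Hs ^ 2 / S * u) := by
    have e : 2 * (S * u) + 2 * (Hs ^ 2 / S * u) = (2 * S ^ 2 + 2 * Hs ^ 2) * (u / S) := by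
      field_simp
    rw [e]
    exact mul_le_mul_of_nonneg_right (by linarith [h.sq_add_le]) (by positivity)
  have f1 : 0 ≤ (8 * L + Lg * B) * B * D / Mg * σG ^ 2 := by positivity
  have f2 : 0 ≤ Hs ^ 2 / S * u := by positivity
  have f3 : 0 ≤ R ^ 2 * σG ^ 2 := by positivity
  have f4 : 0 ≤ S * u := by positivity
  have f5 : 0 ≤ H * u := mul_nonneg h.H_nonneg hu
  have f6 : 0 ≤ √2 * σ * u := mul_nonneg (mul_nonneg (Real.sqrt_nonneg 2) h.σ_nonneg) hu
  have f7 : S * u = H * u + Hg * B * u + √2 * σ * u := by rw [h.S_eq]; ring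
  have f8 : Hs ^ 2 / (2 * S) * u = (Hs ^ 2 / S * u) / 2 := by field_simp
  have f9 : 1 / 2 * (8 * L + Lg * B) * (8 / 9 * (B * D / Mg * σG ^ 2))
      = 4 / 9 * ((8 * L + Lg * B) * B * D / Mg * σG ^ 2) := by ring
  have f10 : w ^ 2 = 4.84 * (6 * (R ^ 2 * σG ^ 2) + 18 * u ^ 2
      + (8 * L + Lg * B) * B * D / Mg * σG ^ 2
      + 4 * (H * u + √2 * σ * u + Hs ^ 2 / (2 * S) * u + Hg * B * u / 2)) := by
    rw [hw, hu']; ring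
  have f11 : Pp * u = S * u + 4 * u ^ 2 := by rw [hPp]; ring
  have f12 := sq_nonneg u
  rw [f10, f8]
  linarith

end IsParams

/-! ### Mean-square bound for the multipliers. -/

section Problem

variable {X : Set (Euc n)} {F : Euc n → Euc n} {g : Euc n → Euc m} {gradg : Fin m → Euc n → Euc n}
  {L H Mg : ℝ} {Lgj Hgj : Fin m → ℝ}

/-- The step size covers the curvature `Lg` only for multipliers of size `B`. For the excess `(R -
B)₊` one factor `‖y - z‖` is bounded by the diameter, so it joins the nonsmooth part in a linear
term, to which Young's inequality applies. -/
lemma IsProblem.inner_sub_lin_le_young (hp : IsProblem X F g gradg L H Lgj Hgj Mg) {y z : Euc n}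
    (hy : y ∈ X) (hz : z ∈ X) {l : Euc m} (hl : l ∈ orthant m) {R B c Lg Hg : ℝ}
    (hLg : Lg = √(∑ j, Lgj j ^ 2)) (hHg : Hg = √(∑ j, Hgj j ^ 2)) (hR : ‖l‖ ≤ R) (hc : 0 < c) :
    inner ℝ l (g y - lin g gradg z y)
      ≤ (Lg * B + c) / 2 * ‖y - z‖ ^ 2
        + (Hg * R + Lg * Metric.diam X * max (R - B) 0 / 2) ^ 2 / (2 * c) := by
  have h1 := hp.inner_sub_lin_le hy hz hl
  rw [← hLg, ← hHg] at h1
  have hL : 0 ≤ Lg := hLg ▸ Real.sqrt_nonneg _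
  have hH : 0 ≤ Hg := hHg ▸ Real.sqrt_nonneg _
  have hd : ‖y - z‖ ≤ Metric.diam X := by
    rw [← dist_eq_norm]; exact Metric.dist_le_diam_of_mem hp.compact.isBounded hy hz
  set d := ‖y - z‖ with hd'
  have hd0 : 0 ≤ d := norm_nonneg _
  have h2 := mul_le_mul_of_nonneg_right hR (by positivity : 0 ≤ Lg / 2 * d ^ 2 + Hg * d)
  have h3 : (R - B) * (Lg / 2 * d ^ 2)
      ≤ Lg * Metric.diam X * max (R - B) 0 / 2 * d := by
    calc (R - B) * (Lg / 2 * d ^ 2) ≤ max (R - B) 0 * (Lg / 2 * d ^ 2) :=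
          mul_le_mul_of_nonneg_right (le_max_left _ _) (by positivity)
      _ = max (R - B) 0 * (Lg / 2) * d * d := by ring
      _ ≤ max (R - B) 0 * (Lg / 2) * d * Metric.diam X :=
          mul_le_mul_of_nonneg_left hd (by have := le_max_right (R - B) 0; positivity)
      _ = _ := by ring
  set Hs := Hg * R + Lg * Metric.diam X * max (R - B) 0 / 2 with hHs
  have h4 : Hs * d ≤ c / 2 * d ^ 2 + Hs ^ 2 / (2 * c) := by
    have e : c / 2 * d ^ 2 + Hs ^ 2 / (2 * c) - Hs * d = (c * d - Hs) ^ 2 / (2 * c) := by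
      field_simp; ring
    have : 0 ≤ (c * d - Hs) ^ 2 / (2 * c) := by positivity
    linarith
  have h5 : Hs * d = Hg * R * d + Lg * Metric.diam X * max (R - B) 0 / 2 * d := by
    rw [hHs]; ring
  linarith

/-- Monotonicity carries the KKT inequality from `F xs` to `F z`, so the gap sum at `(xs, ls)` can
be dropped. -/
lemma IsProblem.lagrangian_nonneg (hp : IsProblem X F g gradg L H Lgj Hgj Mg) {xs : Euc n}
    {ls : Euc m} (hKKT : IsKKTPair X F g xs ls) {z : Euc n} (hz : z ∈ X) :
    0 ≤ inner ℝ (F z) (z - xs) + inner ℝ ls (g z) := by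
  have h1 := hp.monotone z hz xs hKKT.feasible.1
  have h2 := hKKT.inner_nonneg hz
  rw [inner_sub_left] at h1
  linarith

end Problem

lemma integral_inner_sum_eq_zero {Ω : Type*} [MeasurableSpace Ω] {μ : Measure Ω}
    [IsProbabilityMeasure μ] {k K : ℕ} {N : ℕ → Ω → Euc k} (hN : ∀ t < K, MemLp (N t) 2 μ)
    {v : Euc k} (h0 : ∀ t < K, ∫ a, inner ℝ (N t a) v ∂μ = 0) :
    Integrable (fun a => inner ℝ (∑ t ∈ Finset.range K, N t a) v) μ ∧
      ∫ a, inner ℝ (∑ t ∈ Finset.range K, N t a) v ∂μ = 0 := by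
  have hi : ∀ t ∈ Finset.range K, Integrable (fun a => inner ℝ (N t a) v) μ := fun t ht =>
    MemLp.integrable_inner_of_two (hN t (Finset.mem_range.1 ht)) (memLp_const v)
  simp_rw [sum_inner]
  refine ⟨integrable_finsetSum _ hi, ?_⟩
  rw [integral_finsetSum _ hi]
  exact Finset.sum_eq_zero fun t ht => h0 t (Finset.mem_range.1 ht)

namespace IsStochasticRun

variable {Ω Ξ : Type*} [mΩ : MeasurableSpace Ω] [MeasurableSpace Ξ]
  {μ : Measure Ω} {P : Measure Ξ} {X : Set (Euc n)}
  {F : Euc n → Euc n} {g : Euc n → Euc m} {gradg : Fin m → Euc n → Euc n} {L H : ℝ}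
  {Lgj Hgj : Fin m → ℝ} {Mg : ℝ} {Fs : Euc n → Ξ → Euc n} {gs : Euc n → Ξ → Euc m}
  {Gs : Fin m → Euc n → Ξ → Euc n} {σ σg : ℝ} {σj : Fin m → ℝ} {T : ℕ} {c τ : ℝ}
  {ξ ξb : ℕ → Ω → Ξ} {x0 : Euc n} {x : ℕ → Ω → Euc n} {lam : ℕ → Ω → Euc m}
  [IsProbabilityMeasure μ] [IsProbabilityMeasure P]

lemma integral_inner_sum_opNoise
    (hr : IsStochasticRun μ P X F g gradg L H Lgj Hgj Mg Fs gs Gs σ σg σj T c τ ξ ξb x0 x lam)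
    {k : ℕ} (hk : k + 1 ≤ T) (v : Euc n) :
    Integrable (fun a => inner ℝ (∑ t ∈ Finset.range k, opNoise Fs F ξ x (t + 1) a) v) μ ∧
      ∫ a, inner ℝ (∑ t ∈ Finset.range k, opNoise Fs F ξ x (t + 1) a) v ∂μ = 0 :=
  integral_inner_sum_eq_zero (N := fun t => opNoise Fs F ξ x (t + 1))
    (fun t _ => hr.memLp_opNoise (by omega))
    fun t _ => ((hr.opNoise_isNoise (by omega)).integral_inner (fun _ => v) measurable_const
      (integrable_const v)).2

lemma integral_inner_sum_gradNoise
    (hr : IsStochasticRun μ P X F g gradg L H Lgj Hgj Mg Fs gs Gs σ σg σj T c τ ξ ξb x0 x lam)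
    {K : ℕ} (hK : K ≤ T) (v : Euc n) :
    Integrable (fun a => inner ℝ (∑ t ∈ Finset.range K, gradNoise Gs gradg ξ x lam t a) v) μ ∧
      ∫ a, inner ℝ (∑ t ∈ Finset.range K, gradNoise Gs gradg ξ x lam t a) v ∂μ = 0 :=
  integral_inner_sum_eq_zero (fun t _ => hr.memLp_gradNoise (by omega))
    fun t _ => hr.gradNoise_inner (by omega) (u := fun _ => v) measurable_const (memLp_const v)

lemma integral_inner_sum_dualNoise
    (hr : IsStochasticRun μ P X F g gradg L H Lgj Hgj Mg Fs gs Gs σ σg σj T c τ ξ ξb x0 x lam)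
    {K : ℕ} (hK : K ≤ T) (l : Euc m) :
    Integrable (fun a => inner ℝ (∑ t ∈ Finset.range K, dualNoise gs Gs g gradg ξb x t a) l) μ ∧
      ∫ a, inner ℝ (∑ t ∈ Finset.range K, dualNoise gs Gs g gradg ξb x t a) l ∂μ = 0 :=
  integral_inner_sum_eq_zero (fun t _ => hr.memLp_dualNoise (by omega))
    fun t _ => hr.dualNoise_inner (by omega) (l := fun _ => l) measurable_const (memLp_const l)

variable {Lg Hg S η q B σG σXg R Hs w : ℝ} {xs : Euc n} {ls : Euc m}

lemma integral_norm_lam_sq_le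
    (hr : IsStochasticRun μ P X F g gradg L H Lgj Hgj Mg Fs gs Gs σ σg σj T c τ ξ ξb x0 x lam)
    {t : ℕ} (ht : t ≤ T) (l : Euc m) :
    ∫ a, ‖lam t a‖ ^ 2 ∂μ ≤ 2 * ‖l‖ ^ 2 + 2 * ∫ a, ‖l - lam t a‖ ^ 2 ∂μ := by
  have i1 := MemLp.integrable_sq (hr.memLp_lam ht)
  have i2 := MemLp.integrable_sq ((memLp_const l).sub (hr.memLp_lam ht))
  have h := integral_mono i1 ((integrable_const (2 * ‖l‖ ^ 2)).add (i2.const_mul 2)) fun a => by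
    have h1 : ‖lam t a‖ ≤ ‖l‖ + ‖l - lam t a‖ := norm_le_norm_add_norm_sub _ _
    have h2 := pow_le_pow_left₀ (norm_nonneg _) h1 2
    simp only [Pi.add_apply, Pi.sub_apply]
    nlinarith [sq_nonneg (‖l‖ - ‖l - lam t a‖)]
  rw [integral_add' (integrable_const _) (i2.const_mul 2), integral_const, probReal_univ, one_smul,
    integral_const_mul] at h
  exact h

/-- The bound for the expected distance of the multipliers to the KKT multiplier. -/
lemma integral_norm_sub_lam_sq_le
    (hr : IsStochasticRun μ P X F g gradg L H Lgj Hgj Mg Fs gs Gs σ σg σj T (Lg * B + η) τ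
      ξ ξb x0 x lam)
    (hP : IsParams L H Mg σ σg σG σXg B (Metric.diam X) Lg Hg S η τ q)
    (hσG : σG ^ 2 = ∑ j, σj j ^ 2) (hLg : Lg = √(∑ j, Lgj j ^ 2)) (hHg : Hg = √(∑ j, Hgj j ^ 2))
    (hKKT : IsKKTPair X F g xs ls)
    (hHs : Hs = Hg * (‖ls‖ + 1) + Lg * Metric.diam X * max (‖ls‖ + 1 - B) 0 / 2)
    {W : ℝ} (hW : W = (S + 4 * B * σG) * q / Metric.diam X) {A : ℝ}
    (hA : ∀ t ≤ T, ∫ a, ‖lam t a‖ ^ 2 ∂μ ≤ A) {k : ℕ} (hk : k + 1 ≤ T) :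
    τ / 4 * ∫ a, ‖ls - lam (k + 1) a‖ ^ 2 ∂μ
      ≤ (Lg * B + η) / 2 * Metric.diam X ^ 2 + τ / 2 * ‖ls‖ ^ 2
        + (k + 1) * (H ^ 2 / (2 * (W / 4)) + Hs ^ 2 / (2 * (W / 4)))
        + ((k + 1) * (2 * σ ^ 2 / (2 * (W / 4)))
          + (k + 1) * (σG ^ 2 * A) / (2 * (3 / 10 * W))
          + (k + 1) * (27 / 2 * σg ^ 2 / (2 * ((1 - 1 / 8) * τ)))) := by
  have hD := hP.D_pos
  have hWp : 0 < W := by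
    have := hP.S_pos; have := hP.q_pos; have := hP.BσG_nonneg
    have : 0 < S + 4 * B * σG := by linarith
    rw [hW]; positivity
  have hM := hP.Mg_pos
  have hB := hP.B_pos
  have hL := hP.L_nonneg
  have hLgn := hP.Lg_nonneg
  -- The part `2W` of `η` is spent as `1/4 + 1/4 + 1/4 + 3/10 + 19/20 = 2`.
  have hc : (Lg * B + W / 4) + 2 * L + W / 4 + W / 4 + 3 / 10 * W
      + (6 * L + 8 * Mg * B / Metric.diam X + 19 / 20 * W) ≤ Lg * B + η := by
    have e : η = 8 * L + 8 * Mg * B / Metric.diam X + 2 * W := by rw [hP.η_eq, hW]; ring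
    rw [e]; linarith
  obtain ⟨U, hU, hUle, hpath⟩ := hr.exists_fluctuation (cH := W / 4) (cf := W / 4)
    (cδ := 3 / 10 * W) (b := Lg * B + W / 4)
    (ρ := 6 * L + 8 * Mg * B / Metric.diam X + 19 / 20 * W)
    (C := Hs ^ 2 / (2 * (W / 4))) (β := 1 / 8) (by positivity) (by positivity) (by positivity) hc
    (by positivity) (by positivity) (by norm_num) (by norm_num) hk
  have hwt := hP.weight_nonneg
  rw [← hW, hσG] at hwt
  have hwt' : 0 ≤ 27 * (∑ j, σj j ^ 2) / (2 * τ) := by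
    have := hP.τ_pos
    rw [← hσG]; positivity
  have hx : ∀ t ≤ k, ∀ a, x (t + 1) a ∈ X := fun t ht a => hr.x_mem (by omega) a
  have hdiam : ‖xs - x0‖ ^ 2 ≤ Metric.diam X ^ 2 :=
    pow_le_pow_left₀ (norm_nonneg _) (hr.norm_sub_le hKKT.feasible.1 hr.x0_mem) 2
  have hlam := (memLp_const ls).sub (hr.memLp_lam hk)
  -- The comparison pair `(xs, ls)` is deterministic, so all three linear noise terms have mean
  -- zero.
  have hN1 := hr.integral_inner_sum_opNoise hk (xs - x0)
  have hN2 := hr.integral_inner_sum_gradNoise hk (xs - x0)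
  have hN3 := hr.integral_inner_sum_dualNoise hk ls
  set Kc := (Lg * B + η) / 2 * Metric.diam X ^ 2 + τ / 2 * ‖ls‖ ^ 2
        + (k + 1) * (H ^ 2 / (2 * (W / 4)) + Hs ^ 2 / (2 * (W / 4))) with hKc
  have hint := integral_mono ((MemLp.integrable_sq hlam).const_mul (τ / 4))
    (((((integrable_const Kc).add hU).add hN1.1).add hN2.1).sub hN3.1) fun a => by
      have h1 := hpath a xs hKKT.feasible ls hKKT.nonneg fun t ht => by
        have := hr.problem.inner_sub_lin_le_young (hx t ht a) (hr.x_mem (t := t) (by omega) a)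
          hKKT.nonneg (B := B) hLg hHg (R := ‖ls‖ + 1) (by linarith) (c := W / 4) (by positivity)
        rwa [← hHs] at this
      have h2 := Finset.sum_nonneg fun t (ht : t ∈ Finset.range (k + 1)) =>
        hr.problem.lagrangian_nonneg hKKT (hx t (by have := Finset.mem_range.1 ht; omega) a)
      have h3 := mul_le_mul_of_nonneg_left hdiam (half_pos hr.c_pos).le
      rw [real_inner_comm] at h1
      simp only [Pi.add_apply, Pi.sub_apply, hKc]
      rw [real_inner_comm] at h1
      rw [real_inner_comm ls]
      linarith
  rw [integral_const_mul, integral_sub' ((((integrable_const Kc).add hU).add hN1.1).add hN2.1) hN3.1,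
    integral_add' (((integrable_const Kc).add hU).add hN1.1) hN2.1,
    integral_add' ((integrable_const Kc).add hU) hN1.1,
    integral_add' (integrable_const Kc) hU, hN1.2, hN2.2, hN3.2] at hint
  simp only [integral_const, probReal_univ, one_smul, Pi.sub_apply] at hint
  have hδ : ∑ t ∈ Finset.range (k + 1), ∫ a, ‖gradNoise Gs gradg ξ x lam t a‖ ^ 2 ∂μ
      ≤ (k + 1) * (σG ^ 2 * A) := by
    refine (Finset.sum_le_card_nsmul _ _ (σG ^ 2 * A) fun t ht => ?_).trans_eq (by simp)
    have ht' := Finset.mem_range.1 ht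
    refine (hr.gradNoise_memLp_and_integral_le (by omega)).2.trans ?_
    rw [← hσG]
    exact mul_le_mul_of_nonneg_left (hA _ (by omega)) (sq_nonneg _)
  have hδ' := div_le_div_of_nonneg_right hδ (by positivity : 0 ≤ 2 * (3 / 10 * W))
  have hD2 : 0 ≤ ∫ a, ∑ t ∈ Finset.range (k + 1), ‖x (t + 1) a - x t a‖ ^ 2 ∂μ :=
    integral_nonneg fun a => Finset.sum_nonneg fun t _ => sq_nonneg _
  have := mul_nonneg (hwt'.trans hwt) hD2
  linarith

/-- The multipliers are bounded in mean square. -/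
lemma σG_sq_mul_integral_norm_lam_sq_le
    (hr : IsStochasticRun μ P X F g gradg L H Lgj Hgj Mg Fs gs Gs σ σg σj T (Lg * B + η) τ
      ξ ξb x0 x lam)
    (hP : IsParams L H Mg σ σg σG σXg B (Metric.diam X) Lg Hg S η τ (√T))
    (hσG : σG ^ 2 = ∑ j, σj j ^ 2) (hLg : Lg = √(∑ j, Lgj j ^ 2)) (hHg : Hg = √(∑ j, Hgj j ^ 2))
    (hKKT : IsKKTPair X F g xs ls)
    (hHs : Hs = Hg * (‖ls‖ + 1) + Lg * Metric.diam X * max (‖ls‖ + 1 - B) 0 / 2)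
    (hw : w ^ 2 = 4.84 * ((6 * ‖ls‖ ^ 2 + 18 * B ^ 2
      + (8 * L + Lg * B) * B * Metric.diam X / Mg) * σG ^ 2
      + 4 * (H + √2 * σ + Hs ^ 2 / (2 * S) + Hg * B / 2) * B * σG))
    {t : ℕ} (ht : t ≤ T) : σG ^ 2 * ∫ a, ‖lam t a‖ ^ 2 ∂μ ≤ w ^ 2 := by
  -- At the maximizing index the energy bound involves the maximum `A` on both sides, which closes
  -- without induction on `t`. The index `0` is trivial, as `λ⁰ = 0`.
  obtain ⟨s, hs, hmax⟩ := Finset.exists_max_image (Finset.range (T + 1))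
    (fun t => ∫ a, ‖lam t a‖ ^ 2 ∂μ) ⟨0, by simp⟩
  have hs' := Finset.mem_range.1 hs
  have hA : ∀ t ≤ T, ∫ a, ‖lam t a‖ ^ 2 ∂μ ≤ ∫ a, ‖lam s a‖ ^ 2 ∂μ := fun t ht =>
    hmax t (Finset.mem_range.2 (by omega))
  refine (mul_le_mul_of_nonneg_left (hA t ht) (sq_nonneg σG)).trans ?_
  cases s with
  | zero =>
    simp only [hr.run.lam_zero, norm_zero]
    simpa using sq_nonneg w
  | succ k =>
    refine hP.σG_sq_mul_le hw (integral_nonneg fun a => sq_nonneg _)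
      (hr.integral_norm_lam_sq_le (by omega) ls) (K := k + 1) ?_ rfl
      (hr.integral_norm_sub_lam_sq_le hP hσG hLg hHg hKKT hHs rfl hA (by omega))
    rw [Real.sq_sqrt (by positivity)]
    exact_mod_cast (by omega : k + 1 ≤ T)

lemma integral_norm_gradNoise_sq_le
    (hr : IsStochasticRun μ P X F g gradg L H Lgj Hgj Mg Fs gs Gs σ σg σj T (Lg * B + η) τ
      ξ ξb x0 x lam)
    (hP : IsParams L H Mg σ σg σG σXg B (Metric.diam X) Lg Hg S η τ (√T))
    (hσG : σG ^ 2 = ∑ j, σj j ^ 2) (hLg : Lg = √(∑ j, Lgj j ^ 2)) (hHg : Hg = √(∑ j, Hgj j ^ 2))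
    (hKKT : IsKKTPair X F g xs ls)
    (hHs : Hs = Hg * (‖ls‖ + 1) + Lg * Metric.diam X * max (‖ls‖ + 1 - B) 0 / 2)
    (hw : w ^ 2 = 4.84 * ((6 * ‖ls‖ ^ 2 + 18 * B ^ 2
      + (8 * L + Lg * B) * B * Metric.diam X / Mg) * σG ^ 2
      + 4 * (H + √2 * σ + Hs ^ 2 / (2 * S) + Hg * B / 2) * B * σG))
    {t : ℕ} (ht : t < T) : ∫ a, ‖gradNoise Gs gradg ξ x lam t a‖ ^ 2 ∂μ ≤ w ^ 2 := by
  refine (hr.gradNoise_memLp_and_integral_le ht).2.trans ?_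
  rw [← hσG]
  exact hr.σG_sq_mul_integral_norm_lam_sq_le hP hσG hLg hHg hKKT hHs hw ht

end IsStochasticRun

/-! ### Collecting the constants. -/

namespace IsParams

variable {L H Mg σ σg σG σXg B D Lg Hg S η τ q R Hs Rl w : ℝ}

/-- The numerical part of the bound for the infeasibility. -/
lemma infeasibility_le (h : IsParams L H Mg σ σg σG σXg B D Lg Hg S η τ q)
    (hw : 87 * (B * σG) ^ 2 + 9.68 * (S * (B * σG)) ≤ w ^ 2)
    {I W : ℝ} (hW : W = (S + 4 * B * σG) * q / D)
    (hI : q ^ 2 * I ≤ (Lg * B + η) / 2 * D ^ 2 + τ * R ^ 2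
      + q ^ 2 * (H ^ 2 / (2 * (W / 4)) + Hs ^ 2 / (2 * (W / 4)))
      + (q ^ 2 * (2 * σ ^ 2 / (2 * (W / 4))) + q ^ 2 * w ^ 2 / (2 * (3 / 10 * W))
        + q ^ 2 * (27 / 2 * σg ^ 2 / (2 * ((1 - 1 / 8) * τ))))
      + q ^ 2 * (27 / 2 * σg ^ 2) / (2 * τ)) :
    I ≤ ((8 * L + Lg * B) * D + 8 * Mg * B) * D / (2 * q ^ 2)
        + 9 * max Mg σG * D * R ^ 2 / (B * q ^ 2)
        + (S + B * σG) * D / q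
        + 2 * (H ^ 2 + Hs ^ 2 + 2 * σ ^ 2 + w ^ 2) * D / ((S + B * σG) * q)
        + 2 * σXg / q * (B + 4 * R ^ 2 / B) := by
  have hu := h.BσG_nonneg
  have hτ := h.τ_pos
  have hD := h.D_pos
  have hB := h.B_pos
  have hS := h.S_pos
  have hq := h.q_pos
  have hX := h.σXg_nonneg
  have hg := h.σg_sq_div_le
  set u := B * σG with hu'
  set Pp := S + 4 * u with hPp
  set Q := S + u with hQ
  have hP : 0 < Pp := by positivity
  have hQp : 0 < Q := by positivity
  have hW' : W = Pp * q / D := by rw [hW, hPp, hu']; ring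
  have hWp : 0 < W := by rw [hW']; positivity
  have e0 : q ^ 2 / W = D * q / Pp := by rw [hW']; field_simp
  have e1 : q ^ 2 * (H ^ 2 / (2 * (W / 4)) + Hs ^ 2 / (2 * (W / 4)))
      + q ^ 2 * (2 * σ ^ 2 / (2 * (W / 4))) = 2 * (H ^ 2 + Hs ^ 2 + 2 * σ ^ 2) * (D * q / Pp) := by
    rw [← e0]; field_simp; ring
  have e2 : q ^ 2 * w ^ 2 / (2 * (3 / 10 * W)) = 5 / 3 * w ^ 2 * (D * q / Pp) := by
    rw [← e0]; field_simp; ring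
  have e3 : q ^ 2 * (27 / 2 * σg ^ 2 / (2 * ((1 - 1 / 8) * τ))) = 54 / 7 * (q ^ 2 * (σg ^ 2 / τ)) := by
    field_simp; ring
  have e3' : q ^ 2 * (27 / 2 * σg ^ 2) / (2 * τ) = 27 / 4 * (q ^ 2 * (σg ^ 2 / τ)) := by
    field_simp; ring
  have e4 : (Lg * B + η) / 2 * D ^ 2
      = 1 / 2 * ((8 * L + Lg * B) * D + 8 * Mg * B) * D + Pp * (D * q) := by
    rw [h.η_eq, hPp, hu']; field_simp; ring
  have e5 : τ * R ^ 2 = 9 * max Mg σG * D * R ^ 2 / B + 8 * σXg * q * (R ^ 2 / B) := by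
    rw [h.τ_eq]; field_simp
  have hX1 : D * q / Pp ≤ D * q / Q := by
    refine div_le_div_of_nonneg_left (by positivity) hQp ?_
    linarith
  have f1 := mul_le_mul_of_nonneg_left hX1 (by positivity : 0 ≤ 2 * (H ^ 2 + Hs ^ 2 + 2 * σ ^ 2))
  have f2 := mul_le_mul_of_nonneg_left hX1 (by positivity : 0 ≤ 5 / 3 * w ^ 2)
  -- The surplus `3u` of `S + 4u` over `S + u` is paid by `w²`, since `9u(S + u) ≤ w²`; with `5/3`
  -- already spent on the gradient noise this makes the coefficient `2`.
  have f3 : 3 * u * (D * q) ≤ 1 / 3 * w ^ 2 * (D * q / Q) := by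
    have : 3 * u ≤ 1 / 3 * w ^ 2 / Q := by
      rw [le_div_iff₀ hQp, hQ]
      nlinarith [sq_nonneg u, mul_nonneg hS.le hu]
    calc 3 * u * (D * q) ≤ 1 / 3 * w ^ 2 / Q * (D * q) :=
          mul_le_mul_of_nonneg_right this (by positivity)
      _ = _ := by ring
  refine le_of_mul_le_mul_left ?_ (by positivity : 0 < q ^ 2)
  have goal : q ^ 2 * (((8 * L + Lg * B) * D + 8 * Mg * B) * D / (2 * q ^ 2)
        + 9 * max Mg σG * D * R ^ 2 / (B * q ^ 2) + Q * D / q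
        + 2 * (H ^ 2 + Hs ^ 2 + 2 * σ ^ 2 + w ^ 2) * D / (Q * q)
        + 2 * σXg / q * (B + 4 * R ^ 2 / B))
      = 1 / 2 * ((8 * L + Lg * B) * D + 8 * Mg * B) * D + 9 * max Mg σG * D * R ^ 2 / B
        + Q * (D * q) + 2 * (H ^ 2 + Hs ^ 2 + 2 * σ ^ 2 + w ^ 2) * (D * q / Q)
        + (2 * (σXg * q * B) + 8 * σXg * q * (R ^ 2 / B)) := by
    field_simp; ring
  rw [goal]
  have g1 : Pp * (D * q) = Q * (D * q) + 3 * u * (D * q) := by rw [hPp, hQ]; ring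
  have g2 : 0 ≤ σXg * q * B := by positivity
  rw [e4, e5, e3, e3', e2] at hI
  linarith

/-- The numerical part of the bound for the gap. -/
lemma gap_le (h : IsParams L H Mg σ σg σG σXg B D Lg Hg S η τ q)
    (hw : 87 * (B * σG) ^ 2 + 9.68 * (S * (B * σG)) ≤ w ^ 2) (hw0 : 0 ≤ w)
    {I W : ℝ} (hW : W = ((S + 4 * B * σG) * q + 4 * Mg * B) / D)
    (hI : q ^ 2 * I ≤ (Lg * B + η) / 2 * D ^ 2 + q ^ 2 * (H ^ 2 / (2 * (W / 4)))
      + (q ^ 2 * (2 * σ ^ 2 / (2 * (4 / 9 * W))) + q ^ 2 * w ^ 2 / (2 * (3 / 10 * W))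
        + q ^ 2 * (27 / 2 * σg ^ 2 / (2 * ((1 - 1 / 4) * τ))))
      + D * (q * σ) + D * (q * w)) :
    I ≤ 3 * ((8 * L + Lg * B) * D + 8 * Mg * B) * D / (2 * q ^ 2)
        + 3 * (S + B * σG) * D / q
        + (9 * w ^ 2 + 8 * H ^ 2 + 9 * σ ^ 2) * D / (4 * (S + B * σG + 4 * Mg * B / q) * q)
        + 9 * σXg * B / (8 * q) := by
  have hu := h.BσG_nonneg
  have hτ := h.τ_pos
  have hD := h.D_pos
  have hB := h.B_pos
  have hS := h.S_pos
  have hq := h.q_pos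
  have hM := h.Mg_pos
  have hX := h.σXg_nonneg
  have hg := h.σg_sq_div_le
  set u := B * σG with hu'
  set v := 4 * Mg * B / q with hv
  have hvp : 0 < v := by positivity
  have hvq : v * q = 4 * Mg * B := by rw [hv]; field_simp
  set Q := S + u + v with hQ
  have hQp : 0 < Q := by positivity
  set Pp := S + 4 * u + v with hPp
  have hP : 0 < Pp := by positivity
  have hW' : W = Pp * q / D := by
    rw [hW, hPp, hu', ← hvq]; ring
  have hWp : 0 < W := by rw [hW']; positivity
  have e0 : q ^ 2 / W = D * q / Pp := by rw [hW']; field_simp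
  have e1 : q ^ 2 * (H ^ 2 / (2 * (W / 4))) = 2 * H ^ 2 * (D * q / Pp) := by
    rw [← e0]; field_simp; ring
  have e1' : q ^ 2 * (2 * σ ^ 2 / (2 * (4 / 9 * W))) = 9 / 4 * σ ^ 2 * (D * q / Pp) := by
    rw [← e0]; field_simp
  have e2 : q ^ 2 * w ^ 2 / (2 * (3 / 10 * W)) = 5 / 3 * w ^ 2 * (D * q / Pp) := by
    rw [← e0]; field_simp; ring
  have e3 : q ^ 2 * (27 / 2 * σg ^ 2 / (2 * ((1 - 1 / 4) * τ))) = 9 * (q ^ 2 * (σg ^ 2 / τ)) := by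
    field_simp; ring
  have e4 : (Lg * B + η) / 2 * D ^ 2 = 1 / 2 * (8 * L + Lg * B) * D * D + Pp * (D * q) := by
    have : Pp * (D * q) = (S + 4 * u) * (D * q) + D * (v * q) := by rw [hPp]; ring
    rw [this, hvq, h.η_eq, hu']; field_simp; ring
  have hX1 : D * q / Pp ≤ D * q / Q := by
    refine div_le_div_of_nonneg_left (by positivity) hQp ?_
    linarith
  have f1 := mul_le_mul_of_nonneg_left hX1 (by positivity : 0 ≤ 2 * H ^ 2)
  have f1' := mul_le_mul_of_nonneg_left hX1 (by positivity : 0 ≤ 9 / 4 * σ ^ 2)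
  have f2 := mul_le_mul_of_nonneg_left hX1 (by positivity : 0 ≤ 5 / 3 * w ^ 2)
  have hwu : 9.3 * u ≤ w := by
    refine le_of_abs_le (abs_le_of_sq_le_sq ?_ hw0)
    nlinarith [sq_nonneg u, mul_nonneg hS.le hu]
  have hσS : σ ≤ 0.7072 * S := by
    have h1 : (1.4142 : ℝ) ≤ √2 := Real.le_sqrt_of_sq_le (by norm_num)
    have h2 := mul_le_mul_of_nonneg_right h1 h.σ_nonneg
    have h3 := mul_nonneg h.Hg_nonneg hB.le
    have h4 := h.S_eq
    have h5 := h.H_nonneg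
    linarith
  -- Of `9/4 w²/Q` in the claim, `5/3` is spent on the gradient noise and `7/12` remains. The square
  -- is completed at `w = 36/35 Q`; `0.6172` barely exceeds the required `108/175`.
  have hyoung : 1.2 * w ≤ 7 / 12 * (w ^ 2 / Q) + 0.6172 * Q := by
    have e : 7 / 12 * (w ^ 2 / Q) + 0.6172 * Q - 1.2 * w
        = (7 / 12 * (w - 36 / 35 * Q) ^ 2 + (0.6172 - 108 / 175) * Q ^ 2) / Q := by
      field_simp; ring
    have : 0 ≤ (7 / 12 * (w - 36 / 35 * Q) ^ 2 + (0.6172 - 108 / 175) * Q ^ 2) / Q := by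
      have : (0 : ℝ) ≤ 0.6172 - 108 / 175 := by norm_num
      positivity
    linarith
  -- The extra `0.2 w ≥ 1.86 u` pays for both `u` on the left and `0.6172 u` inside `0.6172 Q`.
  have key : u + σ + w ≤ 2 * S + 2 * v + 7 / 12 * (w ^ 2 / Q) := by linarith
  have key' := mul_le_mul_of_nonneg_right key (by positivity : 0 ≤ D * q)
  have g1 : 7 / 12 * (w ^ 2 / Q) * (D * q) = 7 / 12 * w ^ 2 * (D * q / Q) := by ring
  refine le_of_mul_le_mul_left ?_ (by positivity : 0 < q ^ 2)
  have goal : q ^ 2 * (3 * ((8 * L + Lg * B) * D + 8 * Mg * B) * D / (2 * q ^ 2)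
        + 3 * (S + u) * D / q
        + (9 * w ^ 2 + 8 * H ^ 2 + 9 * σ ^ 2) * D / (4 * Q * q)
        + 9 * σXg * B / (8 * q))
      = 3 / 2 * (8 * L + Lg * B) * D * D + 3 * v * (D * q) + 3 * (S + u) * (D * q)
        + (9 / 4 * w ^ 2 + 2 * H ^ 2 + 9 / 4 * σ ^ 2) * (D * q / Q) + 9 * (σXg * q * B / 8) := by
    have : 3 * v * (D * q) = 3 * D * (4 * Mg * B) := by rw [← hvq]; ring
    rw [this]
    field_simp; ring
  rw [goal]
  rw [e4, e3, e2, e1, e1'] at hI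
  have g3 : 0 ≤ (8 * L + Lg * B) * D * D := by
    have := h.L_nonneg; have := h.Lg_nonneg; positivity
  have g4 : Pp * (D * q) = S * (D * q) + 4 * (u * (D * q)) + v * (D * q) := by rw [hPp]; ring
  linarith

end IsParams

/-! ### Expected gap and infeasibility. -/

namespace IsStochasticRun

variable {Ω Ξ : Type*} [mΩ : MeasurableSpace Ω] [MeasurableSpace Ξ]
  {μ : Measure Ω} {P : Measure Ξ} {X : Set (Euc n)}
  {F : Euc n → Euc n} {g : Euc n → Euc m} {gradg : Fin m → Euc n → Euc n} {L H : ℝ}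
  {Lgj Hgj : Fin m → ℝ} {Mg : ℝ} {Fs : Euc n → Ξ → Euc n} {gs : Euc n → Ξ → Euc m}
  {Gs : Fin m → Euc n → Ξ → Euc n} {σ σg : ℝ} {σj : Fin m → ℝ} {T : ℕ} {c τ : ℝ}
  {ξ ξb : ℕ → Ω → Ξ} {x0 : Euc n} {x : ℕ → Ω → Euc n} {lam : ℕ → Ω → Euc m}
  [IsProbabilityMeasure μ] [IsProbabilityMeasure P]
  {Lg Hg S η q B σG σXg R Hs w : ℝ} {xs : Euc n} {ls : Euc m}

lemma integral_norm_sum_opNoise_le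
    (hr : IsStochasticRun μ P X F g gradg L H Lgj Hgj Mg Fs gs Gs σ σg σj T c τ ξ ξb x0 x lam)
    (hσ : 0 ≤ σ) {k : ℕ} (hk : k + 1 ≤ T) :
    Integrable (fun a => ‖∑ t ∈ Finset.range k, opNoise Fs F ξ x (t + 1) a‖) μ ∧
      ∫ a, ‖∑ t ∈ Finset.range k, opNoise Fs F ξ x (t + 1) a‖ ∂μ ≤ √T * σ := by
  have hm : MemLp (fun a => ∑ t ∈ Finset.range k, opNoise Fs F ξ x (t + 1) a) 2 μ :=
    memLp_finsetSum _ fun t ht => hr.memLp_opNoise (by have := Finset.mem_range.1 ht; omega)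
  refine ⟨(hm.integrable one_le_two).norm, le_of_abs_le (abs_le_of_sq_le_sq ?_ (by positivity))⟩
  refine (sq_integral_norm_le hm).trans ((hr.integral_sum_opNoise_sq_le hk).trans ?_)
  rw [mul_pow, Real.sq_sqrt (by positivity)]
  gcongr
  omega

lemma integral_norm_sum_gradNoise_le
    (hr : IsStochasticRun μ P X F g gradg L H Lgj Hgj Mg Fs gs Gs σ σg σj T c τ ξ ξb x0 x lam)
    (hw0 : 0 ≤ w) (hδ : ∀ t < T, ∫ a, ‖gradNoise Gs gradg ξ x lam t a‖ ^ 2 ∂μ ≤ w ^ 2) :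
    Integrable (fun a => ‖∑ t ∈ Finset.range T, gradNoise Gs gradg ξ x lam t a‖) μ ∧
      ∫ a, ‖∑ t ∈ Finset.range T, gradNoise Gs gradg ξ x lam t a‖ ∂μ ≤ √T * w := by
  have hm : MemLp (fun a => ∑ t ∈ Finset.range T, gradNoise Gs gradg ξ x lam t a) 2 μ :=
    memLp_finsetSum _ fun t ht => hr.memLp_gradNoise (Finset.mem_range.1 ht)
  refine ⟨(hm.integrable one_le_two).norm, le_of_abs_le (abs_le_of_sq_le_sq ?_ (by positivity))⟩
  refine (sq_integral_norm_le hm).trans ?_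
  rw [hr.integral_sum_gradNoise_sq le_rfl, mul_pow, Real.sq_sqrt (by positivity)]
  refine (Finset.sum_le_card_nsmul _ _ (w ^ 2) fun t ht => hδ t (Finset.mem_range.1 ht)).trans_eq ?_
  simp

/-- The expected weak gap before the constants are collected. -/
lemma mul_integral_weakGap_le
    (hr : IsStochasticRun μ P X F g gradg L H Lgj Hgj Mg Fs gs Gs σ σg σj T (Lg * B + η) τ
      ξ ξb x0 x lam) (hT : 0 < T) (hne : (feasibleSet X g).Nonempty)
    (hP : IsParams L H Mg σ σg σG σXg B (Metric.diam X) Lg Hg S η τ (√T))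
    (hσG : σG ^ 2 = ∑ j, σj j ^ 2) (hw0 : 0 ≤ w)
    (hδ : ∀ t < T, ∫ a, ‖gradNoise Gs gradg ξ x lam t a‖ ^ 2 ∂μ ≤ w ^ 2)
    {W : ℝ} (hW : W = ((S + 4 * B * σG) * √T + 4 * Mg * B) / Metric.diam X) :
    √T ^ 2 * ∫ a, weakGap X F g (output (fun _ => 1) T x a) ∂μ
      ≤ (Lg * B + η) / 2 * Metric.diam X ^ 2 + √T ^ 2 * (H ^ 2 / (2 * (W / 4)))
      + (√T ^ 2 * (2 * σ ^ 2 / (2 * (4 / 9 * W))) + √T ^ 2 * w ^ 2 / (2 * (3 / 10 * W))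
        + √T ^ 2 * (27 / 2 * σg ^ 2 / (2 * ((1 - 1 / 4) * τ))))
      + Metric.diam X * (√T * σ) + Metric.diam X * (√T * w) := by
  obtain ⟨k, rfl⟩ : ∃ k, T = k + 1 := ⟨T - 1, by omega⟩
  have hq : √((k + 1 : ℕ) : ℝ) ^ 2 = k + 1 := by
    rw [Real.sq_sqrt (by positivity)]; push_cast; ring
  have hD := hP.D_pos
  have hM := hP.Mg_pos
  have hB := hP.B_pos
  have hL := hP.L_nonneg
  have hLgn := hP.Lg_nonneg
  have hWp : 0 < W := by
    have := hP.S_pos; have := hP.q_pos; have := hP.BσG_nonneg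
    have : 0 < S + 4 * B * σG := by linarith
    rw [hW]; positivity
  -- Here `W` also contains `4 Mg B/D`, so that `η = 8L + 2W`, spent as `1/4 + 4/9 + 3/10 + 181/180
  -- = 2`.
  have hc : Lg * B + 2 * L + W / 4 + 4 / 9 * W + 3 / 10 * W
      + (6 * L + 181 / 180 * W) ≤ Lg * B + η := by
    have e : η = 8 * L + 2 * W := by rw [hP.η_eq, hW]; ring
    rw [e]; linarith
  obtain ⟨U, hU, hUle, hpath⟩ := hr.exists_fluctuation (cH := W / 4) (cf := 4 / 9 * W)
    (cδ := 3 / 10 * W) (b := Lg * B) (ρ := 6 * L + 181 / 180 * W)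
    (C := 0) (β := 1 / 4) (by positivity) (by positivity) (by positivity) hc
    (by positivity) (by positivity) (by norm_num) (by norm_num) (k := k) le_rfl
  have hwt := hP.gap_weight_nonneg
  rw [← hW, hσG] at hwt
  have hN1 := hr.integral_norm_sum_opNoise_le hP.σ_nonneg (k := k) le_rfl
  have hN2 := hr.integral_norm_sum_gradNoise_le hw0 hδ
  set Kc := (Lg * B + η) / 2 * Metric.diam X ^ 2 + (k + 1) * (H ^ 2 / (2 * (W / 4))) with hKc
  have hint := integral_mono ((hr.integrable_weakGap hT hne).const_mul ((k + 1 : ℝ)))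
    ((((integrable_const Kc).add hU).add (hN1.1.const_mul (Metric.diam X))).add
      (hN2.1.const_mul (Metric.diam X))) fun a => by
      have hx : ∀ t < k + 1, x (t + 1) a ∈ X := fun t ht => hr.x_mem (by omega) a
      simp only [Pi.add_apply, weakGap]
      rw [← le_div_iff₀' (by positivity)]
      refine csSup_le (hne.image _) ?_
      rintro _ ⟨y, hy, rfl⟩
      rw [le_div_iff₀' (by positivity), output_one]
      -- With `l = 0` there is no linearization error and no linear dual noise. As `y` may depend on
      -- the path, the remaining linear sums are bounded by their norms times the diameter.
      have h1 := hpath a y hy 0 (zero_mem_orthant m) fun t ht => by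
        rw [inner_zero_left]; positivity
      have h2 := hr.problem.sum_inner_le hT (x := fun t => x t a) hx hy.1
      have hdy := hr.norm_sub_le hy.1 hr.x0_mem
      have h3 := mul_le_mul_of_nonneg_left (pow_le_pow_left₀ (norm_nonneg _) hdy 2)
        (half_pos hr.c_pos).le
      have h4 := (real_inner_le_norm (∑ t ∈ Finset.range k, opNoise Fs F ξ x (t + 1) a)
        (y - x0)).trans (mul_le_mul_of_nonneg_left hdy (norm_nonneg _))
      have h5 := (real_inner_le_norm (∑ t ∈ Finset.range (k + 1), gradNoise Gs gradg ξ x lam t a)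
        (y - x0)).trans (mul_le_mul_of_nonneg_left hdy (norm_nonneg _))
      have h6 := mul_nonneg (by linarith [hr.τ_pos] : 0 ≤ τ / 4) (sq_nonneg ‖0 - lam (k + 1) a‖)
      simp only [inner_zero_left, add_zero, sub_zero, norm_zero] at h1
      rw [zero_sub, norm_neg] at h1 h6
      push_cast at h2 ⊢
      simp only [hKc]
      linarith
  rw [integral_const_mul,
    integral_add' (((integrable_const Kc).add hU).add (hN1.1.const_mul _)) (hN2.1.const_mul _),
    integral_add' ((integrable_const Kc).add hU) (hN1.1.const_mul _),
    integral_add' (integrable_const Kc) hU, integral_const_mul, integral_const_mul,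
    integral_const, probReal_univ, one_smul] at hint
  have hδ' : (∑ t ∈ Finset.range (k + 1), ∫ a, ‖gradNoise Gs gradg ξ x lam t a‖ ^ 2 ∂μ)
      / (2 * (3 / 10 * W)) ≤ (k + 1) * w ^ 2 / (2 * (3 / 10 * W)) := by
    refine div_le_div_of_nonneg_right ?_ (by positivity)
    exact (Finset.sum_le_card_nsmul _ _ (w ^ 2) fun t ht => hδ t (Finset.mem_range.1 ht)).trans_eq
      (by simp)
  have hD2 : 0 ≤ ∫ a, ∑ t ∈ Finset.range (k + 1), ‖x (t + 1) a - x t a‖ ^ 2 ∂μ :=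
    integral_nonneg fun a => Finset.sum_nonneg fun t _ => sq_nonneg _
  have h7 := mul_nonneg hwt hD2
  have h8 := mul_le_mul_of_nonneg_left hN1.2 hD.le
  have h9 := mul_le_mul_of_nonneg_left hN2.2 hD.le
  rw [hq]
  linarith

/-- The expected infeasibility before the constants are collected. -/
lemma mul_integral_infeasibility_le
    (hr : IsStochasticRun μ P X F g gradg L H Lgj Hgj Mg Fs gs Gs σ σg σj T (Lg * B + η) τ
      ξ ξb x0 x lam) (hT : 0 < T)
    (hP : IsParams L H Mg σ σg σG σXg B (Metric.diam X) Lg Hg S η τ (√T))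
    (hσG : σG ^ 2 = ∑ j, σj j ^ 2) (hLg : Lg = √(∑ j, Lgj j ^ 2)) (hHg : Hg = √(∑ j, Hgj j ^ 2))
    (hKKT : IsKKTPair X F g xs ls)
    (hHs : Hs = Hg * (‖ls‖ + 1) + Lg * Metric.diam X * max (‖ls‖ + 1 - B) 0 / 2)
    (hδ : ∀ t < T, ∫ a, ‖gradNoise Gs gradg ξ x lam t a‖ ^ 2 ∂μ ≤ w ^ 2)
    {W : ℝ} (hW : W = (S + 4 * B * σG) * √T / Metric.diam X) :
    √T ^ 2 * ∫ a, infeasibility g (output (fun _ => 1) T x a) ∂μ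
      ≤ (Lg * B + η) / 2 * Metric.diam X ^ 2 + τ * (‖ls‖ + 1) ^ 2
      + √T ^ 2 * (H ^ 2 / (2 * (W / 4)) + Hs ^ 2 / (2 * (W / 4)))
      + (√T ^ 2 * (2 * σ ^ 2 / (2 * (W / 4))) + √T ^ 2 * w ^ 2 / (2 * (3 / 10 * W))
        + √T ^ 2 * (27 / 2 * σg ^ 2 / (2 * ((1 - 1 / 8) * τ))))
      + √T ^ 2 * (27 / 2 * σg ^ 2) / (2 * τ) := by
  obtain ⟨k, rfl⟩ : ∃ k, T = k + 1 := ⟨T - 1, by omega⟩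
  have hq : √((k + 1 : ℕ) : ℝ) ^ 2 = k + 1 := by
    rw [Real.sq_sqrt (by positivity)]; push_cast; ring
  have hD := hP.D_pos
  have hM := hP.Mg_pos
  have hB := hP.B_pos
  have hL := hP.L_nonneg
  have hLgn := hP.Lg_nonneg
  have hτ := hP.τ_pos
  have hWp : 0 < W := by
    have := hP.S_pos; have := hP.q_pos; have := hP.BσG_nonneg
    have : 0 < S + 4 * B * σG := by linarith
    rw [hW]; positivity
  have hc : (Lg * B + W / 4) + 2 * L + W / 4 + W / 4 + 3 / 10 * W
      + (6 * L + 8 * Mg * B / Metric.diam X + 19 / 20 * W) ≤ Lg * B + η := by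
    have e : η = 8 * L + 8 * Mg * B / Metric.diam X + 2 * W := by rw [hP.η_eq, hW]; ring
    rw [e]; linarith
  obtain ⟨U, hU, hUle, hpath⟩ := hr.exists_fluctuation (cH := W / 4) (cf := W / 4)
    (cδ := 3 / 10 * W) (b := Lg * B + W / 4)
    (ρ := 6 * L + 8 * Mg * B / Metric.diam X + 19 / 20 * W)
    (C := Hs ^ 2 / (2 * (W / 4))) (β := 1 / 8) (by positivity) (by positivity) (by positivity) hc
    (by positivity) (by positivity) (by norm_num) (by norm_num) (k := k) le_rfl
  have hwt := hP.weight_nonneg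
  rw [← hW, hσG] at hwt
  have hN1 := hr.integral_inner_sum_opNoise (k := k) le_rfl (xs - x0)
  have hN2 := hr.integral_inner_sum_gradNoise le_rfl (xs - x0)
  have hZ : MemLp (fun a => ∑ t ∈ Finset.range (k + 1), dualNoise gs Gs g gradg ξb x t a) 2 μ :=
    memLp_finsetSum _ fun t ht => hr.memLp_dualNoise (Finset.mem_range.1 ht)
  have hZi := MemLp.integrable_sq hZ
  have hZle := hr.sum_integral_dualNoise_sq_le (k := k) le_rfl
  rw [← hr.integral_sum_dualNoise_sq le_rfl] at hZle
  set Kc := (Lg * B + η) / 2 * Metric.diam X ^ 2 + τ * (‖ls‖ + 1) ^ 2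
        + (k + 1) * (H ^ 2 / (2 * (W / 4)) + Hs ^ 2 / (2 * (W / 4))) with hKc
  have hint := integral_mono ((hr.integrable_infeasibility hT).const_mul ((k + 1 : ℝ)))
    (((((integrable_const Kc).add hU).add hN1.1).add hN2.1).add (hZi.div_const (2 * τ)))
    fun a => by
      have hx : ∀ t < k + 1, x (t + 1) a ∈ X := fun t ht => hr.x_mem (by omega) a
      obtain ⟨l, hl, hlR, hI⟩ := hr.problem.exists_multiplier hKKT hT (x := fun t => x t a) hx
      have h1 := hpath a xs hKKT.feasible l hl fun t ht => by
        have := hr.problem.inner_sub_lin_le_young (hx t (by omega)) (hr.x_mem (t := t) (by omega) a)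
          hl (B := B) hLg hHg hlR (c := W / 4) (by positivity)
        rwa [← hHs] at this
      have h3 := mul_le_mul_of_nonneg_left (pow_le_pow_left₀ (norm_nonneg _)
        (hr.norm_sub_le hKKT.feasible.1 hr.x0_mem) 2) (half_pos hr.c_pos).le
      set Z := ∑ t ∈ Finset.range (k + 1), dualNoise gs Gs g gradg ξb x t a with hZdef
      -- The multiplier depends on the whole path, so `⟨l, Z⟩` need not have mean zero. Young's
      -- inequality costs a second `τ/2 ‖l‖²`, and orthogonality of the increments keeps `E‖Z‖²` of
      -- order `T`.
      have h4 : -inner ℝ l Z ≤ τ / 2 * ‖l‖ ^ 2 + ‖Z‖ ^ 2 / (2 * τ) := by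
        have i1 : -inner ℝ l Z ≤ ‖l‖ * ‖Z‖ :=
          (neg_le_abs _).trans (abs_real_inner_le_norm l Z)
        have e : τ / 2 * ‖l‖ ^ 2 + ‖Z‖ ^ 2 / (2 * τ) - ‖l‖ * ‖Z‖
            = (τ * ‖l‖ - ‖Z‖) ^ 2 / (2 * τ) := by field_simp; ring
        have : 0 ≤ (τ * ‖l‖ - ‖Z‖) ^ 2 / (2 * τ) := by positivity
        linarith
      have h5 := mul_le_mul_of_nonneg_left (pow_le_pow_left₀ (norm_nonneg _) hlR 2) hτ.le
      have h6 := mul_nonneg (by linarith : 0 ≤ τ / 4) (sq_nonneg ‖l - lam (k + 1) a‖)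
      simp only [Pi.add_apply, hKc]
      rw [output_one]
      push_cast at hI ⊢
      linarith
  rw [integral_const_mul, integral_add' ((((integrable_const Kc).add hU).add hN1.1).add hN2.1)
      (hZi.div_const _),
    integral_add' (((integrable_const Kc).add hU).add hN1.1) hN2.1,
    integral_add' ((integrable_const Kc).add hU) hN1.1,
    integral_add' (integrable_const Kc) hU, hN1.2, hN2.2, integral_div,
    integral_const, probReal_univ, one_smul] at hint
  have hδ' : (∑ t ∈ Finset.range (k + 1), ∫ a, ‖gradNoise Gs gradg ξ x lam t a‖ ^ 2 ∂μ)
      / (2 * (3 / 10 * W)) ≤ (k + 1) * w ^ 2 / (2 * (3 / 10 * W)) := by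
    refine div_le_div_of_nonneg_right ?_ (by positivity)
    exact (Finset.sum_le_card_nsmul _ _ (w ^ 2) fun t ht => hδ t (Finset.mem_range.1 ht)).trans_eq
      (by simp)
  have hD2 : 0 ≤ ∫ a, ∑ t ∈ Finset.range (k + 1), ‖x (t + 1) a - x t a‖ ^ 2 ∂μ :=
    integral_nonneg fun a => Finset.sum_nonneg fun t _ => sq_nonneg _
  have h7 := mul_le_mul_of_nonneg_right hwt hD2
  have h8 := div_le_div_of_nonneg_right hZle (by positivity : 0 ≤ 2 * τ)
  rw [add_div, mul_div_right_comm (27 * _)] at h8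
  rw [hq]
  linarith

end IsStochasticRun

end FCVI

end

/-! ### Assembly of the three bounds. -/

theorem mainTheorem4 {n m : ℕ} {Ω Ξ : Type*} [MeasurableSpace Ω] [MeasurableSpace Ξ]
    (μ : Measure Ω) [IsProbabilityMeasure μ] (P : Measure Ξ) [IsProbabilityMeasure P]
    -- the problem, its constants and a KKT pair
    (X : Set (FCVI.Euc n)) (F : FCVI.Euc n → FCVI.Euc n) (g : FCVI.Euc n → FCVI.Euc m)
    (gradg : Fin m → FCVI.Euc n → FCVI.Euc n)
    (L H : ℝ) (Lgj Hgj : Fin m → ℝ) (Mg : ℝ)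
    (hproblem : FCVI.IsProblem X F g gradg L H Lgj Hgj Mg)
    (xs : FCVI.Euc n) (ls : FCVI.Euc m) (hKKT : FCVI.IsKKTPair X F g xs ls)
    -- the stochastic oracles
    (Fs : FCVI.Euc n → Ξ → FCVI.Euc n) (gs : FCVI.Euc n → Ξ → FCVI.Euc m)
    (Gs : Fin m → FCVI.Euc n → Ξ → FCVI.Euc n)
    (σ σg : ℝ) (σj : Fin m → ℝ) (hσ : 0 ≤ σ) (hσg : 0 ≤ σg) (hσj : ∀ j, 0 ≤ σj j)
    (hFs : FCVI.IsOracle P X Fs F σ) (hgs : FCVI.IsOracle P X gs g σg)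
    (hGs : ∀ j, FCVI.IsOracle P X (Gs j) (gradg j) (σj j))
    -- the constants of the step sizes and of the bounds
    (T : ℕ) (hT : 0 < T) (B : ℝ) (hB : 1 ≤ B)
    (D Lg Hg σG σXg Hstar η τ w : ℝ)
    (hD : D = Metric.diam X) (hD_pos : 0 < D) (hMg_pos : 0 < Mg)
    (hLg : Lg = √(∑ j, Lgj j ^ 2)) (hHg : Hg = √(∑ j, Hgj j ^ 2))
    (hσG : σG = √(∑ j, σj j ^ 2)) (hσXg : σXg = √(σg ^ 2 + D ^ 2 * σG ^ 2))
    (hpos : 0 < H + Hg * B + √2 * σ)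
    (hHstar : Hstar = Hg * (‖ls‖ + 1) + Lg * D * max (‖ls‖ + 1 - B) 0 / 2)
    (hη : η = 8 * L + 8 * Mg * B / D
      + 2 * (H + Hg * B + √2 * σ + 4 * B * σG) / D * √T)
    (hτ : τ = 9 * D / B * max Mg σG + 8 * σXg / B * √T)
    (hw : w = 2.2 * √((6 * ‖ls‖ ^ 2 + 18 * B ^ 2 + (8 * L + Lg * B) * B * D / Mg) * σG ^ 2
      + 4 * (H + √2 * σ + Hstar ^ 2 / (2 * (H + Hg * B + √2 * σ)) + Hg * B / 2) * B * σG))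
    -- the samples and the iterates with `γ_t = θ_t = 1`, `η_t = Lg * B + η`, `τ_t = τ`
    (ξ ξb : ℕ → Ω → Ξ) (hsampling : FCVI.IsSampling μ P T ξ ξb)
    (x0 : FCVI.Euc n) (hx0 : x0 ∈ X)
    (x : ℕ → Ω → FCVI.Euc n) (lam : ℕ → Ω → FCVI.Euc m)
    (hrun : FCVI.IsRun X Fs gs Gs (fun _ => 1) (fun _ => Lg * B + η) (fun _ => τ) T
      ξ ξb x0 x lam)
    (xbar : Ω → FCVI.Euc n) (hxbar : xbar = FCVI.output (fun _ => 1) T x) :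
    -- the noise of the constraint gradients
    (∀ t < T, Integrable (fun a => ‖FCVI.gradNoise Gs gradg ξ x lam t a‖ ^ 2) μ ∧
      ∫ a, ‖FCVI.gradNoise Gs gradg ξ x lam t a‖ ^ 2 ∂μ ≤ w ^ 2) ∧
    -- the expected weak gap
    ((∀ a, BddAbove (FCVI.gapValues X F g (xbar a))) ∧
      Integrable (fun a => FCVI.weakGap X F g (xbar a)) μ ∧
      ∫ a, FCVI.weakGap X F g (xbar a) ∂μ ≤
        3 * ((8 * L + Lg * B) * D + 8 * Mg * B) * D / (2 * T)
        + 3 * (H + √2 * σ + Hg * B + σG * B) * D / √T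
        + (9 * w ^ 2 + 8 * H ^ 2 + 9 * σ ^ 2) * D
          / (4 * (H + Hg * B + √2 * σ + B * σG + 4 * Mg * B / √T) * √T)
        + 9 * σXg * B / (8 * √T)) ∧
    -- the expected infeasibility
    (Integrable (fun a => FCVI.infeasibility g (xbar a)) μ ∧
      ∫ a, FCVI.infeasibility g (xbar a) ∂μ ≤
        ((8 * L + Lg * B) * D + 8 * Mg * B) * D / (2 * T)
        + 9 * max Mg σG * D * (‖ls‖ + 1) ^ 2 / (B * T)
        + (H + √2 * σ + Hg * B + σG * B) * D / √T
        + 2 * (H ^ 2 + Hstar ^ 2 + 2 * σ ^ 2 + w ^ 2) * D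
          / ((H + Hg * B + √2 * σ + B * σG) * √T)
        + 2 * σXg / √T * (B + 4 * (‖ls‖ + 1) ^ 2 / B)) := by

  subst hxbar hD
  have hLg0 : 0 ≤ Lg := hLg ▸ Real.sqrt_nonneg _
  have hHg0 : 0 ≤ Hg := hHg ▸ Real.sqrt_nonneg _
  have hσG0 : 0 ≤ σG := hσG ▸ Real.sqrt_nonneg _
  have hσG2 : σG ^ 2 = ∑ j, σj j ^ 2 := by rw [hσG, Real.sq_sqrt (by positivity)]
  have hT1 : (1 : ℝ) ≤ T := by exact_mod_cast hT
  have hqT : √(T : ℝ) ^ 2 = T := Real.sq_sqrt (by positivity)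
  have hP : FCVI.IsParams L H Mg σ σg σG σXg B (Metric.diam X) Lg Hg
      (H + Hg * B + √2 * σ) η τ (√T) :=
    { L_nonneg := hproblem.L_nonneg
      H_nonneg := hproblem.H_nonneg
      Mg_pos := hMg_pos
      σ_nonneg := hσ
      σg_nonneg := hσg
      σG_nonneg := hσG0
      σXg_nonneg := hσXg ▸ Real.sqrt_nonneg _
      σXg_sq := by rw [hσXg, Real.sq_sqrt (by positivity)]
      one_le_B := hB
      D_pos := hD_pos
      Lg_nonneg := hLg0
      Hg_nonneg := hHg0
      one_le_q := Real.one_le_sqrt.2 hT1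
      S_eq := rfl
      S_pos := hpos
      η_eq := hη
      τ_eq := hτ }
  have hr : FCVI.IsStochasticRun μ P X F g gradg L H Lgj Hgj Mg Fs gs Gs σ σg σj T (Lg * B + η) τ
      ξ ξb x0 x lam :=
    { problem := hproblem
      Mg_nonneg := hMg_pos.le
      oracleF := hFs
      oracleg := hgs
      oracleG := hGs
      sampling := hsampling
      x0_mem := hx0
      c_pos := hP.c_pos
      τ_pos := hP.τ_pos
      run := hrun }
  have hB0 := hP.B_pos
  have hL0 := hP.L_nonneg
  have hH0 := hP.H_nonneg
  have hw2 : w ^ 2 = 4.84 * ((6 * ‖ls‖ ^ 2 + 18 * B ^ 2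
      + (8 * L + Lg * B) * B * Metric.diam X / Mg) * σG ^ 2
      + 4 * (H + √2 * σ + Hstar ^ 2 / (2 * (H + Hg * B + √2 * σ)) + Hg * B / 2) * B * σG) := by
    rw [hw, mul_pow, Real.sq_sqrt (by positivity)]
    norm_num
  have hw0 : 0 ≤ w := by rw [hw]; positivity
  have hδ : ∀ t < T, ∫ a, ‖FCVI.gradNoise Gs gradg ξ x lam t a‖ ^ 2 ∂μ ≤ w ^ 2 := fun t ht =>
    hr.integral_norm_gradNoise_sq_le hP hσG2 hLg hHg hKKT hHstar hw2 ht
  have hne : (FCVI.feasibleSet X g).Nonempty := ⟨xs, hKKT.feasible⟩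
  refine ⟨fun t ht => ⟨FCVI.MemLp.integrable_sq (hr.memLp_gradNoise ht), hδ t ht⟩,
    ⟨fun a => hr.bddAbove_gap _, hr.integrable_weakGap hT hne, ?_⟩,
    hr.integrable_infeasibility hT, ?_⟩
  · have h := hP.gap_le (hP.w_sq_ge hw2) hw0 rfl
      (hr.mul_integral_weakGap_le hT hne hP hσG2 hw0 hδ rfl)
    rw [hqT] at h
    refine h.trans_eq ?_
    ring
  · have h := hP.infeasibility_le (hP.w_sq_ge hw2) rfl
      (hr.mul_integral_infeasibility_le hT hP hσG2 hLg hHg hKKT hHstar hδ rfl)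
    rw [hqT] at h
    refine h.trans_eq ?_
    ring
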